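/- Let $p\neq 2$ be prime and work in $K=\mathbb C_p$. Let $\omega$ be the Teichmüller character (a Dirichlet character modulo $p$) and, for $x\in\mathbb Z_p^\times$, put $\langle x\rangle=x/\omega(x)\in 1+p\mathbb Z_p$ and $\langle x\rangle^{s}=\exp_p(s\log_p\langle x\rangle)$, where $\log_p$ is the $p$-adic logarithm on $\mathbb Z_p^\times$. For $k\ge 0$ and a Dirichlet character $\chi$ modulo $p$ (not replaced by its primitive version) let $B_{k,\chi}$ be the generalized Bernoulli number, $\sum_{a=1}^{p}\chi(a)\frac{te^{at}}{e^{pt}-1}=\sum_k B_{k,\chi}\frac{t^k}{k!}$; in particular $\omega^{-j}$ with $(p-1)\mid j$ is the principal character modulo $p$. Let $$\zeta_{p,1}(s)=\frac1{s-1}\int_{\mathbb Z_p^\times}\langle x\rangle^{1-s}\,dx=\frac{1}{s-1}\lim_{n\to\infty}\frac1{p^n}\sum_{0\le m<p^n,\ p\nmid m}\langle m\rangle^{1-s}$$ (Volkenborn integral). Near $s=1$ the integral exists and $\zeta_{p,1}(s)=\frac{1-1/p}{s-1}+\gamma_p+\cdots$, that is, $\zeta_{p,1}(s)-\frac{1-1/p}{s-1}$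 extends analytically to $s=1$, with value $\gamma_p$ there. Let $\Gamma_p$ be the $p$-adic Gamma function, i.e. the continuous function on $\mathbb Z_p$ with $\Gamma_p(n)=(-1)^n\prod_{0\le m<n,\ p\nmid m}m$ for all integers $n\ge 0$ (such a function exists). Then: (1) $\displaystyle \gamma_p=\lim_{n\to\infty}\frac1{p^n}\Big(1-\frac1p-B_{p^n,\omega^{-1}}\Big)$. (2) $\displaystyle \gamma_p=-\lim_{m\to\infty}\sum_{n=1}^m\frac1n\sum_{j=0}^n\binom nj(-1)^{j+1}B_{j,\omega^{-j}}$. (3) $\gamma_p=\Gamma_p'(1)=\lim_{h\to0,\ 0\ne h\in\mathbb Z_p}\frac{\Gamma_p(1+h)-\Gamma_p(1)}{h}$. (4) $\displaystyle \gamma_p=\frac1p\sum_{a=1}^{p-1}\Big(-\log_p\langle a\rangle\Big)+\sum_{j\ge1}\frac1p\sum_{a=1}^{p-1}\frac{(-1)^j}{j}B_j\frac{p^j}{a^j}$, where $B_j$ are the Bernoulli numbers ($B_1=-\frac12$). Moreover, consider any ultrapower $A\mapsto{}^*A$, let $\mathrm{st}$ be the standard part map of ${}^*\mathbb C_p$,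 let $N\in{}^*\mathbb N$ be infinite, and put $Y^\times=\{m\in{}^*\mathbb N: m<p^N,\ p\nmid m\}$. Let $\nu$ be the internal Haar measure $\nu(\{m\})=p^{-N}$, and $\nu'$ the internal measure $\nu'(\{m\})=(-1)^m/2$. Then the following elements are nearstandard and their standard parts are as stated: (5) $\displaystyle \gamma_p=\mathrm{st}\Big(\frac1{-p^N}\Big(\int_{Y^\times}\langle y\rangle^{p^N}d\nu-(1-\tfrac1p)\Big)\Big)=\mathrm{st}\Big(\frac{-1}{p^N}\Big(\frac1{p^N}\sum_{1\le m\le p^N,\ p\nmid m}\langle m\rangle^{p^N}-(1-\tfrac1p)\Big)\Big)=\mathrm{st}\Big(\frac{-1}{p^N}\Big(B_{p^N,\omega^{-1}}-(1-\tfrac1p)\Big)\Big)$. (6) $\displaystyle \gamma_p=\mathrm{st}\Big(-\int_{Y^\times}\log_p\langle y\rangle\,d\nu\Big)=\mathrm{st}\Big(-\frac1{p^N}\sum_{1\le m\le p^N,\ p\nmid m}\log_p(m)\Big)=\mathrm{st}\Big(-\frac1{p^N}\log_p\Gamma_p(p^N)\Big)$. (7) $\displaystyle \gamma_p=\mathrm{st}\Big(\frac1{p^N}\big(\Gamma_p(p^N+1)-(-1)\big)\Big)=\mathrm{st}\Big(\frac1{p^N}\Big(\frac{p^N!}{p^{N-1}!\,p^{p^{N-1}}}+1\Big)\Big)$.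 (8) There is $M_0\in{}^*\mathbb N$, depending on $N$, such that for all $M\ge M_0$ in ${}^*\mathbb N$ $$\gamma_p=-\mathrm{st}\Big(\frac1{p^N}\int_{Y^\times}\sum_{n=1}^M\binom{p^N}n(\langle y\rangle-1)^n\,d\nu\Big)=-\mathrm{st}\Big(\int_{Y^\times}\sum_{n=1}^M\frac{(-1)^{n+1}}n\sum_{j=0}^n\binom nj\Big(\frac y{\omega(y)}\Big)^j(-1)^{n-j}\,d\nu\Big)$$ $$=-\mathrm{st}\Big(\sum_{n=1}^M\frac{(-1)^{n+1}}n\sum_{j=0}^n\binom nj(-1)^{n-j}\int_{Y^\times}\omega^{-j}(y)y^j\,d\nu\Big).$$ For every infinite $M\in{}^*\mathbb N$ one has $\displaystyle \gamma_p=-\mathrm{st}\Big(\sum_{n=1}^M\frac1n\sum_{j=0}^n\binom nj(-1)^{j+1}B_{j,\omega^{-j}}\Big)$. (9) $\displaystyle \gamma_p=\mathrm{st}\Big(\frac{-1}{1-\langle2\rangle^{p^N}}\int_{Y^\times}\frac1y\langle y\rangle^{p^N}d\nu'-\frac{1-\frac1p}{-p^N}\Big)=\mathrm{st}\Big(\frac1{1-\langle2\rangle^{p^N}}\Big(\sum_{1\le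 m\le p^N,\ p\nmid m}\frac{(-1)^{m+1}}{2m}\langle m\rangle^{p^N}+(1-\tfrac1p)(1-\langle2\rangle^{p^N})\frac1{p^N}\Big)\Big)$ $$=\mathrm{st}\Big(\frac1{1-\langle2\rangle^{p^N}}\Big(\sum_{1\le m\le p^N,\ p\nmid m}\frac{(-1)^{m+1}}{2m}\langle m\rangle^{p^N}-(1-\tfrac1p)\log_p\langle2\rangle\big(1+\tfrac12p^N\log_p\langle2\rangle\big)\Big)\Big).$$ -/

import Mathlib

open Filter Topology

noncomputable section

namespace PadicEM

/-! ### Teichmüller character, logarithm, generalized Bernoulli numbers -/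

/-- The Teichmüller lift `ℤ/p → ℤ_p`, through the identification of `ℤ_p` with the
Witt vectors of `ℤ/p`. -/
def teichmullerLift (p : ℕ) [Fact p.Prime] : ZMod p →* ℤ_[p] :=
  ((WittVector.equiv p : WittVector p (ZMod p) ≃+* ℤ_[p]) :
    WittVector p (ZMod p) →* ℤ_[p]).comp (WittVector.teichmuller p)

/-- The inclusion `ℤ_p → ℂ_p`. -/
def toCp (p : ℕ) [Fact p.Prime] : ℤ_[p] →+* ℂ_[p] :=
  (algebraMap ℚ_[p] ℂ_[p]).comp PadicInt.Coe.ringHom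

/-- The Teichmüller character `ω` as a Dirichlet character modulo `p`. -/
def omega (p : ℕ) [Fact p.Prime] : DirichletCharacter ℂ_[p] p where
  toMonoidHom := ((toCp p : ℤ_[p] →+* ℂ_[p]) : ℤ_[p] →* ℂ_[p]).comp (teichmullerLift p)
  map_nonunit' := by
    intro a ha
    have h0 : a = 0 := by
      by_contra h
      exact ha (isUnit_iff_ne_zero.mpr h)
    subst h0
    simp [teichmullerLift, WittVector.teichmuller_zero]

/-- `ω(x)` for a `p`-adic integer `x`. -/
def teich (p : ℕ) [Fact p.Prime] (x : ℤ_[p]) : ℂ_[p] := omega p (PadicInt.toZMod x)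

/-- `⟨x⟩ = x / ω(x)` for a `p`-adic unit `x`. -/
def angle (p : ℕ) [Fact p.Prime] (x : ℤ_[p]) : ℂ_[p] := toCp p x / teich p x

/-- The logarithm series `∑_{k ≥ 1} (-1)^(k+1) (x - 1)^k / k`, for `|x - 1| < 1`. -/
def logSeries (p : ℕ) [Fact p.Prime] (x : ℂ_[p]) : ℂ_[p] :=
  ∑' k : ℕ, (-1) ^ k * (x - 1) ^ (k + 1) / ((k : ℂ_[p]) + 1)

/-- The `p`-adic logarithm `log_p(x) = log(x^(p-1)) / (p-1)` of a `p`-adic unit `x`: the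
extension of the logarithm series, as a homomorphism, from `1 + pℤ_p` to `ℤ_p^×`. -/
def padicLog (p : ℕ) [Fact p.Prime] (x : ℤ_[p]) : ℂ_[p] :=
  logSeries p (toCp p x ^ (p - 1)) / ((p : ℂ_[p]) - 1)

/-- `⟨x⟩^s = exp_p(s log_p⟨x⟩)`. -/
def anglePow (p : ℕ) [Fact p.Prime] (x : ℤ_[p]) (s : ℂ_[p]) : ℂ_[p] :=
  NormedSpace.exp (s * logSeries p (angle p x))

/-- The generalized Bernoulli number
`B_{k,χ} = f^(k-1) ∑_{a=1}^f χ(a) B_k(a/f)` of a Dirichlet character `χ` modulo `f`, i.e.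
`k!` times the coefficient of `t^k` in `∑_{a=1}^f χ(a) t e^{at} / (e^{ft} - 1)`. The character
is not replaced by the associated primitive one. -/
def genBernoulli {K : Type*} [Field K] [Algebra ℚ K] {f : ℕ} (χ : DirichletCharacter K f)
    (k : ℕ) : K :=
  (f : K) ^ ((k : ℤ) - 1) * ∑ a ∈ Finset.Icc 1 f,
    χ (a : ZMod f) * Polynomial.aeval ((a : K) / (f : K)) (Polynomial.bernoulli k)

/-! ### Volkenborn integral, zeta function, Euler–Mascheroni constant, Gamma function -/

/-- The sum `p^(-n) ∑ f(m)` over `0 ≤ m < p^n` with `p ∤ m`. -/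
def haarSum (p : ℕ) [Fact p.Prime] (f : ℕ → ℂ_[p]) (n : ℕ) : ℂ_[p] :=
  1 / (p : ℂ_[p]) ^ n * ∑ m ∈ Finset.range (p ^ n) with ¬ p ∣ m, f m

/-- `f` has a Volkenborn integral over `ℤ_p^×`. -/
def VolkenbornIntegrable (p : ℕ) [Fact p.Prime] (f : ℤ_[p] → ℂ_[p]) : Prop :=
  ∃ I : ℂ_[p], Tendsto (haarSum p (fun m => f m)) atTop (𝓝 I)

/-- The Volkenborn integral of `f` over `ℤ_p^×`. -/
def volkenborn (p : ℕ) [Fact p.Prime] (f : ℤ_[p] → ℂ_[p]) : ℂ_[p] :=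
  limUnder atTop (haarSum p (fun m => f m))

/-- The Kubota–Leopoldt zeta function
`ζ_{p,i}(s) = (-1)^(i-1) / (s-1) ∫_{ℤ_p^×} ω(x)^(1-i) ⟨x⟩^(1-s) dx`. -/
def zeta (p : ℕ) [Fact p.Prime] (i : ℤ) (s : ℂ_[p]) : ℂ_[p] :=
  (-1) ^ (i - 1) / (s - 1) *
    volkenborn p (fun x => teich p x ^ (1 - i) * anglePow p x (1 - s))

/-- The `p`-adic Euler–Mascheroni constant: the constant term of `ζ_{p,1}` at its simple pole
`s = 1` with residue `1 - 1/p`. -/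
def gammaConst (p : ℕ) [Fact p.Prime] : ℂ_[p] :=
  limUnder (𝓝[≠] (1 : ℂ_[p])) (fun s => zeta p 1 s - (1 - 1 / (p : ℂ_[p])) / (s - 1))

/-- `(-1)^n ∏ m` over `0 ≤ m < n` with `p ∤ m`. -/
def gammaNat (p : ℕ) [Fact p.Prime] (n : ℕ) : ℤ_[p] :=
  (-1) ^ n * ∏ m ∈ Finset.range n with ¬ p ∣ m, (m : ℤ_[p])

/-- The `p`-adic Gamma function, by continuous interpolation of `gammaNat`. -/
def Gamma (p : ℕ) [Fact p.Prime] (x : ℤ_[p]) : ℤ_[p] :=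
  limUnder (comap (fun n : ℕ => (n : ℤ_[p])) (𝓝 x)) (gammaNat p)

/-! ### Nonstandard extensions (ultrapowers)

`*A` is the ultrapower `Germ U A`. The extension to `*ℕ` of a sequence `a` has the value
`Germ.map a N` at `N`. An internal sequence with values in `*ℂ_p` is an element of
`Germ U (ℕ → ℂ_p)`. -/

/-- `N ∈ *ℕ` is infinite. -/
def IsInfinite {ι : Type*} {U : Ultrafilter ι} (N : Germ (U : Filter ι) ℕ) : Prop :=
  ∀ k : ℕ, ((k : ℕ) : Germ (U : Filter ι) ℕ) < N

/-- `x` is nearstandard with standard part `a`: it lies in `*B` for every ball `B` around `a`. -/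
def HasStandardPart {ι : Type*} {U : Ultrafilter ι} {K : Type*} [PseudoMetricSpace K]
    (x : Germ (U : Filter ι) K) (a : K) : Prop :=
  ∀ ε : ℝ, 0 < ε → x.LiftPred (fun y => dist y a < ε)

/-- `p^N ∈ *ℂ_p` for `N ∈ *ℕ`. -/
def hyperPow (p : ℕ) [Fact p.Prime] {ι : Type*} {U : Ultrafilter ι}
    (N : Germ (U : Filter ι) ℕ) : Germ (U : Filter ι) ℂ_[p] :=
  Germ.map (fun n : ℕ => (p : ℂ_[p]) ^ n) N

/-- The integral of an internal function over the hyperfinite set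
`Y^× = {m ∈ *ℕ : m < p^N, p ∤ m}` with respect to the internal Haar measure `ν({m}) = p^(-N)`. -/
def haarIntegral (p : ℕ) [Fact p.Prime] {ι : Type*} {U : Ultrafilter ι}
    (F : Germ (U : Filter ι) (ℕ → ℂ_[p])) (N : Germ (U : Filter ι) ℕ) :
    Germ (U : Filter ι) ℂ_[p] :=
  Germ.map₂ (fun f n => haarSum p f n) F N

/-- The integral of an internal function over `Y^×` with respect to the internal measure
`ν({m}) = (-1)^m / 2`. -/
def altIntegral (p : ℕ) [Fact p.Prime] {ι : Type*} {U : Ultrafilter ι}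
    (F : Germ (U : Filter ι) (ℕ → ℂ_[p])) (N : Germ (U : Filter ι) ℕ) :
    Germ (U : Filter ι) ℂ_[p] :=
  Germ.map₂ (fun f n => ∑ m ∈ Finset.range (p ^ n) with ¬ p ∣ m, f m * ((-1) ^ m / 2)) F N

end PadicEM

end

open PadicEM

noncomputable section

namespace PadicEM

variable {p : ℕ} [Fact p.Prime]

/-! ### Norms in `ℂ_p` -/

/-! Everything reduces to one moment. Expanding `⟨x⟩^(1-s)` in powers of `(1-s) log⟨x⟩` and
integrating termwise over the units, the zeroth moment `1 - 1/p` produces the pole and the first one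
gives `γ = -∫ log⟨x⟩ dx` (`zeta_eq`, `gammaConst_eq`).

The analytic input is `SmoothWith`: uniform first and second order control on residue discs, with a
constant `C` that is multiplicative under products. Shifting a block of length `p^(n+1)` by a
multiple of its length changes its sum by `O(p^(-2n))`. Hence averages converge, are at most `C p^3`
uniformly in `n`, and `(1/h) ∑_{m<h} f m` differs from the integral by `O(|h|)` for `p ∣ h`
(`SmoothWith.norm_sum_div_sub_le`). Since `log⟨x⟩` and `⟨x⟩ - 1` have `C = 1/p`, the averages of
their `k`-th powers are at most `p^3 p^(-k)` for all `n`. This is the majorant for exchanging limits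
with series in these powers.

For powers, `((1+z)^q - 1)/q = ∑ choose(q-1,k)/(k+1) z^(k+1)` and `choose(p^n-1,k) → (-1)^k`, so the
series turns into the logarithm (`tendsto_tsum_choose`). With `z = ⟨x⟩ - 1`, `∫ ⟨x⟩^j dx =
B_{j,ω^(-j)}` and `ω^(p^n) = ω`, this yields the formulas in generalized Bernoulli numbers.
Expanding `log⟨a + xp⟩` in powers of `x`, whose integrals over `ℤ_p` are the `B_j`, yields the
series in ordinary ones.

For Gamma, `log Γ_p(h)` is the indefinite sum of `log⟨m⟩`, so the `O(|h|)` comparison above says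
`log Γ_p(h) = -γh + O(h²)` for `p ∣ h`. Wilson's theorem puts `Γ_p(h)` in `1 + pℤ_p`, where `log x =
(x-1) + O((x-1)²)`, and `Γ_p(h+1) = -Γ_p(h)`. A Lipschitz bound passes from integers to `ℤ_p`.

For the alternating sums, put `q = p^n` and pair `m` with `q - m`, represented once by the even
member and once by the smaller one; doubling matches the two. Expanding to second order gives
`(1-⟨2⟩^q) ∑⟨m⟩^q = q² ∑ (-1)^m ⟨m⟩^q/(2m) + O(q^4)` (`norm_powSum_sub_altSum_le`). Division by
`q²(1-⟨2⟩^q)`, of size `|q|³` up to a constant, leaves `O(q)`.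

An infinite `N` is represented by a function tending to infinity along the ultrafilter, and a limit
along the ultrafilter is a standard part; so the hyperfinite formulas are the standard limits
composed with a representative. -/

lemma one_lt_prime : (1 : ℝ) < p := by
  exact_mod_cast (Fact.out : p.Prime).one_lt

lemma prime_pos : (0 : ℝ) < p := zero_lt_one.trans one_lt_prime

lemma inv_prime_pos : (0 : ℝ) < (p : ℝ)⁻¹ := inv_pos.mpr prime_pos

lemma inv_prime_lt_one : (p : ℝ)⁻¹ < 1 := inv_lt_one_of_one_lt₀ one_lt_prime

lemma toCp_apply (x : ℤ_[p]) : toCp p x = algebraMap ℚ_[p] ℂ_[p] (x : ℚ_[p]) := rfl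

lemma norm_toCp (x : ℤ_[p]) : ‖toCp p x‖ = ‖x‖ := by
  rw [toCp_apply, norm_algebraMap', PadicInt.norm_def]

lemma toCp_injective : Function.Injective (toCp p) := by
  refine (injective_iff_map_eq_zero _).mpr fun x hx => ?_
  rw [← norm_eq_zero, ← norm_toCp, hx, norm_zero]

lemma norm_natCast_eq (n : ℕ) : ‖(n : ℂ_[p])‖ = ‖(n : ℤ_[p])‖ := by
  rw [← map_natCast (toCp p), norm_toCp]

lemma norm_prime : ‖(p : ℂ_[p])‖ = (p : ℝ)⁻¹ := by
  rw [norm_natCast_eq, PadicInt.norm_p]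

lemma norm_prime_pow (n : ℕ) : ‖(p : ℂ_[p]) ^ n‖ = (p : ℝ)⁻¹ ^ n := by
  rw [norm_pow, norm_prime]

lemma prime_ne_zero : (p : ℂ_[p]) ≠ 0 := Nat.cast_ne_zero.mpr (Fact.out : p.Prime).ne_zero

lemma norm_natCast_le_one (n : ℕ) : ‖(n : ℂ_[p])‖ ≤ 1 := by
  rw [norm_natCast_eq]; exact PadicInt.norm_le_one _

lemma norm_natCast_le_inv {n : ℕ} (h : p ∣ n) : ‖(n : ℂ_[p])‖ ≤ (p : ℝ)⁻¹ := by
  obtain ⟨m, rfl⟩ := h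
  rw [Nat.cast_mul, norm_mul, norm_prime]
  exact mul_le_of_le_one_right inv_prime_pos.le (norm_natCast_le_one m)

lemma norm_natCast_eq_one {n : ℕ} (h : ¬ p ∣ n) : ‖(n : ℂ_[p])‖ = 1 := by
  rw [norm_natCast_eq, PadicInt.norm_natCast_eq_one_iff]
  exact ((Fact.out : p.Prime).coprime_iff_not_dvd).mpr h

lemma natCast_ne_zero_of_not_dvd {n : ℕ} (h : ¬ p ∣ n) : (n : ℂ_[p]) ≠ 0 := by
  rw [← norm_ne_zero_iff, norm_natCast_eq_one h]; exact one_ne_zero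

lemma exists_eq_prime_pow_mul {n : ℕ} (hn : n ≠ 0) : ∃ v m : ℕ, ¬ p ∣ m ∧ n = p ^ v * m :=
  let ⟨v, m, h, e⟩ := Nat.exists_eq_pow_mul_and_not_dvd hn p (Fact.out : p.Prime).ne_one
  ⟨v, m, h, e⟩

lemma inv_norm_natCast_le (n : ℕ) : ‖(n : ℂ_[p])‖⁻¹ ≤ n := by
  rcases eq_or_ne n 0 with rfl | hn
  · simp
  obtain ⟨v, m, hm, rfl⟩ := exists_eq_prime_pow_mul (p := p) hn
  have hm1 : 1 ≤ m := Nat.one_le_iff_ne_zero.mpr (by rintro rfl; simp at hm)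
  rw [Nat.cast_mul, norm_mul, norm_natCast_eq_one hm, Nat.cast_pow, norm_prime_pow, mul_one,
    inv_pow, inv_inv]
  exact_mod_cast Nat.le_mul_of_pos_right _ hm1

/-- If `p^v` divides `k + 2` then `v ≤ k`, because `3^v ≥ v + 2` for `v ≥ 1`. Oddness is essential:
`p = 2`, `k = 0` fails. This is what makes the logarithm isometric on the whole disc of radius
`1/p`. -/
lemma inv_norm_natCast_add_two_le (hp : p ≠ 2) (k : ℕ) :
    ‖((k + 2 : ℕ) : ℂ_[p])‖⁻¹ ≤ (p : ℝ) ^ k := by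
  obtain ⟨v, m, hm, e⟩ := exists_eq_prime_pow_mul (p := p) (n := k + 2) (by omega)
  have hm1 : 1 ≤ m := Nat.one_le_iff_ne_zero.mpr (by rintro rfl; simp at hm)
  have hp3 : 3 ≤ p := by
    have := (Fact.out : p.Prime).two_le
    omega
  rw [e, Nat.cast_mul, norm_mul, norm_natCast_eq_one hm, Nat.cast_pow, norm_prime_pow, mul_one,
    inv_pow, inv_inv]
  refine pow_le_pow_right₀ one_lt_prime.le ?_
  have h1 : 3 ^ v ≤ k + 2 := e ▸ (Nat.pow_le_pow_left hp3 v).trans (Nat.le_mul_of_pos_right _ hm1)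
  rcases Nat.eq_zero_or_pos v with rfl | hv
  · omega
  have h2 : ∀ w : ℕ, w + 3 ≤ 3 ^ (w + 1) := by
    intro w
    induction w with
    | zero => norm_num
    | succ w ih => rw [pow_succ]; omega
  have := h2 (v - 1)
  rw [Nat.sub_add_cancel hv] at this
  omega

lemma norm_two (hp : p ≠ 2) : ‖(2 : ℂ_[p])‖ = 1 := by
  have : ¬ p ∣ 2 := fun h => hp ((Nat.prime_dvd_prime_iff_eq Fact.out Nat.prime_two).mp h)
  exact_mod_cast norm_natCast_eq_one this

lemma norm_sum_le_of_forall {ι : Type*} (s : Finset ι) (f : ι → ℂ_[p]) {C : ℝ} (hC : 0 ≤ C)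
    (h : ∀ i ∈ s, ‖f i‖ ≤ C) : ‖∑ i ∈ s, f i‖ ≤ C :=
  IsUltrametricDist.norm_sum_le_of_forall_le_of_nonneg hC h

lemma norm_add_le_of_le {x y : ℂ_[p]} {C : ℝ} (hx : ‖x‖ ≤ C) (hy : ‖y‖ ≤ C) : ‖x + y‖ ≤ C :=
  (IsUltrametricDist.norm_add_le_max x y).trans (max_le hx hy)

lemma norm_sub_le_of_le {x y : ℂ_[p]} {C : ℝ} (hx : ‖x‖ ≤ C) (hy : ‖y‖ ≤ C) : ‖x - y‖ ≤ C := by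
  rw [sub_eq_add_neg]
  exact norm_add_le_of_le hx (by rwa [norm_neg])

lemma norm_tsum_le_of_forall {f : ℕ → ℂ_[p]} {a : ℂ_[p]} (hf : HasSum f a) {C : ℝ} (hC : 0 ≤ C)
    (h : ∀ i, ‖f i‖ ≤ C) : ‖a‖ ≤ C :=
  le_of_tendsto hf.tendsto_sum_nat.norm
    (Eventually.of_forall fun _ => norm_sum_le_of_forall _ _ hC fun i _ => h i)

/-! ### The logarithm series -/

lemma summable_mul_inv_prime_pow :
    Summable fun k : ℕ => ((k : ℝ) + 1) * (p : ℝ)⁻¹ ^ (k + 1) := by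
  have h := summable_pow_mul_geometric_of_norm_lt_one 1
    (r := (p : ℝ)⁻¹) (by rw [norm_inv, Real.norm_natCast]; exact inv_prime_lt_one)
  have h' := (summable_nat_add_iff 1).mpr h
  simpa using h'

lemma inv_norm_natCast_succ_le (k : ℕ) : ‖(k : ℂ_[p]) + 1‖⁻¹ ≤ (k : ℝ) + 1 := by
  exact_mod_cast inv_norm_natCast_le (p := p) (k + 1)

lemma natCast_succ_ne_zero (k : ℕ) : (k : ℂ_[p]) + 1 ≠ 0 := Nat.cast_add_one_ne_zero k

/-- The common majorant of the terms of all series of logarithmic type. -/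
lemma norm_mul_div_succ_le {c w : ℂ_[p]} {B : ℝ} (k : ℕ) (hc : ‖c‖ ≤ 1)
    (hw : ‖w‖ ≤ B * (p : ℝ)⁻¹ ^ (k + 1)) :
    ‖c / ((k : ℂ_[p]) + 1) * w‖ ≤ B * (((k : ℝ) + 1) * (p : ℝ)⁻¹ ^ (k + 1)) := by
  have h0 : 0 ≤ B * (p : ℝ)⁻¹ ^ (k + 1) := (norm_nonneg _).trans hw
  rw [norm_mul, norm_div, div_eq_mul_inv]
  calc ‖c‖ * ‖(k : ℂ_[p]) + 1‖⁻¹ * ‖w‖ ≤ 1 * ((k : ℝ) + 1) * (B * (p : ℝ)⁻¹ ^ (k + 1)) := by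
        gcongr; exact inv_norm_natCast_succ_le k
    _ = _ := by ring

lemma norm_pow_le_inv_prime_pow {z : ℂ_[p]} (hz : ‖z‖ ≤ (p : ℝ)⁻¹) (k : ℕ) :
    ‖z ^ k‖ ≤ (p : ℝ)⁻¹ ^ k := by
  rw [norm_pow]; exact pow_le_pow_left₀ (norm_nonneg _) hz k

lemma hasSum_logSeries {x : ℂ_[p]} (hx : ‖x - 1‖ ≤ (p : ℝ)⁻¹) :
    HasSum (fun k : ℕ => (-1) ^ k / ((k : ℂ_[p]) + 1) * (x - 1) ^ (k + 1)) (logSeries p x) := by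
  have h : Summable (fun k : ℕ => (-1) ^ k / ((k : ℂ_[p]) + 1) * (x - 1) ^ (k + 1)) := by
    refine Summable.of_norm_bounded (summable_mul_inv_prime_pow (p := p)) fun k => ?_
    have := norm_mul_div_succ_le (p := p) (c := (-1) ^ k) (B := 1) k (by simp)
      ((norm_pow_le_inv_prime_pow hx (k + 1)).trans_eq (one_mul _).symm)
    rwa [one_mul] at this
  convert h.hasSum using 1
  exact tsum_congr fun k => by ring

lemma logSeries_one : logSeries p 1 = 0 := by
  have : (fun k : ℕ => (-1) ^ k * ((1 : ℂ_[p]) - 1) ^ (k + 1) / ((k : ℂ_[p]) + 1))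
      = fun _ => 0 := by
    ext k; simp
  rw [logSeries, this, tsum_zero]

lemma norm_logSeries_sub_le (hp : p ≠ 2) {x : ℂ_[p]} (hx : ‖x - 1‖ ≤ (p : ℝ)⁻¹) :
    ‖logSeries p x - (x - 1)‖ ≤ ‖x - 1‖ ^ 2 := by
  have h := (hasSum_nat_add_iff' 1).mpr (hasSum_logSeries hx)
  simp only [Finset.range_one, Finset.sum_singleton, pow_zero, Nat.cast_zero, zero_add, pow_one,
    div_one, one_mul] at h
  refine norm_tsum_le_of_forall h (by positivity) fun k => ?_
  have h2 := inv_norm_natCast_add_two_le hp k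
  have e : (((k + 1 : ℕ) : ℂ_[p]) + 1) = ((k + 2 : ℕ) : ℂ_[p]) := by push_cast; ring
  rw [e, norm_mul, norm_div, norm_pow, norm_neg, norm_one, one_pow, one_div, norm_pow]
  calc ‖((k + 2 : ℕ) : ℂ_[p])‖⁻¹ * ‖x - 1‖ ^ (k + 1 + 1)
      = ‖((k + 2 : ℕ) : ℂ_[p])‖⁻¹ * ‖x - 1‖ ^ k * ‖x - 1‖ ^ 2 := by ring
    _ ≤ (p : ℝ) ^ k * (p : ℝ)⁻¹ ^ k * ‖x - 1‖ ^ 2 := by gcongr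
    _ = ‖x - 1‖ ^ 2 := by
        rw [← mul_pow, mul_inv_cancel₀ prime_pos.ne', one_pow, one_mul]

/-- The linear term strictly dominates the quadratic remainder. In particular the logarithm has
trivial kernel on this disc. -/
lemma norm_logSeries (hp : p ≠ 2) {x : ℂ_[p]} (hx : ‖x - 1‖ ≤ (p : ℝ)⁻¹) :
    ‖logSeries p x‖ = ‖x - 1‖ := by
  rcases eq_or_ne (x - 1) 0 with h | h
  · rw [sub_eq_zero] at h
    rw [h, logSeries_one, sub_self]
  have h1 : ‖logSeries p x - (x - 1)‖ < ‖x - 1‖ := by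
    refine (norm_logSeries_sub_le hp hx).trans_lt ?_
    rw [pow_two]
    exact mul_lt_of_lt_one_left (norm_pos_iff.mpr h) (hx.trans_lt inv_prime_lt_one)
  have := IsUltrametricDist.norm_add_eq_max_of_norm_ne_norm h1.ne
  rw [sub_add_cancel] at this
  rw [this, max_eq_right h1.le]

/-- The binomial theorem with `choose(q,k+1)/q = choose(q-1,k)/(k+1)`. In this form the series has
the denominators of the logarithm and integral numerators, so one majorant serves for both. -/
lemma hasSum_pow_sub_one_div (z : ℂ_[p]) {q : ℕ} (hq : q ≠ 0) :
    HasSum (fun k : ℕ => ((q - 1).choose k : ℂ_[p]) / ((k : ℂ_[p]) + 1) * z ^ (k + 1))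
      (((1 + z) ^ q - 1) / q) := by
  obtain ⟨r, rfl⟩ := Nat.exists_eq_succ_of_ne_zero hq
  have h : ∀ k ∉ Finset.range (r + 1),
      (((r + 1 - 1).choose k : ℕ) : ℂ_[p]) / ((k : ℂ_[p]) + 1) * z ^ (k + 1) = 0 := by
    intro k hk
    rw [Nat.choose_eq_zero_of_lt (by rw [Finset.mem_range] at hk; omega)]
    simp
  convert hasSum_sum_of_ne_finset_zero (L := .unconditional ℕ) h using 1
  have hr : ((r + 1 : ℕ) : ℂ_[p]) ≠ 0 := Nat.cast_ne_zero.mpr (by omega)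
  rw [div_eq_iff hr, add_comm 1 z, add_pow, Finset.sum_range_succ', Finset.sum_mul]
  simp only [one_pow, mul_one, pow_zero, Nat.choose_zero_right, Nat.cast_one,
    add_sub_cancel_right, Nat.add_sub_cancel]
  refine Finset.sum_congr rfl fun k _ => ?_
  have h1 := Nat.add_one_mul_choose_eq r k
  have h2 : ((r + 1 : ℕ) : ℂ_[p]) * (r.choose k : ℂ_[p])
      = ((r + 1).choose (k + 1) : ℂ_[p]) * ((k : ℂ_[p]) + 1) := by exact_mod_cast h1
  have h3 := natCast_succ_ne_zero (p := p) k
  rw [div_mul_eq_mul_div, div_mul_eq_mul_div, eq_div_iff h3]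
  linear_combination (-z ^ (k + 1)) * h2

lemma tendsto_prime_pow : Tendsto (fun n : ℕ => (p : ℂ_[p]) ^ n) atTop (𝓝 0) :=
  tendsto_pow_atTop_nhds_zero_of_norm_lt_one (by rw [norm_prime]; exact inv_prime_lt_one)

/-- By Pascal's rule `choose(q-1,k+1) = choose(q,k+1) - choose(q-1,k)`, and the first term carries a
factor `q = p^n` that tends to `0`. -/
lemma tendsto_choose_prime_pow_sub_one (k : ℕ) :
    Tendsto (fun n : ℕ => ((p ^ n - 1).choose k : ℂ_[p])) atTop (𝓝 ((-1) ^ k)) := by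
  induction k with
  | zero => simp
  | succ k ih =>
    have h1 : ∀ n : ℕ, ((p ^ n - 1).choose (k + 1) : ℂ_[p])
        = (p : ℂ_[p]) ^ n * (((p ^ n - 1).choose k : ℂ_[p]) / ((k : ℂ_[p]) + 1))
          - ((p ^ n - 1).choose k : ℂ_[p]) := by
      intro n
      obtain ⟨r, hr⟩ := Nat.exists_eq_succ_of_ne_zero (pow_ne_zero n (Fact.out : p.Prime).ne_zero)
      have h2 : ((r + 1 : ℕ) : ℂ_[p]) * (r.choose k : ℂ_[p])
          = ((r + 1).choose (k + 1) : ℂ_[p]) * ((k : ℂ_[p]) + 1) := by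
        exact_mod_cast Nat.add_one_mul_choose_eq r k
      have h3 := natCast_succ_ne_zero (p := p) k
      have h4 : (p : ℂ_[p]) ^ n = ((r + 1 : ℕ) : ℂ_[p]) := by exact_mod_cast congrArg Nat.cast hr
      rw [h4, hr, Nat.succ_sub_one, ← mul_div_assoc, h2, mul_div_cancel_right₀ _ h3,
        Nat.choose_succ_succ]
      push_cast
      ring
    simp_rw [h1]
    have := (tendsto_prime_pow (p := p)).mul (ih.div_const ((k : ℂ_[p]) + 1))
    convert this.sub ih using 2
    ring

/-- A series in the coefficients of `((1 + z)^q - 1)/q`, `q = p^n`, converges to the series with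
the coefficients of the logarithm. -/
lemma tendsto_tsum_choose {α : Type*} {l : Filter α} {n : α → ℕ} (hn : Tendsto n l atTop)
    {w : α → ℕ → ℂ_[p]} {w' : ℕ → ℂ_[p]} {B : ℝ}
    (hw : ∀ k, Tendsto (fun a => w a k) l (𝓝 (w' k)))
    (hB : ∀ a k, ‖w a k‖ ≤ B * (p : ℝ)⁻¹ ^ (k + 1)) :
    Tendsto (fun a => ∑' k : ℕ, ((p ^ n a - 1).choose k : ℂ_[p]) / ((k : ℂ_[p]) + 1) * w a k) l
      (𝓝 (∑' k : ℕ, (-1) ^ k / ((k : ℂ_[p]) + 1) * w' k)) := by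
  refine tendsto_tsum_of_dominated_convergence
    ((summable_mul_inv_prime_pow (p := p)).mul_left B) (fun k => ?_)
    (Eventually.of_forall fun a k => norm_mul_div_succ_le k (norm_natCast_le_one _) (hB a k))
  exact (((tendsto_choose_prime_pow_sub_one k).comp hn).div_const _).mul (hw k)

lemma tendsto_pow_sub_one_div {x : ℂ_[p]} (hx : ‖x - 1‖ ≤ (p : ℝ)⁻¹) :
    Tendsto (fun n : ℕ => (x ^ p ^ n - 1) / (p : ℂ_[p]) ^ n) atTop (𝓝 (logSeries p x)) := by
  have h := tendsto_tsum_choose (p := p) (l := atTop) (B := 1) tendsto_id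
    (w := fun _ k => (x - 1) ^ (k + 1)) (w' := fun k => (x - 1) ^ (k + 1))
    (fun k => tendsto_const_nhds)
    (fun _ k => (norm_pow_le_inv_prime_pow hx (k + 1)).trans_eq (one_mul _).symm)
  rw [(hasSum_logSeries hx).tsum_eq] at h
  refine h.congr fun n => ?_
  have := (hasSum_pow_sub_one_div (x - 1) (pow_ne_zero n (Fact.out : p.Prime).ne_zero)).tsum_eq
  simp only [id]
  rw [this]
  push_cast
  rw [add_sub_cancel]

lemma norm_mul_sub_one_le {x y : ℂ_[p]} (hx : ‖x - 1‖ ≤ (p : ℝ)⁻¹) (hy : ‖y - 1‖ ≤ (p : ℝ)⁻¹) :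
    ‖x * y - 1‖ ≤ (p : ℝ)⁻¹ := by
  have e : x * y - 1 = (x - 1) * (y - 1) + (x - 1) + (y - 1) := by ring
  rw [e]
  refine norm_add_le_of_le (norm_add_le_of_le ?_ hx) hy
  rw [norm_mul]
  exact (mul_le_of_le_one_left (norm_nonneg _) (hx.trans inv_prime_lt_one.le)).trans hy

/-- With `log x = lim (x^q - 1)/q`, the identity `(xy)^q - 1 = (x^q-1)(y^q-1) + (x^q-1) + (y^q-1)`
leaves a cross term that is `q` times a convergent quantity. -/
lemma logSeries_mul {x y : ℂ_[p]} (hx : ‖x - 1‖ ≤ (p : ℝ)⁻¹) (hy : ‖y - 1‖ ≤ (p : ℝ)⁻¹) :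
    logSeries p (x * y) = logSeries p x + logSeries p y := by
  have h1 := tendsto_pow_sub_one_div hx
  have h2 := tendsto_pow_sub_one_div hy
  have h3 := tendsto_pow_sub_one_div (norm_mul_sub_one_le hx hy)
  have h4 := ((tendsto_prime_pow (p := p)).mul (h1.mul h2)).add (h1.add h2)
  rw [zero_mul, zero_add] at h4
  refine tendsto_nhds_unique h3 (h4.congr fun n => ?_)
  have := pow_ne_zero n (prime_ne_zero (p := p))
  rw [mul_pow]
  field_simp
  ring

lemma norm_pow_sub_one_le {x : ℂ_[p]} (hx : ‖x - 1‖ ≤ (p : ℝ)⁻¹) (n : ℕ) :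
    ‖x ^ n - 1‖ ≤ (p : ℝ)⁻¹ := by
  induction n with
  | zero => simp
  | succ n ih => rw [pow_succ]; exact norm_mul_sub_one_le ih hx

lemma logSeries_pow {x : ℂ_[p]} (hx : ‖x - 1‖ ≤ (p : ℝ)⁻¹) (n : ℕ) :
    logSeries p (x ^ n) = n * logSeries p x := by
  induction n with
  | zero => simp [logSeries_one]
  | succ n ih =>
    rw [pow_succ, logSeries_mul (norm_pow_sub_one_le hx n) hx, ih]
    push_cast
    ring

/-! ### Functions with a uniform second order expansion on residue discs -/

/-- `f` has derivative `f'` on the residue discs modulo `p`, with the bounds satisfied by a power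
series in `x / p` with coefficients bounded by `C`. -/
structure SmoothWith (C : ℝ) (f f' : ℕ → ℂ_[p]) : Prop where
  norm_le : ∀ m, ‖f m‖ ≤ C
  deriv_le : ∀ m, ‖f' m‖ ≤ C * p
  remainder_le : ∀ m h, p ∣ h → ‖f (m + h) - f m - f' m * h‖ ≤ C * p ^ 2 * ‖(h : ℂ_[p])‖ ^ 2
  deriv_sub_le : ∀ m h, p ∣ h → ‖f' (m + h) - f' m‖ ≤ C * p ^ 2 * ‖(h : ℂ_[p])‖

/-- The average of `f` over `0 ≤ m < p^n`. -/
def avg (f : ℕ → ℂ_[p]) (n : ℕ) : ℂ_[p] := 1 / (p : ℂ_[p]) ^ n * ∑ m ∈ Finset.range (p ^ n), f m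

lemma sum_range_mul_eq {M : Type*} [AddCommMonoid M] (F : ℕ → M) (c q : ℕ) :
    ∑ m ∈ Finset.range (c * q), F m
      = ∑ a ∈ Finset.range c, ∑ m ∈ Finset.range q, F (m + a * q) := by
  induction c with
  | zero => simp
  | succ c ih =>
    rw [Nat.succ_mul, Finset.sum_range_add, ih, Finset.sum_range_succ]
    simp [add_comm]

lemma prime_mul_norm_le_one {h : ℕ} (hh : p ∣ h) : (p : ℝ) * ‖(h : ℂ_[p])‖ ≤ 1 := by
  have := mul_le_mul_of_nonneg_left (norm_natCast_le_inv hh) (prime_pos (p := p)).le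
  rwa [mul_inv_cancel₀ prime_pos.ne'] at this

namespace SmoothWith

variable {C D : ℝ} {f f' g g' : ℕ → ℂ_[p]}

lemma nonneg (hf : SmoothWith C f f') : 0 ≤ C := (norm_nonneg _).trans (hf.norm_le 0)

lemma sub_le (hf : SmoothWith C f f') {m h : ℕ} (hh : p ∣ h) :
    ‖f (m + h) - f m‖ ≤ C * p * ‖(h : ℂ_[p])‖ := by
  have e : f (m + h) - f m = (f (m + h) - f m - f' m * h) + f' m * h := by ring
  have hC := hf.nonneg
  have hp := prime_pos (p := p)
  rw [e]
  refine norm_add_le_of_le ((hf.remainder_le m h hh).trans ?_) ?_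
  · calc C * p ^ 2 * ‖(h : ℂ_[p])‖ ^ 2 = C * p * ‖(h : ℂ_[p])‖ * (p * ‖(h : ℂ_[p])‖) := by ring
      _ ≤ C * p * ‖(h : ℂ_[p])‖ :=
        mul_le_of_le_one_right (by positivity) (prime_mul_norm_le_one hh)
  · rw [norm_mul]
    exact mul_le_mul_of_nonneg_right (hf.deriv_le m) (norm_nonneg _)

lemma const {c : ℂ_[p]} (hc : ‖c‖ ≤ C) : SmoothWith C (fun _ => c) (fun _ => 0) := by
  have hC : 0 ≤ C := (norm_nonneg _).trans hc
  refine ⟨fun _ => hc, fun _ => ?_, fun _ _ _ => ?_, fun _ _ _ => ?_⟩ <;> simp <;> positivity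

lemma natCast : SmoothWith 1 (fun m => (m : ℂ_[p])) (fun _ => 1) := by
  refine ⟨fun m => norm_natCast_le_one m, fun _ => ?_, fun m h _ => ?_, fun _ _ _ => ?_⟩
  · simpa using (one_lt_prime (p := p)).le
  · simp; positivity
  · simp; positivity

/-- Leibniz's rule. The constants multiply exactly, with no numerical factor, because the norm is
ultrametric; this gives the bound `C^k` for `k`-th powers. -/
lemma mul (hf : SmoothWith C f f') (hg : SmoothWith D g g') :
    SmoothWith (C * D) (fun m => f m * g m) (fun m => f' m * g m + f m * g' m) := by
  have hC := hf.nonneg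
  have hD := hg.nonneg
  have hp := prime_pos (p := p)
  refine ⟨fun m => ?_, fun m => ?_, fun m h hh => ?_, fun m h hh => ?_⟩
  · rw [norm_mul]
    exact mul_le_mul (hf.norm_le m) (hg.norm_le m) (norm_nonneg _) hC
  · refine norm_add_le_of_le ?_ ?_ <;> rw [norm_mul]
    · calc _ ≤ C * p * D :=
            mul_le_mul (hf.deriv_le m) (hg.norm_le m) (norm_nonneg _) (by positivity)
        _ = _ := by ring
    · calc _ ≤ C * (D * p) := mul_le_mul (hf.norm_le m) (hg.deriv_le m) (norm_nonneg _) hC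
        _ = _ := by ring
  · have e : f (m + h) * g (m + h) - f m * g m - (f' m * g m + f m * g' m) * h
        = (f (m + h) - f m - f' m * h) * g m + f m * (g (m + h) - g m - g' m * h)
          + (f (m + h) - f m) * (g (m + h) - g m) := by ring
    rw [e]
    refine norm_add_le_of_le (norm_add_le_of_le ?_ ?_) ?_ <;> rw [norm_mul]
    · calc _ ≤ C * p ^ 2 * ‖(h : ℂ_[p])‖ ^ 2 * D :=
            mul_le_mul (hf.remainder_le m h hh) (hg.norm_le m) (norm_nonneg _) (by positivity)
        _ = _ := by ring
    · calc _ ≤ C * (D * p ^ 2 * ‖(h : ℂ_[p])‖ ^ 2) :=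
            mul_le_mul (hf.norm_le m) (hg.remainder_le m h hh) (norm_nonneg _) hC
        _ = _ := by ring
    · calc _ ≤ (C * p * ‖(h : ℂ_[p])‖) * (D * p * ‖(h : ℂ_[p])‖) :=
            mul_le_mul (hf.sub_le hh) (hg.sub_le hh) (norm_nonneg _) (by positivity)
        _ = _ := by ring
  · have e : f' (m + h) * g (m + h) + f (m + h) * g' (m + h) - (f' m * g m + f m * g' m)
        = (f' (m + h) - f' m) * g (m + h) + f' m * (g (m + h) - g m)
          + ((f (m + h) - f m) * g' (m + h) + f m * (g' (m + h) - g' m)) := by ring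
    rw [e]
    refine norm_add_le_of_le (norm_add_le_of_le ?_ ?_) (norm_add_le_of_le ?_ ?_) <;> rw [norm_mul]
    · calc _ ≤ C * p ^ 2 * ‖(h : ℂ_[p])‖ * D :=
            mul_le_mul (hf.deriv_sub_le m h hh) (hg.norm_le _) (norm_nonneg _) (by positivity)
        _ = _ := by ring
    · calc _ ≤ (C * p) * (D * p * ‖(h : ℂ_[p])‖) :=
            mul_le_mul (hf.deriv_le m) (hg.sub_le hh) (norm_nonneg _) (by positivity)
        _ = _ := by ring
    · calc _ ≤ (C * p * ‖(h : ℂ_[p])‖) * (D * p) :=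
            mul_le_mul (hf.sub_le hh) (hg.deriv_le _) (norm_nonneg _) (by positivity)
        _ = _ := by ring
    · calc _ ≤ C * (D * p ^ 2 * ‖(h : ℂ_[p])‖) :=
            mul_le_mul (hf.norm_le m) (hg.deriv_sub_le m h hh) (norm_nonneg _) hC
        _ = _ := by ring

lemma exists_pow (hf : SmoothWith C f f') (k : ℕ) :
    ∃ F', SmoothWith (C ^ k) (fun m => f m ^ k) F' := by
  induction k with
  | zero => exact ⟨_, by simpa using const (p := p) (C := 1) (c := 1) (by simp)⟩
  | succ k ih =>
    obtain ⟨F', hF⟩ := ih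
    exact ⟨_, by simpa only [pow_succ] using hF.mul hf⟩

/-- A range of length `p^(n+2)` is `p` translates of one of length `p^(n+1)`. Equal translates would
contribute a factor `p`, and the Lipschitz bound on `f'` makes the discrepancy just as small. -/
lemma norm_sum_deriv_le (hf : SmoothWith C f f') (n : ℕ) :
    ‖∑ m ∈ Finset.range (p ^ (n + 1)), f' m‖ ≤ C * p ^ 2 * (p : ℝ)⁻¹ ^ n := by
  have hC := hf.nonneg
  have hp := prime_pos (p := p)
  induction n with
  | zero =>
    refine norm_sum_le_of_forall _ _ (by positivity) fun m _ => (hf.deriv_le m).trans ?_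
    rw [pow_zero, mul_one]
    exact mul_le_mul_of_nonneg_left (le_self_pow₀ one_lt_prime.le two_ne_zero) hC
  | succ n ih =>
    have e : ∑ m ∈ Finset.range (p ^ (n + 1 + 1)), f' m
        = p * ∑ m ∈ Finset.range (p ^ (n + 1)), f' m
          + ∑ a ∈ Finset.range p, ∑ m ∈ Finset.range (p ^ (n + 1)),
              (f' (m + a * p ^ (n + 1)) - f' m) := by
      rw [pow_succ' p (n + 1), sum_range_mul_eq]
      simp only [Finset.sum_sub_distrib, Finset.sum_const, Finset.card_range, nsmul_eq_mul]
      ring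
    rw [e]
    refine norm_add_le_of_le ?_ (norm_sum_le_of_forall _ _ (by positivity) fun a _ =>
      norm_sum_le_of_forall _ _ (by positivity) fun m _ => ?_)
    · rw [norm_mul, norm_prime]
      calc _ ≤ (p : ℝ)⁻¹ * (C * p ^ 2 * (p : ℝ)⁻¹ ^ n) := by gcongr
        _ = _ := by ring
    · refine (hf.deriv_sub_le m _ (Dvd.dvd.mul_left (dvd_pow_self p (by omega)) a)).trans ?_
      gcongr
      push_cast
      rw [norm_mul, norm_prime_pow]
      exact mul_le_of_le_one_left (by positivity) (norm_natCast_le_one a)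

/-- Taylor expansion of each translated block: the linear term is the shift, of size `p^(-n-1)`,
times a sum of derivatives that is itself `O(p^(-n))`, and the remainder is quadratic in the shift.
This double gain survives the division by `p^n` in the averages. -/
lemma norm_sum_sub_le (hf : SmoothWith C f f') (c n : ℕ) :
    ‖∑ m ∈ Finset.range (c * p ^ (n + 1)), f m - c * ∑ m ∈ Finset.range (p ^ (n + 1)), f m‖
      ≤ C * p * (p : ℝ)⁻¹ ^ (2 * n) := by
  have hC := hf.nonneg
  have hp := prime_pos (p := p)
  have e : ∑ m ∈ Finset.range (c * p ^ (n + 1)), f m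
        - c * ∑ m ∈ Finset.range (p ^ (n + 1)), f m
      = ∑ a ∈ Finset.range c, (((a * p ^ (n + 1) : ℕ) : ℂ_[p])
            * ∑ m ∈ Finset.range (p ^ (n + 1)), f' m
          + ∑ m ∈ Finset.range (p ^ (n + 1)), (f (m + a * p ^ (n + 1)) - f m
              - f' m * ((a * p ^ (n + 1) : ℕ) : ℂ_[p]))) := by
    rw [sum_range_mul_eq]
    simp only [Finset.sum_sub_distrib, Finset.sum_const, Finset.card_range, nsmul_eq_mul,
      Finset.sum_add_distrib, ← Finset.sum_mul, ← Finset.mul_sum]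
    ring
  have hq : ∀ a : ℕ, ‖((a * p ^ (n + 1) : ℕ) : ℂ_[p])‖ ≤ (p : ℝ)⁻¹ ^ (n + 1) := by
    intro a
    push_cast
    rw [norm_mul, norm_prime_pow]
    exact mul_le_of_le_one_left (by positivity) (norm_natCast_le_one a)
  have hpp : (p : ℝ) * (p : ℝ)⁻¹ = 1 := mul_inv_cancel₀ hp.ne'
  rw [e]
  refine norm_sum_le_of_forall _ _ (by positivity) fun a _ => norm_add_le_of_le ?_
    (norm_sum_le_of_forall _ _ (by positivity) fun m _ => ?_)
  · rw [norm_mul]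
    calc _ ≤ (p : ℝ)⁻¹ ^ (n + 1) * (C * p ^ 2 * (p : ℝ)⁻¹ ^ n) :=
          mul_le_mul (hq a) (hf.norm_sum_deriv_le n) (norm_nonneg _) (by positivity)
      _ = C * p * (p : ℝ)⁻¹ ^ (2 * n) * (p * (p : ℝ)⁻¹) := by ring
      _ = _ := by rw [hpp, mul_one]
  · refine (hf.remainder_le m _ (Dvd.dvd.mul_left (dvd_pow_self p (by omega)) a)).trans ?_
    calc C * p ^ 2 * ‖((a * p ^ (n + 1) : ℕ) : ℂ_[p])‖ ^ 2
        ≤ C * p ^ 2 * ((p : ℝ)⁻¹ ^ (n + 1)) ^ 2 := by gcongr; exact hq a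
      _ = C * (p : ℝ)⁻¹ ^ (2 * n) * (p * (p : ℝ)⁻¹) ^ 2 := by ring
      _ ≤ C * p * (p : ℝ)⁻¹ ^ (2 * n) := by
        rw [hpp, one_pow, mul_one]
        gcongr
        exact le_mul_of_one_le_right hC one_lt_prime.le

lemma norm_avg_succ_sub_le (hf : SmoothWith C f f') (n : ℕ) :
    ‖avg f (n + 2) - avg f (n + 1)‖ ≤ C * p ^ 3 * (p : ℝ)⁻¹ ^ n := by
  have hp0 := prime_ne_zero (p := p)
  have hp := prime_pos (p := p)
  have e : avg f (n + 2) - avg f (n + 1) = 1 / (p : ℂ_[p]) ^ (n + 2) *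
      (∑ m ∈ Finset.range (p * p ^ (n + 1)), f m - p * ∑ m ∈ Finset.range (p ^ (n + 1)), f m) := by
    rw [avg, avg, ← pow_succ', mul_sub]
    congr 1
    field_simp
    ring
  rw [e, norm_mul, norm_div, norm_one, norm_prime_pow]
  calc _ ≤ 1 / (p : ℝ)⁻¹ ^ (n + 2) * (C * p * (p : ℝ)⁻¹ ^ (2 * n)) := by
        gcongr; exact hf.norm_sum_sub_le p n
    _ = _ := by simp only [inv_pow]; field_simp; ring

/-- Successive errors combine by a maximum, so the first one bounds the whole tail. -/
lemma norm_avg_add_sub_le (hf : SmoothWith C f f') (n k : ℕ) :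
    ‖avg f (n + 1 + k) - avg f (n + 1)‖ ≤ C * p ^ 3 * (p : ℝ)⁻¹ ^ n := by
  have hC := hf.nonneg
  induction k with
  | zero => simp; positivity
  | succ k ih =>
    have e : avg f (n + 1 + (k + 1)) - avg f (n + 1)
      = (avg f (n + k + 2) - avg f (n + k + 1)) + (avg f (n + 1 + k) - avg f (n + 1)) := by
      rw [show n + 1 + (k + 1) = n + k + 2 by ring, show n + 1 + k = n + k + 1 by ring]
      ring
    rw [e]
    refine norm_add_le_of_le ((hf.norm_avg_succ_sub_le (n + k)).trans ?_) ih
    rw [pow_add]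
    have : (p : ℝ)⁻¹ ^ k ≤ 1 := pow_le_one₀ inv_prime_pos.le inv_prime_lt_one.le
    gcongr
    exact mul_le_of_le_one_right (by positivity) this

lemma norm_avg_le (hf : SmoothWith C f f') (n : ℕ) : ‖avg f n‖ ≤ C * p ^ 3 := by
  have hC := hf.nonneg
  have h1 := (one_lt_prime (p := p)).le
  have hp := prime_pos (p := p)
  rcases n with _ | n
  · rw [avg]
    simp only [pow_zero, Finset.range_one, Finset.sum_singleton, div_one, one_mul]
    exact (hf.norm_le 0).trans (le_mul_of_one_le_right hC (one_le_pow₀ h1))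
  · have e : avg f (n + 1) = (avg f (0 + 1 + n) - avg f (0 + 1)) + avg f 1 := by
      rw [show 0 + 1 + n = n + 1 by ring]
      ring
    rw [e]
    refine norm_add_le_of_le ((hf.norm_avg_add_sub_le 0 n).trans (by simp)) ?_
    rw [avg, norm_mul, norm_div, norm_one, norm_prime_pow, pow_one, one_div, inv_inv]
    calc _ ≤ (p : ℝ) * C := by
          gcongr
          exact norm_sum_le_of_forall _ _ hC fun m _ => hf.norm_le m
      _ ≤ _ := by
          rw [mul_comm]
          exact mul_le_mul_of_nonneg_left (le_self_pow₀ h1 (by norm_num)) hC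

lemma exists_tendsto_avg (hf : SmoothWith C f f') : ∃ I, Tendsto (avg f) atTop (𝓝 I) := by
  have h : CauchySeq fun n => avg f (n + 1) := by
    refine cauchySeq_of_le_geometric (p : ℝ)⁻¹ (C * p ^ 3) inv_prime_lt_one fun n => ?_
    rw [dist_comm, dist_eq_norm]
    exact hf.norm_avg_succ_sub_le n
  obtain ⟨I, hI⟩ := cauchySeq_tendsto_of_complete h
  exact ⟨I, (tendsto_add_atTop_iff_nat 1).mp hI⟩

/-- The indefinite sum of `f` has derivative `I` at `0`, with a quantitative error. Writing `h =
p^(n+1) c` with `c` prime to `p`, the sum is `c` times a block of length `p^(n+1)` up to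
`O(p^(-2n))`. -/
lemma norm_sum_div_sub_le (hf : SmoothWith C f f') {I : ℂ_[p]} (hI : Tendsto (avg f) atTop (𝓝 I))
    {h : ℕ} (h0 : h ≠ 0) (hh : p ∣ h) :
    ‖(∑ m ∈ Finset.range h, f m) / h - I‖ ≤ C * p ^ 4 * ‖(h : ℂ_[p])‖ := by
  have hC := hf.nonneg
  have hp := prime_pos (p := p)
  have hp0 := prime_ne_zero (p := p)
  obtain ⟨v, c, hc, rfl⟩ := exists_eq_prime_pow_mul (p := p) h0
  obtain ⟨n, rfl⟩ : ∃ n, v = n + 1 := by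
    refine Nat.exists_eq_succ_of_ne_zero ?_
    rintro rfl
    exact hc (by simpa using hh)
  have hnorm : ‖((p ^ (n + 1) * c : ℕ) : ℂ_[p])‖ = (p : ℝ)⁻¹ ^ (n + 1) := by
    push_cast
    rw [norm_mul, norm_natCast_eq_one hc, norm_prime_pow, mul_one]
  have hlim : ‖avg f (n + 1) - I‖ ≤ C * p ^ 3 * (p : ℝ)⁻¹ ^ n := by
    have h1 : Tendsto (fun k => avg f (n + 1 + k)) atTop (𝓝 I) :=
      (tendsto_add_atTop_iff_nat (n + 1)).mpr hI |>.congr fun k => by rw [add_comm]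
    rw [norm_sub_rev]
    exact le_of_tendsto (h1.sub_const _).norm
      (Eventually.of_forall fun k => hf.norm_avg_add_sub_le n k)
  have hcn := natCast_ne_zero_of_not_dvd hc
  have e : (∑ m ∈ Finset.range (p ^ (n + 1) * c), f m) / ((p ^ (n + 1) * c : ℕ) : ℂ_[p]) - I
      = (∑ m ∈ Finset.range (c * p ^ (n + 1)), f m - c * ∑ m ∈ Finset.range (p ^ (n + 1)), f m)
          / ((p ^ (n + 1) * c : ℕ) : ℂ_[p]) + (avg f (n + 1) - I) := by
    rw [avg, mul_comm c]
    push_cast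
    field_simp
    ring
  rw [e, hnorm]
  refine norm_add_le_of_le ?_ (hlim.trans_eq ?_)
  · rw [norm_div, hnorm]
    calc _ ≤ C * p * (p : ℝ)⁻¹ ^ (2 * n) / (p : ℝ)⁻¹ ^ (n + 1) := by
          gcongr; exact hf.norm_sum_sub_le c n
      _ = C * p ^ 3 * (p : ℝ)⁻¹ ^ (n + 1) := by simp only [inv_pow]; field_simp; ring
      _ ≤ _ := by
          gcongr
          · exact one_lt_prime.le
          · norm_num
  · simp only [inv_pow]; field_simp; ring

end SmoothWith

/-! ### The Teichmüller character and the projection to the principal units -/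

/-- Every `p`-adic integer is a natural number plus a multiple of `p`, which leaves no freedom. It
identifies reduction modulo `p` with the constant coefficient of the associated Witt vector. -/
lemma ringHom_eq_toZMod (φ : ℤ_[p] →+* ZMod p) : φ = PadicInt.toZMod := by
  ext x
  have h := PadicInt.toZMod_spec x
  rw [PadicInt.maximalIdeal_eq_span_p, Ideal.mem_span_singleton] at h
  obtain ⟨y, hy⟩ := h
  have h1 := congrArg φ hy
  rw [← ZMod.natCast_val, map_sub, map_mul, map_natCast, map_natCast,
    CharP.cast_eq_zero (ZMod p) p, zero_mul, sub_eq_zero, ZMod.natCast_val, ZMod.cast_id] at h1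
  exact h1

lemma toZMod_teichmullerLift (a : ZMod p) : PadicInt.toZMod (teichmullerLift p a) = a := by
  rw [← ringHom_eq_toZMod ((WittVector.constantCoeff : WittVector p (ZMod p) →+* ZMod p).comp
    ((WittVector.equiv p).symm : ℤ_[p] →+* WittVector p (ZMod p)))]
  simp [teichmullerLift]

lemma teich_eq (x : ℤ_[p]) : teich p x = toCp p (teichmullerLift p (PadicInt.toZMod x)) := rfl

lemma toZMod_ne_zero {x : ℤ_[p]} (hx : IsUnit x) : PadicInt.toZMod x ≠ 0 :=
  (hx.map (PadicInt.toZMod (p := p))).ne_zero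

lemma norm_teich {x : ℤ_[p]} (hx : IsUnit x) : ‖teich p x‖ = 1 := by
  rw [teich_eq, norm_toCp]
  exact PadicInt.isUnit_iff.mp
    (((isUnit_iff_ne_zero.mpr (toZMod_ne_zero hx)).map (teichmullerLift p)))

lemma norm_toCp_unit {x : ℤ_[p]} (hx : IsUnit x) : ‖toCp p x‖ = 1 := by
  rw [norm_toCp]; exact PadicInt.isUnit_iff.mp hx

lemma teich_ne_zero {x : ℤ_[p]} (hx : IsUnit x) : teich p x ≠ 0 := by
  rw [← norm_ne_zero_iff, norm_teich hx]; exact one_ne_zero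

lemma toCp_ne_zero {x : ℤ_[p]} (hx : IsUnit x) : toCp p x ≠ 0 := by
  rw [← norm_ne_zero_iff, norm_toCp_unit hx]; exact one_ne_zero

lemma teich_mul (x y : ℤ_[p]) : teich p (x * y) = teich p x * teich p y := by
  simp only [teich, map_mul]

lemma angle_mul (x y : ℤ_[p]) : angle p (x * y) = angle p x * angle p y := by
  rw [angle, angle, angle, teich_mul, map_mul, mul_div_mul_comm]

lemma teich_add {x h : ℤ_[p]} (hh : (p : ℤ_[p]) ∣ h) : teich p (x + h) = teich p x := by
  obtain ⟨y, rfl⟩ := hh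
  rw [teich, teich, map_add, map_mul, map_natCast, CharP.cast_eq_zero, zero_mul, add_zero]

lemma teich_one : teich p 1 = 1 := by
  rw [teich, map_one, map_one]

lemma angle_add {x h : ℤ_[p]} (hx : IsUnit x) (hh : (p : ℤ_[p]) ∣ h) :
    angle p (x + h) = angle p x * (1 + toCp p h / toCp p x) := by
  have := toCp_ne_zero hx
  rw [angle, angle, teich_add hh, map_add]
  field_simp

lemma angle_eq_toCp {y : ℤ_[p]} (hy : (p : ℤ_[p]) ∣ y - 1) : angle p y = toCp p y := by
  have e : y = 1 + (y - 1) := by ring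
  rw [angle, e, teich_add hy, teich_one, div_one]

lemma norm_le_inv_prime {h : ℤ_[p]} (hh : (p : ℤ_[p]) ∣ h) : ‖h‖ ≤ (p : ℝ)⁻¹ := by
  obtain ⟨y, rfl⟩ := hh
  rw [norm_mul, PadicInt.norm_p]
  exact mul_le_of_le_one_right inv_prime_pos.le (PadicInt.norm_le_one y)

lemma norm_angle_sub_one_le {x : ℤ_[p]} (hx : IsUnit x) : ‖angle p x - 1‖ ≤ (p : ℝ)⁻¹ := by
  rw [angle, div_sub_one (teich_ne_zero hx), norm_div, norm_teich hx, div_one, teich_eq, ← map_sub,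
    norm_toCp]
  refine norm_le_inv_prime ?_
  rw [← Ideal.mem_span_singleton, ← PadicInt.maximalIdeal_eq_span_p, ← PadicInt.ker_toZMod,
    RingHom.mem_ker, map_sub, toZMod_teichmullerLift, sub_self]

lemma norm_angle {x : ℤ_[p]} (hx : IsUnit x) : ‖angle p x‖ = 1 := by
  rw [angle, norm_div, norm_teich hx, norm_toCp_unit hx, div_one]

lemma logSeries_angle_mul {x y : ℤ_[p]} (hx : IsUnit x) (hy : IsUnit y) :
    logSeries p (angle p (x * y)) = logSeries p (angle p x) + logSeries p (angle p y) := by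
  rw [angle_mul, logSeries_mul (norm_angle_sub_one_le hx) (norm_angle_sub_one_le hy)]

lemma logSeries_angle_one : logSeries p (angle p 1) = 0 := by
  rw [angle, teich_one, map_one, div_one, logSeries_one]

lemma logSeries_angle_neg_one : logSeries p (angle p (-1)) = 0 := by
  have h := logSeries_angle_mul (p := p) (x := -1) (y := -1) isUnit_one.neg isUnit_one.neg
  rw [neg_one_mul, neg_neg, logSeries_angle_one, ← two_mul] at h
  exact (mul_eq_zero.mp h.symm).resolve_left two_ne_zero

/-- Raising to the power `p - 1` kills the root of unity `ω(x)`, so `x^(p-1) = ⟨x⟩^(p-1)`. -/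
lemma padicLog_eq {x : ℤ_[p]} (hx : IsUnit x) : padicLog p x = logSeries p (angle p x) := by
  have h1 : angle p x ^ (p - 1) = toCp p x ^ (p - 1) := by
    rw [angle, div_pow, teich, ← map_pow (omega p), ZMod.pow_card_sub_one_eq_one (toZMod_ne_zero hx),
      map_one, div_one]
  have h2 : (p : ℂ_[p]) - 1 = ((p - 1 : ℕ) : ℂ_[p]) := by
    rw [Nat.cast_sub (Fact.out : p.Prime).one_le, Nat.cast_one]
  have h3 : ((p - 1 : ℕ) : ℂ_[p]) ≠ 0 :=
    Nat.cast_ne_zero.mpr (Nat.sub_ne_zero_of_lt (Fact.out : p.Prime).one_lt)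
  rw [padicLog, ← h1, logSeries_pow (norm_angle_sub_one_le hx), h2, mul_div_cancel_left₀ _ h3]

lemma isUnit_natCast {m : ℕ} (hm : ¬ p ∣ m) : IsUnit (m : ℤ_[p]) := by
  rw [PadicInt.isUnit_iff, ← norm_natCast_eq, norm_natCast_eq_one hm]

lemma natCast_dvd {h : ℕ} (hh : p ∣ h) : (p : ℤ_[p]) ∣ (h : ℤ_[p]) := by
  exact_mod_cast Nat.cast_dvd_cast (α := ℤ_[p]) hh

lemma angle_natCast_add {m h : ℕ} (hm : ¬ p ∣ m) (hh : p ∣ h) :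
    angle p ((m + h : ℕ) : ℤ_[p]) = angle p m * (1 + (h : ℂ_[p]) / m) := by
  rw [Nat.cast_add, angle_add (isUnit_natCast hm) (natCast_dvd hh), map_natCast, map_natCast]

lemma norm_div_le_inv_prime {m h : ℕ} (hm : ¬ p ∣ m) (hh : p ∣ h) :
    ‖(h : ℂ_[p]) / m‖ ≤ (p : ℝ)⁻¹ := by
  rw [norm_div, norm_natCast_eq_one hm, div_one]; exact norm_natCast_le_inv hh

lemma logSeries_angle_natCast_add {m h : ℕ} (hm : ¬ p ∣ m) (hh : p ∣ h) :
    logSeries p (angle p ((m + h : ℕ) : ℤ_[p]))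
      = logSeries p (angle p m) + logSeries p (1 + (h : ℂ_[p]) / m) := by
  rw [angle_natCast_add hm hh, logSeries_mul (norm_angle_sub_one_le (isUnit_natCast hm))]
  rw [add_sub_cancel_left]; exact norm_div_le_inv_prime hm hh

/-! ### Extension by zero from the units -/

/-- Extension by zero from the integers prime to `p`. -/
def unitExt (f : ℕ → ℂ_[p]) (m : ℕ) : ℂ_[p] := if p ∣ m then 0 else f m

lemma haarSum_eq_avg (f : ℕ → ℂ_[p]) (n : ℕ) : haarSum p f n = avg (unitExt f) n := by
  rw [haarSum, avg, Finset.sum_filter]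
  simp only [unitExt, ite_not]

lemma smoothWith_unitExt {C : ℝ} (hC : 0 ≤ C) {f f' : ℕ → ℂ_[p]}
    (h1 : ∀ m, ¬ p ∣ m → ‖f m‖ ≤ C) (h2 : ∀ m, ¬ p ∣ m → ‖f' m‖ ≤ C * p)
    (h3 : ∀ m h, ¬ p ∣ m → p ∣ h → ‖f (m + h) - f m - f' m * h‖ ≤ C * p ^ 2 * ‖(h : ℂ_[p])‖ ^ 2)
    (h4 : ∀ m h, ¬ p ∣ m → p ∣ h → ‖f' (m + h) - f' m‖ ≤ C * p ^ 2 * ‖(h : ℂ_[p])‖) :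
    SmoothWith C (unitExt f) (unitExt f') := by
  have hp := prime_pos (p := p)
  constructor
  · intro m
    by_cases hm : p ∣ m
    · simpa [unitExt, hm]
    · simpa [unitExt, hm] using h1 m hm
  · intro m
    by_cases hm : p ∣ m
    · simp only [unitExt, hm, if_true, norm_zero]; positivity
    · simpa [unitExt, hm] using h2 m hm
  · intro m h hh
    by_cases hm : p ∣ m
    · simp only [unitExt, hm, if_true, (Nat.dvd_add_right hm).mpr hh]
      simp only [sub_self, zero_mul, norm_zero]
      positivity
    · have hm' : ¬ p ∣ m + h := mt (Nat.dvd_add_left hh).mp hm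
      simpa [unitExt, hm, hm'] using h3 m h hm hh
  · intro m h hh
    by_cases hm : p ∣ m
    · simp only [unitExt, hm, if_true, (Nat.dvd_add_right hm).mpr hh]
      simp only [sub_self, norm_zero]
      positivity
    · have hm' : ¬ p ∣ m + h := mt (Nat.dvd_add_left hh).mp hm
      simpa [unitExt, hm, hm'] using h4 m h hm hh

lemma smoothWith_unitExt_one : SmoothWith (p := p) 1 (unitExt fun _ => 1) (unitExt fun _ => 0) := by
  have hp := prime_pos (p := p)
  refine smoothWith_unitExt zero_le_one ?_ ?_ ?_ ?_ <;> intros <;> simp <;> positivity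

lemma exists_smoothWith_unitExt_pow {C : ℝ} {f f' : ℕ → ℂ_[p]} (hf : SmoothWith C (unitExt f) f')
    (k : ℕ) : ∃ F', SmoothWith (C ^ k) (unitExt fun m => f m ^ k) F' := by
  obtain ⟨F', hF⟩ := hf.exists_pow k
  -- For `k = 0` the power of the extended function is `0^0 = 1` at multiples of `p`; the indicator
  -- of the units restores the zero there.
  have := smoothWith_unitExt_one.mul hF
  rw [one_mul] at this
  refine ⟨_, (?_ : (fun m => unitExt (fun _ => 1) m * unitExt f m ^ k) = _) ▸ this⟩
  ext m
  by_cases hm : p ∣ m <;> simp [unitExt, hm]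

/-- On a residue disc `ω` is constant, so `⟨x⟩ = x/ω(x)` is affine and the remainder vanishes. -/
lemma smoothWith_angle_sub_one :
    SmoothWith (p := p) (p : ℝ)⁻¹ (unitExt fun m => angle p m - 1)
      (unitExt fun m => (teich p m)⁻¹) := by
  have hp := prime_pos (p := p)
  have ht : ∀ m h : ℕ, p ∣ h → teich p ((m + h : ℕ) : ℤ_[p]) = teich p m := fun m h hh => by
    rw [Nat.cast_add, teich_add (natCast_dvd hh)]
  refine smoothWith_unitExt inv_prime_pos.le
    (fun m hm => norm_angle_sub_one_le (isUnit_natCast hm)) (fun m hm => ?_) (fun m h hm hh => ?_)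
    (fun m h hm hh => ?_)
  · rw [norm_inv, norm_teich (isUnit_natCast hm), inv_one, inv_mul_cancel₀ hp.ne']
  · have e : angle p ((m + h : ℕ) : ℤ_[p]) - 1 - (angle p m - 1) - (teich p m)⁻¹ * h = 0 := by
      rw [angle, angle, ht m h hh, map_natCast, map_natCast]
      push_cast
      ring
    rw [e, norm_zero]; positivity
  · rw [ht m h hh, sub_self, norm_zero]; positivity

lemma norm_inv_add_sub_inv {m h : ℕ} (hm : ¬ p ∣ m) (hh : p ∣ h) :
    ‖((m + h : ℕ) : ℂ_[p])⁻¹ - (m : ℂ_[p])⁻¹‖ = ‖(h : ℂ_[p])‖ := by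
  have h1 := natCast_ne_zero_of_not_dvd hm
  have h2 := natCast_ne_zero_of_not_dvd (mt (Nat.dvd_add_left hh).mp hm)
  have e : (m : ℂ_[p]) - ((m + h : ℕ) : ℂ_[p]) = -h := by push_cast; ring
  rw [inv_sub_inv h2 h1, e, norm_div, norm_mul, norm_natCast_eq_one hm,
    norm_natCast_eq_one (mt (Nat.dvd_add_left hh).mp hm), norm_neg, one_mul, div_one]

lemma one_le_inv_mul_sq : (1 : ℝ) ≤ (p : ℝ)⁻¹ * p ^ 2 := by
  rw [pow_two, ← mul_assoc, inv_mul_cancel₀ prime_pos.ne', one_mul]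
  exact one_lt_prime.le

/-- From `log⟨m+h⟩ = log⟨m⟩ + log(1 + h/m)` and `|log(1+u) - u| ≤ |u|²`. -/
lemma smoothWith_logSeries_angle (hp : p ≠ 2) :
    SmoothWith (p := p) (p : ℝ)⁻¹ (unitExt fun m => logSeries p (angle p m))
      (unitExt fun m => (m : ℂ_[p])⁻¹) := by
  have hp0 := prime_pos (p := p)
  refine smoothWith_unitExt inv_prime_pos.le (fun m hm => ?_) (fun m hm => ?_)
    (fun m h hm hh => ?_) (fun m h hm hh => ?_)
  · have := norm_angle_sub_one_le (isUnit_natCast hm)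
    rwa [norm_logSeries hp this]
  · rw [norm_inv, norm_natCast_eq_one hm, inv_one, inv_mul_cancel₀ hp0.ne']
  · have h1 := norm_div_le_inv_prime hm hh
    rw [logSeries_angle_natCast_add hm hh, add_sub_cancel_left]
    have h2 := norm_logSeries_sub_le hp (x := 1 + (h : ℂ_[p]) / m) (by rwa [add_sub_cancel_left])
    rw [add_sub_cancel_left, norm_div, norm_natCast_eq_one hm, div_one] at h2
    rw [← div_eq_inv_mul]
    exact h2.trans (le_mul_of_one_le_left (by positivity) one_le_inv_mul_sq)
  · rw [norm_inv_add_sub_inv hm hh]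
    exact le_mul_of_one_le_left (by positivity) one_le_inv_mul_sq

lemma smoothWith_inv :
    SmoothWith (p := p) 1 (unitExt fun m => (m : ℂ_[p])⁻¹)
      (unitExt fun m => -(m : ℂ_[p])⁻¹ ^ 2) := by
  have hp0 := prime_pos (p := p)
  have hp1 := one_lt_prime (p := p)
  have hp2 : (1 : ℝ) ≤ 1 * p ^ 2 := by rw [one_mul]; exact one_le_pow₀ hp1.le
  refine smoothWith_unitExt zero_le_one (fun m hm => ?_) (fun m hm => ?_)
    (fun m h hm hh => ?_) (fun m h hm hh => ?_)
  · rw [norm_inv, norm_natCast_eq_one hm, inv_one]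
  · rw [norm_neg, norm_pow, norm_inv, norm_natCast_eq_one hm]
    simpa using hp1.le
  · have h1 := natCast_ne_zero_of_not_dvd hm
    have h2 := natCast_ne_zero_of_not_dvd (mt (Nat.dvd_add_left hh).mp hm)
    have e : ((m + h : ℕ) : ℂ_[p])⁻¹ - (m : ℂ_[p])⁻¹ - -(m : ℂ_[p])⁻¹ ^ 2 * h
        = -(((m + h : ℕ) : ℂ_[p])⁻¹ - (m : ℂ_[p])⁻¹) * (m : ℂ_[p])⁻¹ * h := by
      have e2 : (h : ℂ_[p]) = ((m + h : ℕ) : ℂ_[p]) - m := by push_cast; ring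
      rw [e2]
      field_simp
      ring
    rw [e, norm_mul, norm_mul, norm_neg, norm_inv_add_sub_inv hm hh, norm_inv,
      norm_natCast_eq_one hm, inv_one, mul_one, ← pow_two]
    exact le_mul_of_one_le_left (by positivity) hp2
  · have e : -((m + h : ℕ) : ℂ_[p])⁻¹ ^ 2 - -(m : ℂ_[p])⁻¹ ^ 2
        = -(((m + h : ℕ) : ℂ_[p])⁻¹ - (m : ℂ_[p])⁻¹) *
            (((m + h : ℕ) : ℂ_[p])⁻¹ + (m : ℂ_[p])⁻¹) := by ring
    rw [e, norm_mul, norm_neg, norm_inv_add_sub_inv hm hh]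
    refine (mul_le_of_le_one_right (norm_nonneg _) (norm_add_le_of_le ?_ ?_)).trans
      (le_mul_of_one_le_left (norm_nonneg _) hp2)
    · rw [norm_inv, norm_natCast_eq_one (mt (Nat.dvd_add_left hh).mp hm), inv_one]
    · rw [norm_inv, norm_natCast_eq_one hm, inv_one]

/-! ### Haar sums -/

lemma hasSum_haarSum {F : ℕ → ℕ → ℂ_[p]} {f : ℕ → ℂ_[p]}
    (h : ∀ m, ¬ p ∣ m → HasSum (fun k => F k m) (f m)) (n : ℕ) :
    HasSum (fun k => haarSum p (F k) n) (haarSum p f n) :=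
  (hasSum_sum fun m hm => h m (Finset.mem_filter.mp hm).2).mul_left _

lemma haarSum_congr {f g : ℕ → ℂ_[p]} (h : ∀ m, ¬ p ∣ m → f m = g m) (n : ℕ) :
    haarSum p f n = haarSum p g n := by
  rw [haarSum, haarSum]
  congr 1
  exact Finset.sum_congr rfl fun m hm => h m (Finset.mem_filter.mp hm).2

lemma haarSum_const_mul (c : ℂ_[p]) (f : ℕ → ℂ_[p]) (n : ℕ) :
    haarSum p (fun m => c * f m) n = c * haarSum p f n := by
  rw [haarSum, haarSum, ← Finset.mul_sum]
  ring

lemma haarSum_sub (f g : ℕ → ℂ_[p]) (n : ℕ) :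
    haarSum p (fun m => f m - g m) n = haarSum p f n - haarSum p g n := by
  rw [haarSum, haarSum, haarSum, Finset.sum_sub_distrib]
  ring

lemma haarSum_finsetSum {ι : Type*} (s : Finset ι) (F : ι → ℕ → ℂ_[p]) (n : ℕ) :
    haarSum p (fun m => ∑ i ∈ s, F i m) n = ∑ i ∈ s, haarSum p (F i) n := by
  simp only [haarSum]
  rw [Finset.sum_comm, Finset.mul_sum]

lemma sum_range_mul_prime_unitExt (f : ℕ → ℂ_[p]) (c : ℕ) :
    ∑ m ∈ Finset.range (c * p), unitExt f m
      = ∑ x ∈ Finset.range c, ∑ a ∈ Finset.Icc 1 (p - 1), f (a + x * p) := by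
  rw [sum_range_mul_eq]
  refine Finset.sum_congr rfl fun x _ => ?_
  have hp : p = (p - 1) + 1 := (Nat.sub_add_cancel (Fact.out : p.Prime).one_le).symm
  have e : Finset.Icc 1 (p - 1) = (Finset.range p).erase 0 := by
    ext a
    simp only [Finset.mem_Icc, Finset.mem_erase, Finset.mem_range]
    omega
  have h0 : unitExt f (0 + x * p) = 0 := by simp [unitExt]
  rw [e, ← Finset.sum_erase (Finset.range p) (a := 0) h0]
  refine Finset.sum_congr rfl fun a ha => ?_
  rw [Finset.mem_erase, Finset.mem_range] at ha
  have : ¬ p ∣ a + x * p := fun H =>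
    Nat.not_dvd_of_pos_of_lt (Nat.pos_of_ne_zero ha.1) ha.2
      ((Nat.dvd_add_left (Dvd.intro_left x rfl)).mp H)
  rw [unitExt, if_neg this]

/-- Splitting the units into residue classes `a + xp` turns an integral over the units into
integrals over `ℤ_p`. -/
lemma haarSum_succ (f : ℕ → ℂ_[p]) (n : ℕ) :
    haarSum p f (n + 1)
      = 1 / (p : ℂ_[p]) * ∑ a ∈ Finset.Icc 1 (p - 1), avg (fun x => f (a + x * p)) n := by
  rw [haarSum_eq_avg, avg, pow_succ, pow_succ, sum_range_mul_prime_unitExt, Finset.sum_comm]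
  simp only [avg]
  rw [← Finset.mul_sum]
  have := prime_ne_zero (p := p)
  field_simp

/-- The shift of the index matters: for exponent `0` the only point is `m = 0`, which is not a unit,
and the sum is empty. -/
lemma haarSum_one (n : ℕ) : haarSum p (fun _ => 1) (n + 1) = 1 - 1 / (p : ℂ_[p]) := by
  have := prime_ne_zero (p := p)
  have h2 : ((p - 1 : ℕ) : ℂ_[p]) = (p : ℂ_[p]) - 1 := by
    rw [Nat.cast_sub (Fact.out : p.Prime).one_le, Nat.cast_one]
  rw [haarSum_succ]
  simp only [avg, Finset.sum_const, Finset.card_range, nsmul_eq_mul, mul_one, Nat.card_Icc,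
    Nat.add_sub_cancel, h2]
  push_cast
  field_simp

/-! ### The Laurent expansion of the zeta function -/

lemma tendsto_haarSum_of_smoothWith {C : ℝ} {f f' : ℕ → ℂ_[p]} (hf : SmoothWith C (unitExt f) f') :
    Tendsto (haarSum p f) atTop (𝓝 (limUnder atTop (haarSum p f))) := by
  obtain ⟨I, hI⟩ := hf.exists_tendsto_avg
  exact tendsto_nhds_limUnder ⟨I, by rwa [funext (haarSum_eq_avg f)]⟩

lemma norm_haarSum_le {C : ℝ} {f f' : ℕ → ℂ_[p]} (hf : SmoothWith C (unitExt f) f') (n : ℕ) :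
    ‖haarSum p f n‖ ≤ C * p ^ 3 := by
  rw [haarSum_eq_avg]; exact hf.norm_avg_le n

/-- The moments `∫ (log⟨x⟩)^k dx` over the units. -/
def logMoment (p : ℕ) [Fact p.Prime] (k : ℕ) : ℂ_[p] :=
  limUnder atTop (haarSum p fun m => logSeries p (angle p m) ^ k)

lemma tendsto_logMoment (hp : p ≠ 2) (k : ℕ) :
    Tendsto (haarSum p fun m => logSeries p (angle p m) ^ k) atTop (𝓝 (logMoment p k)) :=
  let ⟨_, h⟩ := exists_smoothWith_unitExt_pow (smoothWith_logSeries_angle hp) k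
  tendsto_haarSum_of_smoothWith h

lemma norm_haarSum_log_pow_le (hp : p ≠ 2) (k n : ℕ) :
    ‖haarSum p (fun m => logSeries p (angle p m) ^ k) n‖ ≤ (p : ℝ)⁻¹ ^ k * p ^ 3 :=
  let ⟨_, h⟩ := exists_smoothWith_unitExt_pow (smoothWith_logSeries_angle hp) k
  norm_haarSum_le h n

lemma norm_logMoment_le (hp : p ≠ 2) (k : ℕ) : ‖logMoment p k‖ ≤ (p : ℝ)⁻¹ ^ k * p ^ 3 :=
  le_of_tendsto (tendsto_logMoment hp k).norm
    (Eventually.of_forall fun n => norm_haarSum_log_pow_le hp k n)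

lemma logMoment_zero (hp : p ≠ 2) : logMoment p 0 = 1 - 1 / (p : ℂ_[p]) := by
  have h := (tendsto_add_atTop_iff_nat 1).mpr (tendsto_logMoment hp 0)
  simp only [pow_zero, haarSum_one] at h
  exact (tendsto_nhds_unique h tendsto_const_nhds)

/-- Legendre's formula in crude form. For `|t| ≤ 1/p` it bounds `t^k/k!` by `1`, and the factor
`p^(-k)` of the `k`-th moment provides convergence. -/
lemma inv_norm_factorial_le (k : ℕ) : ‖(k.factorial : ℂ_[p])‖⁻¹ ≤ (p : ℝ) ^ k := by
  obtain ⟨v, m, hm, e⟩ := exists_eq_prime_pow_mul (p := p) k.factorial_ne_zero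
  have hv : v ≤ k := by
    have h1 := sub_one_mul_padicValNat_factorial (p := p) k
    have h2 : v ≤ padicValNat p k.factorial :=
      (padicValNat_dvd_iff_le k.factorial_ne_zero).mp (e ▸ Dvd.intro _ rfl)
    have h3 : 1 ≤ p - 1 := Nat.le_sub_one_of_lt (Fact.out : p.Prime).one_lt
    calc v ≤ padicValNat p k.factorial := h2
      _ ≤ (p - 1) * padicValNat p k.factorial := Nat.le_mul_of_pos_left _ h3
      _ ≤ k := by rw [h1]; exact Nat.sub_le _ _
  rw [e, Nat.cast_mul, norm_mul, norm_natCast_eq_one hm, Nat.cast_pow, norm_prime_pow, mul_one,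
    inv_pow, inv_inv]
  exact pow_le_pow_right₀ one_lt_prime.le hv

lemma norm_expTerm_le {t w : ℂ_[p]} {B : ℝ} (ht : ‖t‖ ≤ (p : ℝ)⁻¹) {k : ℕ}
    (hw : ‖w‖ ≤ (p : ℝ)⁻¹ ^ k * B) :
    ‖t ^ k / (k.factorial : ℂ_[p]) * w‖ ≤ B * (p : ℝ)⁻¹ ^ k := by
  have h0 : 0 ≤ (p : ℝ)⁻¹ ^ k * B := (norm_nonneg _).trans hw
  rw [norm_mul, norm_div, div_eq_mul_inv]
  calc _ ≤ (p : ℝ)⁻¹ ^ k * (p : ℝ) ^ k * ((p : ℝ)⁻¹ ^ k * B) := by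
        gcongr
        · exact norm_pow_le_inv_prime_pow ht k
        · exact inv_norm_factorial_le k
    _ = _ := by rw [← mul_pow, inv_mul_cancel₀ prime_pos.ne', one_pow]; ring

lemma summable_inv_prime_pow (B : ℝ) : Summable fun k : ℕ => B * (p : ℝ)⁻¹ ^ k :=
  (summable_geometric_of_lt_one inv_prime_pos.le inv_prime_lt_one).mul_left B

lemma hasSum_anglePow (hp : p ≠ 2) {t : ℂ_[p]} (ht : ‖t‖ ≤ (p : ℝ)⁻¹) {x : ℤ_[p]}
    (hx : IsUnit x) :
    HasSum (fun k : ℕ => t ^ k / (k.factorial : ℂ_[p]) * logSeries p (angle p x) ^ k)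
      (anglePow p x t) := by
  have hu := norm_angle_sub_one_le hx
  have hl : ‖logSeries p (angle p x)‖ ≤ (p : ℝ)⁻¹ := by rwa [norm_logSeries hp hu]
  have h : Summable fun k : ℕ =>
      t ^ k / (k.factorial : ℂ_[p]) * logSeries p (angle p x) ^ k :=
    Summable.of_norm_bounded (summable_inv_prime_pow 1) fun k =>
      norm_expTerm_le ht (by rw [mul_one]; exact norm_pow_le_inv_prime_pow hl k)
  convert h.hasSum using 1
  rw [anglePow, NormedSpace.exp_eq_tsum_div]
  exact tsum_congr fun k => by rw [mul_pow]; ring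

lemma tendsto_haarSum_anglePow (hp : p ≠ 2) {t : ℂ_[p]} (ht : ‖t‖ ≤ (p : ℝ)⁻¹) :
    Tendsto (haarSum p fun m => anglePow p m t) atTop
      (𝓝 (∑' k : ℕ, t ^ k / (k.factorial : ℂ_[p]) * logMoment p k)) := by
  have e : ∀ n, haarSum p (fun m => anglePow p m t) n = ∑' k : ℕ, t ^ k / (k.factorial : ℂ_[p]) *
      haarSum p (fun m => logSeries p (angle p m) ^ k) n := by
    intro n
    have := hasSum_haarSum (fun m hm => hasSum_anglePow hp ht (isUnit_natCast hm)) n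
    simp only [haarSum_const_mul] at this
    exact this.tsum_eq.symm
  simp_rw [show (haarSum p fun m => anglePow p m t) = _ from funext e]
  exact tendsto_tsum_of_dominated_convergence (summable_inv_prime_pow (p ^ 3))
    (fun k => (tendsto_logMoment hp k).const_mul _)
    (Eventually.of_forall fun n k => norm_expTerm_le ht (norm_haarSum_log_pow_le hp k n))

/-- The coefficients of the Taylor expansion at `1` of the regular part of the zeta function. -/
def zetaCoeff (p : ℕ) [Fact p.Prime] (k : ℕ) : ℂ_[p] :=
  (-1) ^ (k + 1) / ((k + 1).factorial : ℂ_[p]) * logMoment p (k + 1)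

/-- The regular part of the zeta function at `1`. -/
def zetaRegular (p : ℕ) [Fact p.Prime] (s : ℂ_[p]) : ℂ_[p] :=
  ∑' k : ℕ, (s - 1) ^ k * zetaCoeff p k

lemma norm_zetaCoeff_le (hp : p ≠ 2) (k : ℕ) : ‖zetaCoeff p k‖ ≤ p ^ 3 := by
  rw [zetaCoeff, norm_mul, norm_div, norm_pow, norm_neg, norm_one, one_pow, one_div]
  calc _ ≤ (p : ℝ) ^ (k + 1) * ((p : ℝ)⁻¹ ^ (k + 1) * p ^ 3) := by
        gcongr
        · exact inv_norm_factorial_le _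
        · exact norm_logMoment_le hp _
    _ = _ := by rw [← mul_assoc, ← mul_pow, mul_inv_cancel₀ prime_pos.ne', one_pow, one_mul]

lemma hasSum_zetaRegular (hp : p ≠ 2) {s : ℂ_[p]} (hs : ‖s - 1‖ ≤ (p : ℝ)⁻¹) :
    HasSum (fun k : ℕ => (s - 1) ^ k * zetaCoeff p k) (zetaRegular p s) := by
  refine (Summable.of_norm_bounded (summable_inv_prime_pow (p := p) (p ^ 3)) fun k => ?_).hasSum
  rw [norm_mul, mul_comm]
  exact mul_le_mul (norm_zetaCoeff_le hp k) (norm_pow_le_inv_prime_pow hs k) (norm_nonneg _)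
    (by positivity)

lemma eventually_norm_sub_one_le : ∀ᶠ s in 𝓝 (1 : ℂ_[p]), ‖s - 1‖ ≤ (p : ℝ)⁻¹ := by
  filter_upwards [Metric.closedBall_mem_nhds (1 : ℂ_[p]) (inv_prime_pos (p := p))] with s hs
  rwa [mem_closedBall_iff_norm] at hs

lemma analyticAt_zetaRegular (hp : p ≠ 2) : AnalyticAt ℂ_[p] (zetaRegular p) 1 := by
  refine ⟨FormalMultilinearSeries.ofScalars ℂ_[p] (zetaCoeff p), hasFPowerSeriesAt_iff'.mpr ?_⟩
  filter_upwards [eventually_norm_sub_one_le] with s hs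
  simpa [FormalMultilinearSeries.coeff_ofScalars] using hasSum_zetaRegular hp hs

lemma zeta_eq (hp : p ≠ 2) {s : ℂ_[p]} (hs : ‖s - 1‖ ≤ (p : ℝ)⁻¹) (h1 : s ≠ 1) :
    zeta p 1 s = (1 - 1 / (p : ℂ_[p])) / (s - 1) + zetaRegular p s := by
  have hs' : ‖1 - s‖ ≤ (p : ℝ)⁻¹ := by rwa [norm_sub_rev]
  have hs0 : s - 1 ≠ 0 := sub_ne_zero.mpr h1
  have h2 : volkenborn p (fun x => teich p x ^ ((1 : ℤ) - 1) * anglePow p x (1 - s))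
      = ∑' k : ℕ, (1 - s) ^ k / (k.factorial : ℂ_[p]) * logMoment p k := by
    simp only [sub_self, zpow_zero, one_mul]
    exact (tendsto_haarSum_anglePow hp hs').limUnder_eq
  have h3 : HasSum (fun k : ℕ => (1 - s) ^ k / (k.factorial : ℂ_[p]) * logMoment p k)
      (1 - 1 / (p : ℂ_[p]) + (s - 1) * zetaRegular p s) := by
    have e : ∀ k : ℕ, (1 - s) ^ (k + 1) / ((k + 1).factorial : ℂ_[p]) * logMoment p (k + 1)
        = (s - 1) * ((s - 1) ^ k * zetaCoeff p k) := fun k => by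
      rw [zetaCoeff, ← neg_sub s 1, neg_pow]
      ring
    -- The term `k = 0` is the residue; every later term is divisible by `s - 1`.
    rw [← hasSum_nat_add_iff' 1]
    simp only [e, Finset.sum_range_one, pow_zero, Nat.factorial_zero, Nat.cast_one, div_one,
      one_mul, logMoment_zero hp, add_sub_cancel_left]
    exact (hasSum_zetaRegular hp hs).mul_left (s - 1)
  rw [zeta, h2, h3.tsum_eq]
  simp only [sub_self, zpow_zero]
  field_simp

lemma zetaRegular_one : zetaRegular p 1 = -logMoment p 1 := by
  rw [zetaRegular, tsum_eq_single 0 fun k hk => by rw [sub_self, zero_pow hk, zero_mul]]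
  simp [zetaCoeff]

lemma gammaConst_eq_zetaRegular (hp : p ≠ 2) : gammaConst p = zetaRegular p 1 := by
  refine Tendsto.limUnder_eq ?_
  have h : Tendsto (zetaRegular p) (𝓝[≠] 1) (𝓝 (zetaRegular p 1)) :=
    (analyticAt_zetaRegular hp).continuousAt.tendsto.mono_left nhdsWithin_le_nhds
  refine h.congr' ?_
  filter_upwards [eventually_norm_sub_one_le.filter_mono nhdsWithin_le_nhds, self_mem_nhdsWithin]
    with s hs h1
  rw [zeta_eq hp hs h1, add_sub_cancel_left]

lemma gammaConst_eq (hp : p ≠ 2) : gammaConst p = -logMoment p 1 := by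
  rw [gammaConst_eq_zetaRegular hp, zetaRegular_one]

lemma tendsto_haarSum_log (hp : p ≠ 2) :
    Tendsto (haarSum p fun m => logSeries p (angle p m)) atTop (𝓝 (-gammaConst p)) := by
  rw [gammaConst_eq hp, neg_neg]
  simpa only [pow_one] using tendsto_logMoment hp 1

theorem volkenbornIntegrable_anglePow (hp : p ≠ 2) :
    ∀ᶠ s in 𝓝 (1 : ℂ_[p]), VolkenbornIntegrable p (fun x => anglePow p x (1 - s)) := by
  filter_upwards [eventually_norm_sub_one_le] with s hs
  exact ⟨_, tendsto_haarSum_anglePow hp (by rwa [norm_sub_rev])⟩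

theorem exists_analyticAt_zeta_eq (hp : p ≠ 2) :
    ∃ g : ℂ_[p] → ℂ_[p], AnalyticAt ℂ_[p] g 1 ∧ g 1 = gammaConst p ∧
      ∀ᶠ s in 𝓝[≠] (1 : ℂ_[p]), zeta p 1 s = (1 - 1 / (p : ℂ_[p])) / (s - 1) + g s := by
  refine ⟨zetaRegular p, analyticAt_zetaRegular hp, (gammaConst_eq_zetaRegular hp).symm, ?_⟩
  filter_upwards [eventually_norm_sub_one_le.filter_mono nhdsWithin_le_nhds, self_mem_nhdsWithin]
    with s hs h1
  exact zeta_eq hp hs h1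

/-! ### Bernoulli numbers as limits of averages -/

lemma hasSum_avg {F : ℕ → ℕ → ℂ_[p]} {f : ℕ → ℂ_[p]} (h : ∀ m, HasSum (fun k => F k m) (f m))
    (n : ℕ) : HasSum (fun k => avg (F k) n) (avg f n) :=
  (hasSum_sum fun m _ => h m).mul_left _

lemma avg_const_mul (c : ℂ_[p]) (f : ℕ → ℂ_[p]) (n : ℕ) :
    avg (fun m => c * f m) n = c * avg f n := by
  rw [avg, avg, ← Finset.mul_sum]
  ring

lemma avg_add (f g : ℕ → ℂ_[p]) (n : ℕ) :
    avg (fun m => f m + g m) n = avg f n + avg g n := by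
  rw [avg, avg, avg, Finset.sum_add_distrib, mul_add]

lemma avg_const (c : ℂ_[p]) (n : ℕ) : avg (fun _ => c) n = c := by
  have := pow_ne_zero n (prime_ne_zero (p := p))
  rw [avg, Finset.sum_const, Finset.card_range, nsmul_eq_mul]
  push_cast
  field_simp

lemma avg_finsetSum {ι : Type*} (s : Finset ι) (F : ι → ℕ → ℂ_[p]) (n : ℕ) :
    avg (fun m => ∑ i ∈ s, F i m) n = ∑ i ∈ s, avg (F i) n := by
  simp only [avg]
  rw [Finset.sum_comm, Finset.mul_sum]

/-- By Faulhaber's formula `(1/q) ∑_{x<q} x^j` is a polynomial in `q` with constant term `B_j`, and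
`q = p^n → 0`. -/
lemma tendsto_avg_pow (j : ℕ) :
    Tendsto (avg fun x => (x : ℂ_[p]) ^ j) atTop (𝓝 (bernoulli j : ℂ_[p])) := by
  have hj : ((j : ℂ_[p]) + 1) ≠ 0 := natCast_succ_ne_zero j
  have e : ∀ n, avg (fun x => (x : ℂ_[p]) ^ j) n
      = ∑ i ∈ Finset.range j, (bernoulli i : ℂ_[p]) * ((j + 1).choose i : ℂ_[p])
          / ((j : ℂ_[p]) + 1) * ((p : ℂ_[p]) ^ n) ^ (j - i) + (bernoulli j : ℂ_[p]) := by
    intro n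
    have hq := pow_ne_zero n (prime_ne_zero (p := p))
    have h := congrArg (Rat.cast : ℚ → ℂ_[p]) (sum_range_pow (p ^ n) j)
    push_cast at h
    rw [avg, h, Finset.sum_range_succ, mul_add, Finset.mul_sum]
    congr 1
    · refine Finset.sum_congr rfl fun i hi => ?_
      rw [Finset.mem_range] at hi
      rw [show j + 1 - i = j - i + 1 by omega, pow_succ _ (j - i)]
      field_simp
    · rw [Nat.add_sub_cancel_left, pow_one, Nat.choose_succ_self_right]
      push_cast
      field_simp
  simp_rw [show (avg fun x => (x : ℂ_[p]) ^ j) = _ from funext e]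
  have h0 : Tendsto (fun n : ℕ => ∑ i ∈ Finset.range j, (bernoulli i : ℂ_[p]) *
      ((j + 1).choose i : ℂ_[p]) / ((j : ℂ_[p]) + 1) * ((p : ℂ_[p]) ^ n) ^ (j - i)) atTop
      (𝓝 (∑ i ∈ Finset.range j, 0)) := by
    refine tendsto_finsetSum _ fun i hi => ?_
    rw [Finset.mem_range] at hi
    have := ((tendsto_prime_pow (p := p)).pow (j - i)).const_mul
      ((bernoulli i : ℂ_[p]) * ((j + 1).choose i : ℂ_[p]) / ((j : ℂ_[p]) + 1))
    rwa [zero_pow (by omega), mul_zero] at this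
  simpa using h0.add_const (bernoulli j : ℂ_[p])

lemma norm_avg_pow_le (j n : ℕ) : ‖avg (fun x => (x : ℂ_[p]) ^ j) n‖ ≤ p ^ 3 := by
  obtain ⟨_, h⟩ := (SmoothWith.natCast (p := p)).exists_pow j
  simpa using h.norm_avg_le n

lemma tendsto_avg_add_pow (y : ℂ_[p]) (j : ℕ) :
    Tendsto (avg fun x => ((x : ℂ_[p]) + y) ^ j) atTop
      (𝓝 (Polynomial.aeval y (Polynomial.bernoulli j))) := by
  have e1 : (avg fun x => ((x : ℂ_[p]) + y) ^ j) = fun n => ∑ i ∈ Finset.range (j + 1),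
      y ^ (j - i) * (j.choose i : ℂ_[p]) * avg (fun x => (x : ℂ_[p]) ^ i) n := by
    ext n
    simp only [add_pow, ← avg_const_mul, ← avg_finsetSum]
    congr 1
    ext m
    exact Finset.sum_congr rfl fun i _ => by ring
  have e2 : Polynomial.aeval y (Polynomial.bernoulli j) = ∑ i ∈ Finset.range (j + 1),
      y ^ (j - i) * (j.choose i : ℂ_[p]) * (bernoulli i : ℂ_[p]) := by
    rw [Polynomial.bernoulli, map_sum]
    refine Finset.sum_congr rfl fun i _ => ?_
    rw [Polynomial.aeval_monomial, eq_ratCast]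
    push_cast
    ring
  rw [e1, e2]
  exact tendsto_finsetSum _ fun i _ => (tendsto_avg_pow i).const_mul _

lemma tendsto_haarSum_genBernoulli (χ : DirichletCharacter ℂ_[p] p) (j : ℕ) :
    Tendsto (haarSum p fun m => χ (m : ZMod p) * (m : ℂ_[p]) ^ j) atTop
      (𝓝 (genBernoulli χ j)) := by
  have hp0 := prime_ne_zero (p := p)
  have e1 : ∀ n, haarSum p (fun m => χ (m : ZMod p) * (m : ℂ_[p]) ^ j) (n + 1)
      = 1 / (p : ℂ_[p]) * ∑ a ∈ Finset.Icc 1 (p - 1), χ (a : ZMod p) * (p : ℂ_[p]) ^ j *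
          avg (fun x : ℕ => ((x : ℂ_[p]) + (a : ℂ_[p]) / (p : ℂ_[p])) ^ j) n := by
    intro n
    rw [haarSum_succ]
    congr 1
    refine Finset.sum_congr rfl fun a _ => ?_
    rw [← avg_const_mul]
    congr 1
    ext x
    rw [mul_assoc, ← mul_pow]
    push_cast
    rw [CharP.cast_eq_zero (ZMod p) p, mul_zero, add_zero]
    congr 2
    field_simp
    ring
  have e2 : genBernoulli χ j = 1 / (p : ℂ_[p]) * ∑ a ∈ Finset.Icc 1 (p - 1), χ (a : ZMod p) *
      (p : ℂ_[p]) ^ j * Polynomial.aeval ((a : ℂ_[p]) / p) (Polynomial.bernoulli j) := by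
    have h1 : (p - 1) + 1 = p := Nat.sub_add_cancel (Fact.out : p.Prime).one_le
    have h2 : Finset.Icc 1 p = insert p (Finset.Icc 1 (p - 1)) := by
      ext a
      simp only [Finset.mem_Icc, Finset.mem_insert]
      omega
    -- The endpoint `a = p` drops out because `χ` vanishes on non-units; this holds for the
    -- principal character modulo `p` as well.
    rw [genBernoulli, h2, Finset.sum_insert (by simp only [Finset.mem_Icc]; omega),
      CharP.cast_eq_zero (ZMod p) p, MulCharClass.map_nonunit χ not_isUnit_zero, zero_mul, zero_add,
      zpow_sub_one₀ hp0, zpow_natCast, Finset.mul_sum, Finset.mul_sum]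
    refine Finset.sum_congr rfl fun a _ => ?_
    field_simp
  rw [← tendsto_add_atTop_iff_nat 1, funext e1, e2]
  exact (tendsto_finsetSum _ fun a _ => (tendsto_avg_add_pow _ j).const_mul _).const_mul _

lemma teich_natCast (m : ℕ) : teich p m = omega p (m : ZMod p) := by
  rw [teich, map_natCast]

lemma inv_omega_pow_apply {m : ℕ} (hm : ¬ p ∣ m) (j : ℕ) :
    ((omega p)⁻¹ ^ j) (m : ZMod p) = (teich p m)⁻¹ ^ j := by
  have h0 : (m : ZMod p) ≠ 0 := by rwa [Ne, ZMod.natCast_eq_zero_iff]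
  obtain ⟨v, hv⟩ := isUnit_iff_ne_zero.mpr h0
  rw [teich_natCast, ← hv, MulChar.pow_apply_coe, MulChar.inv_apply_eq_inv']

/-- Frobenius is trivial on `ZMod p`, so `ω^(p^n) = ω`. This is why a single character appears for
all the exponents `p^n`. -/
lemma inv_omega_apply_prime_pow {m : ℕ} (hm : ¬ p ∣ m) (n : ℕ) :
    (omega p)⁻¹ (m : ZMod p) = (teich p m)⁻¹ ^ p ^ n := by
  rw [← pow_one (omega p)⁻¹, inv_omega_pow_apply hm, pow_one, teich_natCast, inv_pow,
    ← map_pow (omega p), ZMod.pow_card_pow]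

lemma angle_natCast_pow (m j : ℕ) :
    angle p m ^ j = (teich p m)⁻¹ ^ j * (m : ℂ_[p]) ^ j := by
  rw [angle, map_natCast, div_pow, div_eq_inv_mul, inv_pow]

lemma tendsto_haarSum_angle_pow (j : ℕ) :
    Tendsto (haarSum p fun m => angle p m ^ j) atTop
      (𝓝 (genBernoulli ((omega p)⁻¹ ^ j) j)) := by
  refine (tendsto_haarSum_genBernoulli ((omega p)⁻¹ ^ j) j).congr fun n => ?_
  exact haarSum_congr (fun m hm => by rw [angle_natCast_pow, inv_omega_pow_apply hm]) n

lemma tendsto_haarSum_angle_prime_pow (n : ℕ) :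
    Tendsto (haarSum p fun m => angle p m ^ p ^ n) atTop
      (𝓝 (genBernoulli (omega p)⁻¹ (p ^ n))) := by
  refine (tendsto_haarSum_genBernoulli (omega p)⁻¹ (p ^ n)).congr fun N => ?_
  exact haarSum_congr
    (fun m hm => by rw [angle_natCast_pow, inv_omega_apply_prime_pow hm n]) N

/-! ### Expansions in powers of `⟨x⟩ - 1` -/

/-- The moments `∫ (⟨x⟩ - 1)^k dx` over the units. -/
def angleMoment (p : ℕ) [Fact p.Prime] (k : ℕ) : ℂ_[p] :=
  limUnder atTop (haarSum p fun m => (angle p m - 1) ^ k)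

lemma tendsto_angleMoment (k : ℕ) :
    Tendsto (haarSum p fun m => (angle p m - 1) ^ k) atTop (𝓝 (angleMoment p k)) :=
  let ⟨_, h⟩ := exists_smoothWith_unitExt_pow smoothWith_angle_sub_one k
  tendsto_haarSum_of_smoothWith h

lemma norm_haarSum_angle_sub_one_pow_le (k n : ℕ) :
    ‖haarSum p (fun m => (angle p m - 1) ^ k) n‖ ≤ p ^ 3 * (p : ℝ)⁻¹ ^ k := by
  obtain ⟨_, h⟩ := exists_smoothWith_unitExt_pow (smoothWith_angle_sub_one (p := p)) k
  rw [mul_comm]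
  exact norm_haarSum_le h n

lemma norm_angleMoment_le (k : ℕ) : ‖angleMoment p k‖ ≤ p ^ 3 * (p : ℝ)⁻¹ ^ k :=
  le_of_tendsto (tendsto_angleMoment k).norm
    (Eventually.of_forall fun n => norm_haarSum_angle_sub_one_pow_le k n)

lemma summable_mul_inv_prime_pow_mul (B : ℝ) :
    Summable fun k : ℕ => B * (((k : ℝ) + 1) * (p : ℝ)⁻¹ ^ (k + 1)) :=
  summable_mul_inv_prime_pow.mul_left B

lemma hasSum_haarSum_log (n : ℕ) :
    HasSum (fun k : ℕ => (-1) ^ k / ((k : ℂ_[p]) + 1) *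
        haarSum p (fun m => (angle p m - 1) ^ (k + 1)) n)
      (haarSum p (fun m => logSeries p (angle p m)) n) := by
  have := hasSum_haarSum
    (fun m hm => hasSum_logSeries (norm_angle_sub_one_le (isUnit_natCast (p := p) hm))) n
  simpa only [haarSum_const_mul] using this

lemma norm_neg_one_pow_le (k : ℕ) : ‖(-1 : ℂ_[p]) ^ k‖ ≤ 1 := by simp

/-- The series `-γ = ∑ (-1)^k / (k + 1) ∫ (⟨x⟩ - 1)^(k + 1) dx`. -/
lemma hasSum_angleMoment (hp : p ≠ 2) :
    HasSum (fun k : ℕ => (-1) ^ k / ((k : ℂ_[p]) + 1) * angleMoment p (k + 1))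
      (-gammaConst p) := by
  have hs : Summable (fun k : ℕ => (-1) ^ k / ((k : ℂ_[p]) + 1) * angleMoment p (k + 1)) :=
    Summable.of_norm_bounded (summable_mul_inv_prime_pow_mul (p := p) (p ^ 3)) fun k =>
      norm_mul_div_succ_le k (norm_neg_one_pow_le k) (norm_angleMoment_le _)
  have h1 := tendsto_tsum_of_dominated_convergence (𝓕 := atTop)
    (f := fun n (k : ℕ) => (-1) ^ k / ((k : ℂ_[p]) + 1) *
        haarSum p (fun m => (angle p m - 1) ^ (k + 1)) n)
    (summable_mul_inv_prime_pow_mul (p := p) (p ^ 3))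
    (fun k => (tendsto_angleMoment (k + 1)).const_mul ((-1) ^ k / ((k : ℂ_[p]) + 1)))
    (Eventually.of_forall fun n k => norm_mul_div_succ_le k (norm_neg_one_pow_le k)
      (norm_haarSum_angle_sub_one_pow_le _ n))
  have h2 := h1.congr fun n => (hasSum_haarSum_log n).tsum_eq
  rw [← tendsto_nhds_unique h2 (tendsto_haarSum_log hp)]
  exact hs.hasSum

lemma hasSum_haarSum_pow_sub_one_div (n N : ℕ) :
    HasSum (fun k : ℕ => ((p ^ n - 1).choose k : ℂ_[p]) / ((k : ℂ_[p]) + 1) *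
        haarSum p (fun m => (angle p m - 1) ^ (k + 1)) N)
      ((haarSum p (fun m => angle p m ^ p ^ n) N - haarSum p (fun _ => 1) N)
        / (p : ℂ_[p]) ^ n) := by
  have := hasSum_haarSum (fun m _ => hasSum_pow_sub_one_div (angle p (m : ℤ_[p]) - 1)
    (pow_ne_zero n (Fact.out : p.Prime).ne_zero)) N
  simp only [haarSum_const_mul, add_sub_cancel] at this
  convert this using 1
  rw [← haarSum_sub, div_eq_inv_mul, ← haarSum_const_mul]
  push_cast
  exact haarSum_congr (fun m _ => by rw [div_eq_inv_mul]) N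

/-- The exponent `p^n` and the length `p^n` of the average grow together. The majorant is uniform in
both, so the diagonal limit needs no iterated limit. -/
lemma tendsto_haarSum_pow_sub_one_div (hp : p ≠ 2) :
    Tendsto (fun n : ℕ => (haarSum p (fun m => angle p m ^ p ^ n) n - haarSum p (fun _ => 1) n)
        / (p : ℂ_[p]) ^ n) atTop (𝓝 (-gammaConst p)) := by
  rw [← (hasSum_angleMoment hp).tsum_eq]
  exact (tendsto_tsum_choose tendsto_id (fun k => tendsto_angleMoment (k + 1))
    (fun n k => norm_haarSum_angle_sub_one_pow_le (k + 1) n)).congr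
      fun n => (hasSum_haarSum_pow_sub_one_div n n).tsum_eq

/-- Here the exponent stays fixed and only the length of the average grows, which turns the Haar sum
into an exact generalized Bernoulli number. -/
lemma tsum_choose_mul_angleMoment (n : ℕ) :
    ∑' k : ℕ, ((p ^ n - 1).choose k : ℂ_[p]) / ((k : ℂ_[p]) + 1) * angleMoment p (k + 1)
      = (genBernoulli (omega p)⁻¹ (p ^ n) - (1 - 1 / (p : ℂ_[p]))) / (p : ℂ_[p]) ^ n := by
  have h1 := tendsto_tsum_of_dominated_convergence (𝓕 := atTop)
    (f := fun N k => ((p ^ n - 1).choose k : ℂ_[p]) / ((k : ℂ_[p]) + 1) *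
        haarSum p (fun m => (angle p m - 1) ^ (k + 1)) N)
    (summable_mul_inv_prime_pow_mul (p := p) (p ^ 3))
    (fun k => (tendsto_angleMoment (k + 1)).const_mul _)
    (Eventually.of_forall fun N k => norm_mul_div_succ_le k (norm_natCast_le_one _)
      (norm_haarSum_angle_sub_one_pow_le _ N))
  have h2 := (h1.congr fun N => (hasSum_haarSum_pow_sub_one_div n N).tsum_eq)
  have h3 : Tendsto (haarSum p fun _ => (1 : ℂ_[p])) atTop (𝓝 (1 - 1 / (p : ℂ_[p]))) := by
    rw [← tendsto_add_atTop_iff_nat 1]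
    simp only [haarSum_one]
    exact tendsto_const_nhds
  exact tendsto_nhds_unique h2
    (((tendsto_haarSum_angle_prime_pow n).sub h3).div_const _)

theorem tendsto_genBernoulli_prime_pow (hp : p ≠ 2) :
    Tendsto (fun n : ℕ => 1 / (p : ℂ_[p]) ^ n *
        (1 - 1 / (p : ℂ_[p]) - genBernoulli (omega p)⁻¹ (p ^ n))) atTop (𝓝 (gammaConst p)) := by
  have h := tendsto_tsum_choose (p := p) tendsto_id (l := atTop)
    (w := fun _ k => angleMoment p (k + 1))
    (fun k => tendsto_const_nhds) (fun _ k => norm_angleMoment_le (k + 1))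
  rw [(hasSum_angleMoment hp).tsum_eq] at h
  rw [← neg_neg (gammaConst p)]
  refine h.neg.congr fun n => ?_
  simp only [id]
  rw [tsum_choose_mul_angleMoment]
  ring

lemma angleMoment_eq (n : ℕ) : angleMoment p n = ∑ j ∈ Finset.range (n + 1),
    (n.choose j : ℂ_[p]) * (-1) ^ (n - j) * genBernoulli ((omega p)⁻¹ ^ j) j := by
  have h : Tendsto (haarSum p fun m => (angle p m - 1) ^ n) atTop
      (𝓝 (∑ j ∈ Finset.range (n + 1),
        (n.choose j : ℂ_[p]) * (-1) ^ (n - j) * genBernoulli ((omega p)⁻¹ ^ j) j)) := by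
    refine (tendsto_finsetSum (Finset.range (n + 1)) fun j _ =>
      (tendsto_haarSum_angle_pow (p := p) j).const_mul
        ((n.choose j : ℂ_[p]) * (-1) ^ (n - j))).congr fun N => ?_
    simp only [← haarSum_const_mul, ← haarSum_finsetSum]
    refine haarSum_congr (fun m _ => ?_) N
    rw [sub_eq_add_neg, add_pow]
    exact Finset.sum_congr rfl fun j _ => by ring
  exact tendsto_nhds_unique (tendsto_angleMoment n) h

lemma sum_Icc_one_eq {M : Type*} [AddCommMonoid M] (F : ℕ → M) (m : ℕ) :
    ∑ n ∈ Finset.Icc 1 m, F n = ∑ k ∈ Finset.range m, F (k + 1) := by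
  rw [Finset.range_eq_Ico, Finset.sum_Ico_add' F 0 m 1, zero_add]
  rfl

theorem tendsto_sum_genBernoulli (hp : p ≠ 2) :
    Tendsto (fun m : ℕ => -∑ n ∈ Finset.Icc 1 m, 1 / (n : ℂ_[p]) *
        ∑ j ∈ Finset.range (n + 1), (n.choose j : ℂ_[p]) * (-1) ^ (j + 1) *
          genBernoulli ((omega p)⁻¹ ^ j) j)
      atTop (𝓝 (gammaConst p)) := by
  have h := (hasSum_angleMoment hp).tendsto_sum_nat.neg
  rw [neg_neg] at h
  refine h.congr fun m => ?_
  rw [sum_Icc_one_eq]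
  congr 1
  refine Finset.sum_congr rfl fun k _ => ?_
  rw [angleMoment_eq, div_eq_inv_mul, one_div, mul_assoc, Finset.mul_sum]
  push_cast
  congr 1
  refine Finset.sum_congr rfl fun j hj => ?_
  rw [Finset.mem_range] at hj
  obtain ⟨i, hi⟩ := Nat.exists_eq_add_of_le (Nat.le_of_lt_succ hj)
  -- The sign of the logarithm series, at index `n = k + 1`, absorbs the sign `(-1)^(n-j)` of the
  -- binomial expansion.
  have e : (-1 : ℂ_[p]) ^ k * (-1) ^ (k + 1 - j) = (-1) ^ (j + 1) := by
    rw [show k + 1 - j = i by omega, ← pow_add]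
    have h3 : k + 1 + i = j + 2 * i := by omega
    have h4 : (-1 : ℂ_[p]) ^ (k + 1 + i) = (-1) ^ (j + 2 * i) := by rw [h3]
    rw [pow_add _ j, pow_mul, neg_one_sq, one_pow, mul_one] at h4
    rw [pow_succ, ← h4]
    ring
  linear_combination ((k + 1).choose j : ℂ_[p]) * genBernoulli ((omega p)⁻¹ ^ j) j * e

/-! ### The series in ordinary Bernoulli numbers -/

lemma hasSum_log_angle_add {a : ℕ} (ha : ¬ p ∣ a) (x : ℕ) :
    HasSum (fun k : ℕ => (-1) ^ k / ((k : ℂ_[p]) + 1) *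
        (((p : ℂ_[p]) / a) ^ (k + 1) * (x : ℂ_[p]) ^ (k + 1)))
      (logSeries p (angle p ((a + x * p : ℕ) : ℤ_[p])) - logSeries p (angle p a)) := by
  have hd : p ∣ x * p := Dvd.intro_left x rfl
  rw [logSeries_angle_natCast_add ha hd, add_sub_cancel_left]
  have h := hasSum_logSeries (p := p) (x := 1 + ((x * p : ℕ) : ℂ_[p]) / a)
    (by rw [add_sub_cancel_left]; exact norm_div_le_inv_prime ha hd)
  convert h using 3 with k
  rw [add_sub_cancel_left, ← mul_pow]
  push_cast
  ring

lemma norm_prime_div_pow_le {a : ℕ} (ha : ¬ p ∣ a) {w : ℂ_[p]} {B : ℝ} (hw : ‖w‖ ≤ B) (k : ℕ) :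
    ‖((p : ℂ_[p]) / a) ^ k * w‖ ≤ B * (p : ℝ)⁻¹ ^ k := by
  rw [norm_mul, norm_pow, norm_div, norm_natCast_eq_one ha, div_one, norm_prime, mul_comm]
  gcongr

/-- Any bound uniform in `j` suffices for convergence, and the uniform bound on averages passes to
the limit. -/
lemma norm_bernoulli_le (j : ℕ) : ‖(bernoulli j : ℂ_[p])‖ ≤ p ^ 3 :=
  le_of_tendsto (tendsto_avg_pow j).norm (Eventually.of_forall fun n => norm_avg_pow_le j n)

lemma tendsto_avg_log_angle {a : ℕ} (ha : ¬ p ∣ a) :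
    Tendsto (avg fun x => logSeries p (angle p ((a + x * p : ℕ) : ℤ_[p]))) atTop
      (𝓝 (logSeries p (angle p a) + ∑' k : ℕ, (-1) ^ k / ((k : ℂ_[p]) + 1) *
        (((p : ℂ_[p]) / a) ^ (k + 1) * (bernoulli (k + 1) : ℂ_[p])))) := by
  have e : (avg fun x => logSeries p (angle p ((a + x * p : ℕ) : ℤ_[p])))
      = fun n => logSeries p (angle p a) + ∑' k : ℕ, (-1) ^ k / ((k : ℂ_[p]) + 1) *
        (((p : ℂ_[p]) / a) ^ (k + 1) * avg (fun x => (x : ℂ_[p]) ^ (k + 1)) n) := by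
    ext n
    have h := hasSum_avg (fun x => hasSum_log_angle_add ha x) n
    simp only [avg_const_mul] at h
    rw [h.tsum_eq, ← avg_const (logSeries p (angle p (a : ℤ_[p]))) n, ← avg_add]
    simp only [avg_const, add_sub_cancel]
  rw [e]
  refine (tendsto_tsum_of_dominated_convergence
    (summable_mul_inv_prime_pow_mul (p := p) (p ^ 3))
    (fun k => ((tendsto_avg_pow (k + 1)).const_mul _).const_mul _)
    (Eventually.of_forall fun N k => norm_mul_div_succ_le k (norm_neg_one_pow_le k)
      (norm_prime_div_pow_le ha (norm_avg_pow_le _ _) _))).const_add _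

theorem hasSum_bernoulli (hp : p ≠ 2) :
    HasSum (fun j : ℕ => 1 / (p : ℂ_[p]) * ∑ a ∈ Finset.Icc 1 (p - 1),
        (-1) ^ (j + 1) / ((j : ℂ_[p]) + 1) * (bernoulli (j + 1) : ℂ_[p]) *
          ((p : ℂ_[p]) ^ (j + 1) / (a : ℂ_[p]) ^ (j + 1)))
      (gammaConst p - 1 / (p : ℂ_[p]) * ∑ a ∈ Finset.Icc 1 (p - 1),
        -logSeries p (angle p (a : ℤ_[p]))) := by
  have hdvd : ∀ a ∈ Finset.Icc 1 (p - 1), ¬ p ∣ a := by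
    intro a ha
    rw [Finset.mem_Icc] at ha
    exact Nat.not_dvd_of_pos_of_lt ha.1 (by omega)
  have h1 : Tendsto (fun n => haarSum p (fun m => logSeries p (angle p m)) (n + 1)) atTop
      (𝓝 (1 / (p : ℂ_[p]) * ∑ a ∈ Finset.Icc 1 (p - 1), (logSeries p (angle p a) +
        ∑' k : ℕ, (-1) ^ k / ((k : ℂ_[p]) + 1) *
          (((p : ℂ_[p]) / a) ^ (k + 1) * (bernoulli (k + 1) : ℂ_[p]))))) := by
    simp only [haarSum_succ]
    exact (tendsto_finsetSum _ fun a ha => tendsto_avg_log_angle (hdvd a ha)).const_mul _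
  have h2 := tendsto_nhds_unique h1 ((tendsto_add_atTop_iff_nat 1).mpr (tendsto_haarSum_log hp))
  have h3 : HasSum (fun k : ℕ => 1 / (p : ℂ_[p]) * ∑ a ∈ Finset.Icc 1 (p - 1),
      (-1) ^ k / ((k : ℂ_[p]) + 1) *
          (((p : ℂ_[p]) / a) ^ (k + 1) * (bernoulli (k + 1) : ℂ_[p])))
      (1 / (p : ℂ_[p]) * ∑ a ∈ Finset.Icc 1 (p - 1), ∑' k : ℕ, (-1) ^ k / ((k : ℂ_[p]) + 1) *
          (((p : ℂ_[p]) / a) ^ (k + 1) * (bernoulli (k + 1) : ℂ_[p]))) := by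
    refine (hasSum_sum fun a ha => Summable.hasSum ?_).mul_left _
    exact Summable.of_norm_bounded (summable_mul_inv_prime_pow_mul (p := p) (p ^ 3)) fun k =>
      norm_mul_div_succ_le k (norm_neg_one_pow_le k)
        (norm_prime_div_pow_le (hdvd a ha) (norm_bernoulli_le _) _)
  rw [Finset.sum_add_distrib, mul_add] at h2
  have e1 : ∀ k : ℕ, 1 / (p : ℂ_[p]) * ∑ a ∈ Finset.Icc 1 (p - 1),
        (-1) ^ (k + 1) / ((k : ℂ_[p]) + 1) * (bernoulli (k + 1) : ℂ_[p]) *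
          ((p : ℂ_[p]) ^ (k + 1) / (a : ℂ_[p]) ^ (k + 1))
      = -(1 / (p : ℂ_[p]) * ∑ a ∈ Finset.Icc 1 (p - 1), (-1) ^ k / ((k : ℂ_[p]) + 1) *
          (((p : ℂ_[p]) / a) ^ (k + 1) * (bernoulli (k + 1) : ℂ_[p]))) := by
    intro k
    rw [← mul_neg, ← Finset.sum_neg_distrib]
    congr 1
    refine Finset.sum_congr rfl fun a _ => ?_
    rw [div_pow]
    ring
  have e2 : gammaConst p - 1 / (p : ℂ_[p]) * ∑ a ∈ Finset.Icc 1 (p - 1),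
        -logSeries p (angle p (a : ℤ_[p]))
      = -(1 / (p : ℂ_[p]) * ∑ a ∈ Finset.Icc 1 (p - 1), ∑' k : ℕ, (-1) ^ k / ((k : ℂ_[p]) + 1) *
          (((p : ℂ_[p]) / a) ^ (k + 1) * (bernoulli (k + 1) : ℂ_[p]))) := by
    rw [Finset.sum_neg_distrib]
    linear_combination h2
  simp only [e1]
  rw [e2]
  exact h3.neg

/-! ### Averages of exponentially growing powers -/

omit [Fact p.Prime] in
lemma sum_Icc_filter_eq {M : Type*} [AddCommMonoid M] (F : ℕ → M) {n : ℕ} (hn : n ≠ 0) :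
    ∑ m ∈ Finset.Icc 1 (p ^ n) with ¬ p ∣ m, F m
      = ∑ m ∈ Finset.range (p ^ n) with ¬ p ∣ m, F m := by
  congr 1
  ext m
  simp only [Finset.mem_filter, Finset.mem_Icc, Finset.mem_range]
  constructor
  · rintro ⟨⟨_, h2⟩, h3⟩
    exact ⟨lt_of_le_of_ne h2 (by rintro rfl; exact h3 (dvd_pow_self p hn)), h3⟩
  · rintro ⟨h2, h3⟩
    exact ⟨⟨Nat.one_le_iff_ne_zero.mpr (by rintro rfl; exact h3 (dvd_zero p)), h2.le⟩, h3⟩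

lemma haarSum_one_of_ne_zero {n : ℕ} (hn : n ≠ 0) :
    haarSum p (fun _ => 1) n = 1 - 1 / (p : ℂ_[p]) := by
  obtain ⟨k, rfl⟩ := Nat.exists_eq_succ_of_ne_zero hn
  exact haarSum_one k

theorem tendsto_haarSum_angle_pow_self (hp : p ≠ 2) :
    Tendsto (fun n : ℕ => 1 / (-(p : ℂ_[p]) ^ n) *
      (haarSum p (fun m : ℕ => angle p m ^ p ^ n) n - (1 - 1 / (p : ℂ_[p])))) atTop
      (𝓝 (gammaConst p)) := by
  rw [← neg_neg (gammaConst p)]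
  refine (tendsto_haarSum_pow_sub_one_div hp).neg.congr' ?_
  filter_upwards [eventually_ne_atTop 0] with n hn
  rw [haarSum_one_of_ne_zero hn, one_div_neg_eq_neg_one_div, div_eq_inv_mul]
  ring

theorem tendsto_sum_Icc_angle_pow_self (hp : p ≠ 2) :
    Tendsto (fun n : ℕ => -1 / (p : ℂ_[p]) ^ n *
      (1 / (p : ℂ_[p]) ^ n * (∑ m ∈ Finset.Icc 1 (p ^ n) with ¬ p ∣ m, angle p m ^ p ^ n)
        - (1 - 1 / (p : ℂ_[p])))) atTop (𝓝 (gammaConst p)) := by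
  refine (tendsto_haarSum_angle_pow_self hp).congr' ?_
  filter_upwards [eventually_ne_atTop 0] with n hn
  rw [sum_Icc_filter_eq _ hn, haarSum]
  ring

theorem tendsto_neg_genBernoulli_prime_pow (hp : p ≠ 2) :
    Tendsto (fun n : ℕ => -1 / (p : ℂ_[p]) ^ n *
        (genBernoulli (omega p)⁻¹ (p ^ n) - (1 - 1 / (p : ℂ_[p])))) atTop (𝓝 (gammaConst p)) :=
  (tendsto_genBernoulli_prime_pow hp).congr fun n => by ring

theorem tendsto_neg_haarSum_log (hp : p ≠ 2) :
    Tendsto (fun n : ℕ => -haarSum p (fun m => logSeries p (angle p m)) n) atTop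
      (𝓝 (gammaConst p)) := by
  simpa using (tendsto_haarSum_log hp).neg

theorem tendsto_sum_Icc_padicLog (hp : p ≠ 2) :
    Tendsto (fun n : ℕ => -(1 / (p : ℂ_[p]) ^ n *
      ∑ m ∈ Finset.Icc 1 (p ^ n) with ¬ p ∣ m, padicLog p m)) atTop (𝓝 (gammaConst p)) := by
  refine (tendsto_neg_haarSum_log hp).congr' ?_
  filter_upwards [eventually_ne_atTop 0] with n hn
  rw [sum_Icc_filter_eq _ hn, haarSum]
  congr 2
  exact Finset.sum_congr rfl fun m hm =>
    (padicLog_eq (isUnit_natCast (Finset.mem_filter.mp hm).2)).symm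

/-! ### Truncated binomial and logarithmic expansions -/

lemma sum_Icc_choose_mul_pow (x : ℂ_[p]) {q M : ℕ} (h : q ≤ M) :
    ∑ k ∈ Finset.Icc 1 M, (q.choose k : ℂ_[p]) * (x - 1) ^ k = x ^ q - 1 := by
  have h1 : x ^ q = ∑ k ∈ Finset.range (M + 1), (q.choose k : ℂ_[p]) * (x - 1) ^ k := by
    nth_rw 1 [← sub_add_cancel x 1]
    rw [add_pow]
    have h2 : Finset.range (q + 1) ⊆ Finset.range (M + 1) :=
      Finset.range_subset_range.mpr (by omega)
    rw [← Finset.sum_subset h2]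
    · exact Finset.sum_congr rfl fun k _ => by rw [one_pow, mul_one, mul_comm]
    · intro k _ hk
      rw [Finset.mem_range, not_lt] at hk
      rw [Nat.choose_eq_zero_of_lt (by omega), Nat.cast_zero, zero_mul]
  rw [sum_Icc_one_eq, h1, Finset.sum_range_succ']
  simp

theorem tendsto_haarSum_sum_choose (hp : p ≠ 2) {α : Type*} {l : Filter α} {n M : α → ℕ}
    (hn : Tendsto n l atTop) (hM : ∀ᶠ a in l, p ^ n a ≤ M a) :
    Tendsto (fun a => -(1 / (p : ℂ_[p]) ^ n a * haarSum p (fun m => ∑ k ∈ Finset.Icc 1 (M a),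
      ((p ^ n a).choose k : ℂ_[p]) * (angle p m - 1) ^ k) (n a))) l (𝓝 (gammaConst p)) := by
  rw [← neg_neg (gammaConst p)]
  refine ((tendsto_haarSum_pow_sub_one_div hp).neg.comp hn).congr' ?_
  filter_upwards [hM] with a ha
  simp only [sum_Icc_choose_mul_pow _ ha, Function.comp_apply, haarSum_sub]
  ring

/-- Truncation is encoded by the indicator of `k < M a`, so that dominated convergence handles both
indices at once. No relation between the growth of `n` and of `M` is needed. -/
lemma tendsto_sum_haarSum_angle_sub_one_pow (hp : p ≠ 2) {α : Type*} {l : Filter α} {n M : α → ℕ}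
    (hn : Tendsto n l atTop) (hM : Tendsto M l atTop) :
    Tendsto (fun a => ∑ k ∈ Finset.range (M a), (-1) ^ k / ((k : ℂ_[p]) + 1) *
      haarSum p (fun m => (angle p m - 1) ^ (k + 1)) (n a)) l (𝓝 (-gammaConst p)) := by
  have h := tendsto_tsum_of_dominated_convergence (𝓕 := l)
    (f := fun a (k : ℕ) => if k < M a then (-1) ^ k / ((k : ℂ_[p]) + 1) *
        haarSum p (fun m => (angle p m - 1) ^ (k + 1)) (n a) else 0)
    (g := fun k : ℕ => (-1) ^ k / ((k : ℂ_[p]) + 1) * angleMoment p (k + 1))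
    (summable_mul_inv_prime_pow_mul (p := p) (p ^ 3))
    (fun k => (((tendsto_angleMoment (k + 1)).comp hn).const_mul _).congr' (by
      filter_upwards [hM.eventually_gt_atTop k] with a ha
      rw [if_pos ha, Function.comp_apply]))
    (Eventually.of_forall fun a k => by
      have hB := norm_mul_div_succ_le k (norm_neg_one_pow_le k)
        (norm_haarSum_angle_sub_one_pow_le (p := p) (k + 1) (n a))
      split_ifs
      · exact hB
      · rw [norm_zero]; exact (norm_nonneg _).trans hB)
  rw [(hasSum_angleMoment hp).tsum_eq] at h
  refine h.congr fun a => ?_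
  rw [tsum_eq_sum (s := Finset.range (M a)) fun k hk => by
    rw [if_neg (by simpa using hk)]]
  exact Finset.sum_congr rfl fun k hk => by rw [if_pos (Finset.mem_range.mp hk)]

lemma sum_choose_mul_pow_eq (x : ℂ_[p]) (n : ℕ) :
    ∑ j ∈ Finset.range (n + 1), (n.choose j : ℂ_[p]) * x ^ j * (-1) ^ (n - j) = (x - 1) ^ n := by
  rw [sub_eq_add_neg, add_pow]
  exact Finset.sum_congr rfl fun j _ => by ring

theorem tendsto_haarSum_sum_log (hp : p ≠ 2) {α : Type*} {l : Filter α} {n M : α → ℕ}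
    (hn : Tendsto n l atTop) (hM : Tendsto M l atTop) :
    Tendsto (fun a => -haarSum p (fun m : ℕ => ∑ n ∈ Finset.Icc 1 (M a),
      (-1) ^ (n + 1) / (n : ℂ_[p]) * ∑ j ∈ Finset.range (n + 1), (n.choose j : ℂ_[p]) *
        ((m : ℂ_[p]) / teich p m) ^ j * (-1) ^ (n - j)) (n a)) l (𝓝 (gammaConst p)) := by
  rw [← neg_neg (gammaConst p)]
  refine (tendsto_sum_haarSum_angle_sub_one_pow hp hn hM).neg.congr fun a => ?_
  simp only [sum_choose_mul_pow_eq, sum_Icc_one_eq, ← haarSum_const_mul, ← haarSum_finsetSum]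
  congr 1
  refine haarSum_congr (fun m _ => Finset.sum_congr rfl fun k _ => ?_) _
  rw [angle, map_natCast]
  push_cast
  ring

theorem tendsto_sum_log_haarSum (hp : p ≠ 2) {α : Type*} {l : Filter α} {n M : α → ℕ}
    (hn : Tendsto n l atTop) (hM : Tendsto M l atTop) :
    Tendsto (fun a => -∑ k ∈ Finset.Icc 1 (M a),
      (-1) ^ (k + 1) / (k : ℂ_[p]) * ∑ j ∈ Finset.range (k + 1), (k.choose j : ℂ_[p]) *
        (-1) ^ (k - j) * haarSum p (fun m => (teich p m)⁻¹ ^ j * (m : ℂ_[p]) ^ j) (n a)) l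
      (𝓝 (gammaConst p)) := by
  refine (tendsto_haarSum_sum_log hp hn hM).congr fun a => ?_
  simp only [← haarSum_const_mul, ← haarSum_finsetSum]
  congr 1
  refine haarSum_congr (fun m _ => Finset.sum_congr rfl fun k _ => ?_) _
  congr 1
  refine Finset.sum_congr rfl fun j _ => ?_
  rw [div_pow, inv_pow]
  ring

/-! ### The `p`-adic Gamma function -/

lemma prod_Icc_id_eq_factorial (n : ℕ) : ∏ i ∈ Finset.Icc 1 n, i = n.factorial := by
  induction n with
  | zero => simp
  | succ n ih => rw [Finset.prod_Icc_succ_top (by omega), ih, Nat.factorial_succ, mul_comm]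

lemma gammaNat_zero : gammaNat p 0 = 1 := by simp [gammaNat]

lemma gammaNat_succ (n : ℕ) :
    gammaNat p (n + 1) = -(if p ∣ n then 1 else (n : ℤ_[p])) * gammaNat p n := by
  rw [gammaNat, gammaNat, Finset.range_add_one, Finset.filter_insert]
  by_cases h : p ∣ n
  · simp [h, pow_succ]
  · rw [if_pos h, if_neg h, Finset.prod_insert (by simp), pow_succ]
    ring

lemma isUnit_gammaNat (n : ℕ) : IsUnit (gammaNat p n) := by
  induction n with
  | zero => rw [gammaNat_zero]; exact isUnit_one
  | succ n ih =>
    rw [gammaNat_succ]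
    refine IsUnit.mul (IsUnit.neg ?_) ih
    split_ifs with h
    · exact isUnit_one
    · exact isUnit_natCast h

/-- Wilson's theorem gives `-1` for the product, and `(-1)^p = -1` in `ZMod p`. -/
lemma toZMod_gammaNat_prime : PadicInt.toZMod (gammaNat p p) = 1 := by
  have hp := (Fact.out : p.Prime)
  have e : (Finset.range p).filter (fun m => ¬ p ∣ m) = Finset.Icc 1 (p - 1) := by
    ext m
    simp only [Finset.mem_filter, Finset.mem_range, Finset.mem_Icc]
    constructor
    · rintro ⟨h1, h2⟩
      exact ⟨Nat.one_le_iff_ne_zero.mpr (by rintro rfl; exact h2 (dvd_zero p)), by omega⟩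
    · rintro ⟨h1, h2⟩
      exact ⟨by omega, Nat.not_dvd_of_pos_of_lt h1 (by omega)⟩
  have h1 : ((-1 : ZMod p)) ^ p = -1 := ZMod.pow_card _
  rw [gammaNat, e, ← Nat.cast_prod, prod_Icc_id_eq_factorial, map_mul, map_pow, map_neg,
    map_one, map_natCast, ZMod.wilsons_lemma, h1]
  ring

lemma toZMod_gammaNat_add_prime (m : ℕ) :
    PadicInt.toZMod (gammaNat p (m + p)) = PadicInt.toZMod (gammaNat p m) := by
  induction m with
  | zero => rw [zero_add, toZMod_gammaNat_prime, gammaNat_zero, map_one]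
  | succ m ih =>
    have h : p ∣ m + p ↔ p ∣ m := Nat.dvd_add_left dvd_rfl
    rw [show m + 1 + p = m + p + 1 by ring, gammaNat_succ, gammaNat_succ, map_mul, map_mul, ih]
    congr 1
    simp only [h]
    split_ifs
    · rfl
    · simp

lemma prime_dvd_gammaNat_sub_one {h : ℕ} (hh : p ∣ h) : (p : ℤ_[p]) ∣ gammaNat p h - 1 := by
  obtain ⟨c, rfl⟩ := hh
  rw [← Ideal.mem_span_singleton, ← PadicInt.maximalIdeal_eq_span_p, ← PadicInt.ker_toZMod,
    RingHom.mem_ker, map_sub, map_one, sub_eq_zero]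
  induction c with
  | zero => rw [mul_zero, gammaNat_zero, map_one]
  | succ c ih => rw [Nat.mul_succ, toZMod_gammaNat_add_prime, ih]

/-- The signs in the functional equation disappear because `log⟨-1⟩ = 0`. This makes `log Γ_p` the
indefinite sum whose derivative at `0` is the integral of `log⟨x⟩`. -/
lemma logSeries_angle_gammaNat (n : ℕ) : logSeries p (angle p (gammaNat p n))
    = ∑ m ∈ Finset.range n, unitExt (fun m => logSeries p (angle p m)) m := by
  induction n with
  | zero => rw [gammaNat_zero, logSeries_angle_one, Finset.range_zero, Finset.sum_empty]
  | succ n ih =>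
    rw [Finset.sum_range_succ, ← ih, gammaNat_succ, add_comm]
    by_cases h : p ∣ n
    · rw [if_pos h, logSeries_angle_mul isUnit_one.neg (isUnit_gammaNat n),
        logSeries_angle_neg_one, unitExt, if_pos h]
    · have hn := isUnit_natCast h
      rw [if_neg h, logSeries_angle_mul hn.neg (isUnit_gammaNat n), neg_eq_neg_one_mul (n : ℤ_[p]),
        logSeries_angle_mul isUnit_one.neg hn, logSeries_angle_neg_one, zero_add, unitExt,
        if_neg h]

lemma tendsto_avg_log (hp : p ≠ 2) :
    Tendsto (avg (unitExt fun m => logSeries p (angle p m))) atTop (𝓝 (-gammaConst p)) := by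
  have := tendsto_haarSum_log hp
  rwa [funext (haarSum_eq_avg fun m => logSeries p (angle p m))] at this

lemma inv_prime_mul_pow_succ (k : ℕ) : (p : ℝ)⁻¹ * (p : ℝ) ^ (k + 1) = p ^ k := by
  rw [pow_succ', ← mul_assoc, inv_mul_cancel₀ prime_pos.ne', one_mul]

lemma norm_sum_log_sub_le (hp : p ≠ 2) {h : ℕ} (hh : p ∣ h) :
    ‖(∑ m ∈ Finset.range h, unitExt (fun m => logSeries p (angle p m)) m) + gammaConst p * h‖
      ≤ p ^ 3 * ‖(h : ℂ_[p])‖ ^ 2 := by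
  rcases eq_or_ne h 0 with rfl | h0
  · simp
  have hc : (h : ℂ_[p]) ≠ 0 := Nat.cast_ne_zero.mpr h0
  have H := (smoothWith_logSeries_angle hp).norm_sum_div_sub_le (tendsto_avg_log hp) h0 hh
  rw [inv_prime_mul_pow_succ, sub_neg_eq_add, div_add' _ _ _ hc, norm_div,
    div_le_iff₀ (norm_pos_iff.mpr hc)] at H
  exact H.trans_eq (by ring)

lemma norm_gammaConst_le (hp : p ≠ 2) : ‖gammaConst p‖ ≤ p ^ 2 := by
  rw [gammaConst_eq hp, norm_neg]
  refine (norm_logMoment_le hp 1).trans_eq ?_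
  rw [pow_one, inv_prime_mul_pow_succ]

lemma norm_sum_log_le (hp : p ≠ 2) {h : ℕ} (hh : p ∣ h) :
    ‖∑ m ∈ Finset.range h, unitExt (fun m => logSeries p (angle p m)) m‖
      ≤ p ^ 3 * ‖(h : ℂ_[p])‖ := by
  rw [← add_sub_cancel_right (∑ m ∈ Finset.range h, unitExt (fun m => logSeries p (angle p m)) m)
    (gammaConst p * h)]
  refine norm_sub_le_of_le ((norm_sum_log_sub_le hp hh).trans ?_) ?_
  · rw [pow_two, ← mul_assoc]
    exact mul_le_of_le_one_right (by positivity) (norm_natCast_le_one h)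
  · rw [norm_mul]
    gcongr
    exact (norm_gammaConst_le hp).trans (pow_le_pow_right₀ one_lt_prime.le (by norm_num))

lemma norm_toCp_gammaNat_sub_one_le_inv {h : ℕ} (hh : p ∣ h) :
    ‖toCp p (gammaNat p h) - 1‖ ≤ (p : ℝ)⁻¹ := by
  rw [← map_one (toCp p), ← map_sub, norm_toCp]
  exact norm_le_inv_prime (prime_dvd_gammaNat_sub_one hh)

lemma logSeries_toCp_gammaNat {h : ℕ} (hh : p ∣ h) : logSeries p (toCp p (gammaNat p h))
    = ∑ m ∈ Finset.range h, unitExt (fun m => logSeries p (angle p m)) m := by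
  rw [← logSeries_angle_gammaNat, angle_eq_toCp (prime_dvd_gammaNat_sub_one hh)]

lemma norm_toCp_gammaNat_sub_one_le (hp : p ≠ 2) {h : ℕ} (hh : p ∣ h) :
    ‖toCp p (gammaNat p h) - 1‖ ≤ p ^ 3 * ‖(h : ℂ_[p])‖ := by
  rw [← norm_logSeries hp (norm_toCp_gammaNat_sub_one_le_inv hh), logSeries_toCp_gammaNat hh]
  exact norm_sum_log_le hp hh

/-- Only `m = 0` needs the logarithm; the functional equation, whose factor at `m + h` differs from
that at `m` by at most `|h|`, propagates the bound. -/
lemma norm_gammaNat_add_sub_le (hp : p ≠ 2) (m : ℕ) {h : ℕ} (hh : p ∣ h) :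
    ‖gammaNat p (m + h) - gammaNat p m‖ ≤ p ^ 3 * ‖(h : ℤ_[p])‖ := by
  have hp3 : (1 : ℝ) ≤ p ^ 3 := one_le_pow₀ one_lt_prime.le
  induction m with
  | zero =>
    rw [zero_add, gammaNat_zero, ← norm_toCp, map_sub, map_one, ← norm_natCast_eq]
    exact norm_toCp_gammaNat_sub_one_le hp hh
  | succ m ih =>
    have hd : p ∣ m + h ↔ p ∣ m := Nat.dvd_add_left hh
    rw [show m + 1 + h = m + h + 1 by ring, gammaNat_succ, gammaNat_succ]
    by_cases hm : p ∣ m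
    · rw [if_pos (hd.mpr hm), if_pos hm, ← mul_sub, norm_mul, norm_neg, norm_one, one_mul]
      exact ih
    · rw [if_neg (mt hd.mp hm), if_neg hm]
      have e : -((m + h : ℕ) : ℤ_[p]) * gammaNat p (m + h) - -(m : ℤ_[p]) * gammaNat p m
          = -((m + h : ℕ) : ℤ_[p]) * (gammaNat p (m + h) - gammaNat p m)
            + -(h : ℤ_[p]) * gammaNat p m := by
        push_cast
        ring
      rw [e]
      refine (PadicInt.nonarchimedean _ _).trans (max_le ?_ ?_)
      · rw [norm_mul]
        exact (mul_le_of_le_one_left (norm_nonneg _) (PadicInt.norm_le_one _)).trans ih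
      · rw [norm_mul, norm_neg]
        exact (mul_le_of_le_one_right (norm_nonneg _) (PadicInt.norm_le_one _)).trans
          (le_mul_of_one_le_left (norm_nonneg _) hp3)

lemma norm_gammaNat_sub_le (hp : p ≠ 2) (m n : ℕ) :
    ‖gammaNat p m - gammaNat p n‖ ≤ p ^ 3 * ‖(m : ℤ_[p]) - n‖ := by
  wlog hmn : n ≤ m generalizing m n
  · rw [norm_sub_rev, norm_sub_rev (m : ℤ_[p])]
    exact this n m (by omega)
  obtain ⟨h, rfl⟩ := Nat.exists_eq_add_of_le hmn
  rw [Nat.cast_add, add_sub_cancel_left]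
  by_cases hh : p ∣ h
  · exact norm_gammaNat_add_sub_le hp n hh
  · rw [← norm_natCast_eq, norm_natCast_eq_one hh, mul_one]
    exact (PadicInt.norm_le_one _).trans (one_le_pow₀ one_lt_prime.le)

/-! ### Continuous interpolation of Gamma and its derivative at 1 -/

instance comap_natCast_nhds_neBot (x : ℤ_[p]) :
    (comap (fun n : ℕ => (n : ℤ_[p])) (𝓝 x)).NeBot :=
  comap_neBot fun _ ht =>
    let ⟨_, hu, n, hn⟩ := mem_closure_iff_nhds.mp (PadicInt.denseRange_natCast x) _ ht
    ⟨n, hn ▸ hu⟩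

lemma cauchy_map_gammaNat (hp : p ≠ 2) (x : ℤ_[p]) :
    Cauchy (map (gammaNat p) (comap (fun n : ℕ => (n : ℤ_[p])) (𝓝 x))) := by
  refine Metric.cauchy_iff.mpr ⟨inferInstance, fun ε hε => ?_⟩
  have hp3 : (0 : ℝ) < p ^ 3 := pow_pos prime_pos 3
  refine ⟨_, image_mem_map (preimage_mem_comap
    (Metric.ball_mem_nhds x (div_pos hε hp3))), ?_⟩
  rintro _ ⟨m, hm, rfl⟩ _ ⟨n, hn, rfl⟩
  rw [Set.mem_preimage, mem_ball_iff_norm] at hm hn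
  rw [dist_eq_norm]
  refine (norm_gammaNat_sub_le hp m n).trans_lt ?_
  have e : (m : ℤ_[p]) - n = (m - x) + -(n - x) := by ring
  have h : ‖(m : ℤ_[p]) - n‖ < ε / p ^ 3 := by
    rw [e]
    refine (PadicInt.nonarchimedean _ _).trans_lt (max_lt hm ?_)
    rwa [norm_neg]
  rw [mul_comm]
  exact (lt_div_iff₀ hp3).mp h

lemma tendsto_gammaNat (hp : p ≠ 2) (x : ℤ_[p]) :
    Tendsto (gammaNat p) (comap (fun n : ℕ => (n : ℤ_[p])) (𝓝 x)) (𝓝 (Gamma p x)) :=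
  tendsto_nhds_limUnder (CompleteSpace.complete (cauchy_map_gammaNat hp x))

lemma norm_Gamma_sub_gammaNat_le (hp : p ≠ 2) (x : ℤ_[p]) (n : ℕ) :
    ‖Gamma p x - gammaNat p n‖ ≤ p ^ 3 * ‖x - n‖ :=
  le_of_tendsto_of_tendsto ((tendsto_gammaNat hp x).sub_const _).norm
    ((tendsto_comap.sub_const (n : ℤ_[p])).norm.const_mul _)
    (Eventually.of_forall fun m => norm_gammaNat_sub_le hp m n)

lemma Gamma_natCast (hp : p ≠ 2) (n : ℕ) : Gamma p n = gammaNat p n := by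
  have h := norm_Gamma_sub_gammaNat_le hp (n : ℤ_[p]) n
  rw [sub_self, norm_zero, mul_zero] at h
  exact sub_eq_zero.mp (norm_eq_zero.mp (le_antisymm h (norm_nonneg _)))

lemma norm_Gamma_sub_le (hp : p ≠ 2) (x y : ℤ_[p]) :
    ‖Gamma p x - Gamma p y‖ ≤ p ^ 3 * ‖x - y‖ :=
  le_of_tendsto_of_tendsto ((tendsto_gammaNat hp y).const_sub _).norm
    ((tendsto_comap.const_sub x).norm.const_mul _)
    (Eventually.of_forall fun m => norm_Gamma_sub_gammaNat_le hp x m)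

theorem continuous_Gamma (hp : p ≠ 2) : Continuous (Gamma p) := by
  refine (LipschitzWith.of_dist_le_mul (K := (p : NNReal) ^ 3) fun x y => ?_).continuous
  rw [dist_eq_norm, dist_eq_norm]
  exact_mod_cast norm_Gamma_sub_le hp x y

lemma Gamma_natCast_add_one (hp : p ≠ 2) {h : ℕ} (hh : p ∣ h) :
    Gamma p ((h : ℤ_[p]) + 1) = -gammaNat p h := by
  rw [← Nat.cast_succ, Gamma_natCast hp, gammaNat_succ, if_pos hh, neg_one_mul]

/-- Two second order errors are combined: replacing `Γ_p(h) - 1` by its logarithm, and replacing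
that logarithm by `-γh`. -/
lemma norm_Gamma_one_add_natCast_le (hp : p ≠ 2) {h : ℕ} (hh : p ∣ h) :
    ‖toCp p (Gamma p (h + 1)) + 1 - gammaConst p * h‖ ≤ p ^ 6 * ‖(h : ℂ_[p])‖ ^ 2 := by
  have h1 := norm_logSeries_sub_le hp (norm_toCp_gammaNat_sub_one_le_inv hh)
  rw [logSeries_toCp_gammaNat hh] at h1
  have h2 := norm_sum_log_sub_le hp hh
  have h3 := norm_toCp_gammaNat_sub_one_le hp hh
  rw [Gamma_natCast_add_one hp hh, map_neg]
  have e : -toCp p (gammaNat p h) + 1 - gammaConst p * h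
      = ((∑ m ∈ Finset.range h, unitExt (fun m => logSeries p (angle p m)) m)
          - (toCp p (gammaNat p h) - 1))
        - ((∑ m ∈ Finset.range h, unitExt (fun m => logSeries p (angle p m)) m)
          + gammaConst p * h) := by ring
  rw [e]
  refine norm_sub_le_of_le (h1.trans ?_) (h2.trans ?_)
  · calc _ ≤ ((p : ℝ) ^ 3 * ‖(h : ℂ_[p])‖) ^ 2 := by gcongr
      _ = _ := by ring
  · gcongr
    · exact one_lt_prime.le
    · norm_num

lemma norm_Gamma_one_add_le (hp : p ≠ 2) {h : ℤ_[p]} (hh : (p : ℤ_[p]) ∣ h) :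
    ‖toCp p (Gamma p (1 + h)) + 1 - gammaConst p * toCp p h‖ ≤ p ^ 6 * ‖h‖ ^ 2 := by
  rcases eq_or_ne h 0 with rfl | h0
  · have := Gamma_natCast_add_one hp (dvd_zero p)
    rw [Nat.cast_zero, zero_add, gammaNat_zero] at this
    simp [this]
  have hpos : 0 < ‖h‖ := norm_pos_iff.mpr h0
  have hlt : ‖h‖ < 1 := (norm_le_inv_prime hh).trans_lt inv_prime_lt_one
  -- Precision `|h|²` makes the Lipschitz error of the approximation as small as the error claimed,
  -- and forces `|n| ≤ |h| < 1`, hence `p ∣ n`.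
  obtain ⟨n, hn⟩ : ∃ n : ℕ, dist h n < ‖h‖ ^ 2 :=
    PadicInt.denseRange_natCast.exists_dist_lt h (pow_pos hpos 2)
  rw [dist_eq_norm] at hn
  have hsq : ‖h‖ ^ 2 < ‖h‖ := by
    rw [pow_two]; exact mul_lt_of_lt_one_left hpos hlt
  have hnn : ‖(n : ℤ_[p])‖ ≤ ‖h‖ := by
    rw [← sub_sub_cancel h (n : ℤ_[p]), sub_eq_add_neg]
    exact (PadicInt.nonarchimedean _ _).trans
      (max_le le_rfl (by rw [norm_neg]; exact (hn.trans hsq).le))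
  have hpn : p ∣ n := by
    by_contra H
    have := norm_natCast_eq_one H
    rw [norm_natCast_eq] at this
    linarith
  have e : toCp p (Gamma p (1 + h)) + 1 - gammaConst p * toCp p h
      = (toCp p (Gamma p (n + 1)) + 1 - gammaConst p * n)
        + (toCp p (Gamma p (1 + h) - Gamma p (n + 1)) - gammaConst p * toCp p (h - n)) := by
    rw [map_sub, map_sub, map_natCast]
    ring
  have hp1 := (one_lt_prime (p := p)).le
  rw [e]
  refine norm_add_le_of_le ?_ (norm_sub_le_of_le ?_ ?_)
  · refine (norm_Gamma_one_add_natCast_le hp hpn).trans ?_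
    rw [norm_natCast_eq]
    gcongr
  · rw [norm_toCp]
    refine (norm_Gamma_sub_le hp _ _).trans ?_
    rw [add_comm (n : ℤ_[p]), add_sub_add_left_eq_sub]
    gcongr
    norm_num
  · rw [norm_mul, norm_toCp]
    gcongr
    exact (norm_gammaConst_le hp).trans (pow_le_pow_right₀ hp1 (by norm_num))

lemma Gamma_one (hp : p ≠ 2) : Gamma p 1 = -1 := by
  have := Gamma_natCast_add_one hp (dvd_zero p)
  rwa [Nat.cast_zero, zero_add, gammaNat_zero] at this

theorem tendsto_Gamma_slope (hp : p ≠ 2) :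
    Tendsto (fun h : ℤ_[p] => (toCp p (Gamma p (1 + h)) - toCp p (Gamma p 1)) / toCp p h)
      (𝓝[≠] 0) (𝓝 (gammaConst p)) := by
  rw [tendsto_iff_norm_sub_tendsto_zero]
  have hlim : Tendsto (fun h : ℤ_[p] => (p : ℝ) ^ 6 * ‖h‖) (𝓝[≠] 0) (𝓝 0) := by
    have : Tendsto (fun h : ℤ_[p] => (p : ℝ) ^ 6 * ‖h‖) (𝓝 0) (𝓝 ((p : ℝ) ^ 6 * ‖(0 : ℤ_[p])‖)) :=
      (continuous_const.mul continuous_norm).tendsto 0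
    rw [norm_zero, mul_zero] at this
    exact this.mono_left nhdsWithin_le_nhds
  refine squeeze_zero' (Eventually.of_forall fun _ => norm_nonneg _) ?_ hlim
  filter_upwards [self_mem_nhdsWithin,
    nhdsWithin_le_nhds (Metric.ball_mem_nhds (0 : ℤ_[p]) one_pos)] with h h0 h1
  have h0' : toCp p h ≠ 0 := (map_ne_zero_iff _ toCp_injective).mpr h0
  rw [mem_ball_zero_iff, PadicInt.norm_lt_one_iff_dvd] at h1
  rw [Gamma_one hp, map_neg, map_one, sub_neg_eq_add, div_sub' h0', norm_div, norm_toCp,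
    div_le_iff₀ (norm_pos_iff.mpr h0), mul_comm (toCp p h)]
  exact (norm_Gamma_one_add_le hp h1).trans_eq (by ring)

theorem tendsto_padicLog_Gamma (hp : p ≠ 2) :
    Tendsto (fun n : ℕ => -(1 / (p : ℂ_[p]) ^ n * padicLog p (Gamma p ((p : ℤ_[p]) ^ n)))) atTop
      (𝓝 (gammaConst p)) := by
  refine (tendsto_neg_haarSum_log hp).congr fun n => ?_
  rw [← Nat.cast_pow p n (α := ℤ_[p]), Gamma_natCast hp, padicLog_eq (isUnit_gammaNat _),
    logSeries_angle_gammaNat, haarSum_eq_avg, avg]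

theorem tendsto_Gamma_prime_pow_add_one (hp : p ≠ 2) :
    Tendsto (fun n : ℕ => 1 / (p : ℂ_[p]) ^ n *
      (toCp p (Gamma p ((p : ℤ_[p]) ^ n + 1)) - (-1))) atTop (𝓝 (gammaConst p)) := by
  have h : Tendsto (fun n : ℕ => (p : ℤ_[p]) ^ n) atTop (𝓝[≠] 0) := by
    refine tendsto_nhdsWithin_iff.mpr ⟨?_, Eventually.of_forall fun n =>
      pow_ne_zero n (Nat.cast_ne_zero.mpr (Fact.out : p.Prime).ne_zero)⟩
    exact tendsto_pow_atTop_nhds_zero_of_norm_lt_one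
      (by rw [PadicInt.norm_p]; exact inv_prime_lt_one)
  refine ((tendsto_Gamma_slope hp).comp h).congr fun n => ?_
  rw [Function.comp_apply, Gamma_one hp, map_pow, map_natCast, map_neg, map_one, add_comm 1,
    div_eq_inv_mul, one_div]

lemma factorial_mul_prime (c : ℕ) : (c * p).factorial
    = c.factorial * p ^ c * ∏ m ∈ Finset.range (c * p) with ¬ p ∣ m, m := by
  have hp := (Fact.out : p.Prime).pos
  have e1 : (Finset.Icc 1 (c * p)).filter (fun m => p ∣ m) = (Finset.Icc 1 c).image (· * p) := by
    ext m
    simp only [Finset.mem_filter, Finset.mem_Icc, Finset.mem_image]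
    constructor
    · rintro ⟨⟨h1, h2⟩, i, rfl⟩
      refine ⟨i, ⟨Nat.pos_of_mul_pos_left h1, ?_⟩, mul_comm _ _⟩
      rw [mul_comm] at h2
      exact Nat.le_of_mul_le_mul_right h2 hp
    · rintro ⟨i, ⟨h1, h2⟩, rfl⟩
      exact ⟨⟨Nat.mul_pos h1 hp, Nat.mul_le_mul_right p h2⟩, Dvd.intro_left i rfl⟩
  have e2 : (Finset.Icc 1 (c * p)).filter (fun m => ¬ p ∣ m)
      = (Finset.range (c * p)).filter (fun m => ¬ p ∣ m) := by
    ext m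
    simp only [Finset.mem_filter, Finset.mem_Icc, Finset.mem_range]
    constructor
    · rintro ⟨⟨_, h2⟩, h3⟩
      exact ⟨lt_of_le_of_ne h2 (by rintro rfl; exact h3 (Dvd.intro_left c rfl)), h3⟩
    · rintro ⟨h2, h3⟩
      exact ⟨⟨Nat.one_le_iff_ne_zero.mpr (by rintro rfl; exact h3 (dvd_zero p)), h2.le⟩, h3⟩
  rw [← prod_Icc_id_eq_factorial, ← Finset.prod_filter_mul_prod_filter_not _ (p ∣ ·), e1, e2,
    Finset.prod_image fun a _ b _ h => Nat.eq_of_mul_eq_mul_right hp h, Finset.prod_mul_distrib,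
    Finset.prod_const, Nat.card_Icc, Nat.add_sub_cancel, prod_Icc_id_eq_factorial]

/-- Removing the multiples of `p` from `(p^n)!` leaves the product defining Gamma; the sign
`(-1)^(p^n) = -1` cancels that of `Γ_p(h+1) = -Γ_p(h)`. -/
lemma factorial_div_eq (hp : p ≠ 2) {n : ℕ} (hn : n ≠ 0) :
    ((p ^ n).factorial : ℂ_[p]) / (((p ^ (n - 1)).factorial : ℂ_[p]) * (p : ℂ_[p]) ^ p ^ (n - 1))
      = toCp p (Gamma p ((p : ℤ_[p]) ^ n + 1)) := by
  obtain ⟨k, rfl⟩ := Nat.exists_eq_succ_of_ne_zero hn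
  have h1 : ((p ^ k).factorial : ℂ_[p]) ≠ 0 := Nat.cast_ne_zero.mpr (Nat.factorial_ne_zero _)
  have h2 := pow_ne_zero (p ^ k) (prime_ne_zero (p := p))
  have hodd : Odd (p ^ (k + 1)) := ((Fact.out : p.Prime).odd_of_ne_two hp).pow
  rw [← Nat.cast_pow p (k + 1) (α := ℤ_[p]),
    Gamma_natCast_add_one hp (dvd_pow_self p k.succ_ne_zero), gammaNat, hodd.neg_one_pow,
    Nat.succ_eq_add_one, Nat.add_sub_cancel, pow_succ, factorial_mul_prime]
  push_cast
  rw [mul_div_cancel_left₀ _ (mul_ne_zero h1 h2), neg_one_mul, neg_neg, map_prod]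
  simp only [map_natCast]

theorem tendsto_factorial_div (hp : p ≠ 2) :
    Tendsto (fun n : ℕ => 1 / (p : ℂ_[p]) ^ n * (((p ^ n).factorial : ℂ_[p]) /
      (((p ^ (n - 1)).factorial : ℂ_[p]) * (p : ℂ_[p]) ^ p ^ (n - 1)) + 1)) atTop
      (𝓝 (gammaConst p)) := by
  refine (tendsto_Gamma_prime_pow_add_one hp).congr' ?_
  filter_upwards [eventually_ne_atTop 0] with n hn
  rw [factorial_div_eq hp hn, sub_neg_eq_add]

/-! ### The regularized Bernoulli measure -/

lemma not_dvd_two (hp : p ≠ 2) : ¬ p ∣ 2 :=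
  fun h => hp ((Nat.prime_dvd_prime_iff_eq Fact.out Nat.prime_two).mp h)

section Reflection

variable {M : Type*} [AddCommMonoid M] {q : ℕ}

omit [Fact p.Prime] in
-- The predicate selects exactly one member of each pair `{m, q - m}`.
lemma sum_units_eq_sum_add_reflect (hpq : p ∣ q) (P : ℕ → Prop) [DecidablePred P]
    (hP : ∀ m < q, ¬ p ∣ m → (P (q - m) ↔ ¬ P m)) (F : ℕ → M) :
    ∑ m ∈ Finset.range q with ¬ p ∣ m, F m
      = ∑ m ∈ Finset.range q with ¬ p ∣ m ∧ P m, (F m + F (q - m)) := by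
  have hmem : ∀ m < q, ¬ p ∣ m → q - m < q ∧ ¬ p ∣ q - m ∧ q - (q - m) = m := by
    intro m hm hpm
    have h0 : m ≠ 0 := by rintro rfl; exact hpm (dvd_zero p)
    refine ⟨by omega, fun H => hpm ?_, by omega⟩
    have := Nat.dvd_sub hpq H
    rwa [show q - (q - m) = m by omega] at this
  rw [Finset.sum_add_distrib, ← Finset.sum_filter_add_sum_filter_not _ P, Finset.filter_filter,
    Finset.filter_filter]
  congr 1
  refine Finset.sum_nbij' (q - ·) (q - ·) ?_ ?_ ?_ ?_ ?_
  all_goals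
    intro m hm
    simp only [Finset.mem_filter, Finset.mem_range] at hm
    obtain ⟨h1, h2, h3⟩ := hm
    have h := hmem m h1 h2
  · simp only [Finset.mem_filter, Finset.mem_range]
    exact ⟨h.1, h.2.1, (hP m h1 h2).mpr h3⟩
  · simp only [Finset.mem_filter, Finset.mem_range]
    exact ⟨h.1, h.2.1, fun H => (hP m h1 h2).mp H h3⟩
  · exact h.2.2
  · exact h.2.2
  · simp only [h.2.2]

omit [Fact p.Prime] in
lemma sum_units_eq_even (hpq : p ∣ q) (hq : Odd q) (F : ℕ → M) :
    ∑ m ∈ Finset.range q with ¬ p ∣ m, F m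
      = ∑ m ∈ Finset.range q with ¬ p ∣ m ∧ Even m, (F m + F (q - m)) := by
  refine sum_units_eq_sum_add_reflect hpq _ (fun m hm _ => ?_) F
  rw [Nat.even_sub hm.le]
  have := Nat.not_even_iff_odd.mpr hq
  tauto

omit [Fact p.Prime] in
lemma sum_units_eq_half (hpq : p ∣ q) (hq : Odd q) (F : ℕ → M) :
    ∑ m ∈ Finset.range q with ¬ p ∣ m, F m
      = ∑ m ∈ Finset.range q with ¬ p ∣ m ∧ 2 * m < q, (F m + F (q - m)) := by
  refine sum_units_eq_sum_add_reflect hpq _ (fun m hm _ => ?_) F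
  obtain ⟨r, rfl⟩ := hq
  omega

lemma sum_half_eq_even (hp : p ≠ 2) (F : ℕ → M) :
    ∑ m ∈ Finset.range q with ¬ p ∣ m ∧ 2 * m < q, F (2 * m)
      = ∑ m ∈ Finset.range q with ¬ p ∣ m ∧ Even m, F m := by
  have hpp := (Fact.out : p.Prime)
  have h2 := not_dvd_two hp
  refine Finset.sum_nbij (2 * ·) ?_ ?_ ?_ fun _ _ => rfl
  · intro m hm
    simp only [Finset.mem_filter, Finset.mem_range] at hm ⊢
    exact ⟨hm.2.2, fun H => (hpp.dvd_mul.mp H).elim h2 hm.2.1, even_two_mul m⟩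
  · intro a _ b _ h
    exact Nat.eq_of_mul_eq_mul_left two_pos h
  · intro m hm
    simp only [Finset.coe_filter, Finset.mem_range, Set.mem_ofPred_eq, Set.mem_image] at hm ⊢
    obtain ⟨h1, h2, r, rfl⟩ := hm
    exact ⟨r, ⟨by omega, fun H => h2 (dvd_add H H), by omega⟩, two_mul r⟩

end Reflection

/-! ### Second order expansions and the comparison of the two sums -/

lemma norm_sub_two_terms_le (hp : p ≠ 2) {c : ℕ → ℂ_[p]} (hc : ∀ k, ‖c k‖ ≤ 1) {w s : ℂ_[p]}
    (hw : ‖w‖ ≤ (p : ℝ)⁻¹)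
    (h : HasSum (fun k : ℕ => c k / ((k : ℂ_[p]) + 1) * w ^ (k + 1)) s) :
    ‖s - (c 0 * w + c 1 / 2 * w ^ 2)‖ ≤ p * ‖w‖ ^ 3 := by
  have h2 := (hasSum_nat_add_iff' 2).mpr h
  have e : ∑ k ∈ Finset.range 2, c k / ((k : ℂ_[p]) + 1) * w ^ (k + 1)
      = c 0 * w + c 1 / 2 * w ^ 2 := by
    simp only [Finset.sum_range_succ, Finset.range_zero, Finset.sum_empty]
    norm_num
  rw [e] at h2
  refine norm_tsum_le_of_forall h2 (by positivity) fun k => ?_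
  have e2 : (((k + 2 : ℕ) : ℂ_[p]) + 1) = ((k + 1 + 2 : ℕ) : ℂ_[p]) := by push_cast; ring
  rw [norm_mul, norm_div, norm_pow, e2, div_eq_mul_inv]
  calc _ ≤ 1 * (p : ℝ) ^ (k + 1) * (‖w‖ ^ k * ‖w‖ ^ 3) := by
        rw [show k + 2 + 1 = k + 3 by ring, pow_add ‖w‖]
        gcongr
        · exact hc _
        · exact inv_norm_natCast_add_two_le hp (k + 1)
    _ ≤ 1 * (p : ℝ) ^ (k + 1) * ((p : ℝ)⁻¹ ^ k * ‖w‖ ^ 3) := by gcongr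
    _ = (p * (p : ℝ)⁻¹) ^ k * (p * ‖w‖ ^ 3) := by ring
    _ = _ := by rw [mul_inv_cancel₀ prime_pos.ne', one_pow, one_mul]

/-- Estimating `((1+w)^r - 1)/r` first and multiplying back keeps the factor `|r|`, which supplies
the fourth order in `q` when `r = q`. -/
lemma norm_pow_sub_quadratic_le (hp : p ≠ 2) {w : ℂ_[p]} (hw : ‖w‖ ≤ (p : ℝ)⁻¹) {r : ℕ}
    (hr : r ≠ 0) :
    ‖(1 + w) ^ r - (1 + r * w + r * (r - 1) / 2 * w ^ 2)‖
      ≤ ‖(r : ℂ_[p])‖ * (p * ‖w‖ ^ 3) := by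
  have hr' : (r : ℂ_[p]) ≠ 0 := Nat.cast_ne_zero.mpr hr
  have h := norm_sub_two_terms_le hp (fun k => norm_natCast_le_one _) hw
    (hasSum_pow_sub_one_div w hr)
  rw [Nat.choose_zero_right, Nat.choose_one_right, Nat.cast_one,
    Nat.cast_sub (Nat.one_le_iff_ne_zero.mpr hr), Nat.cast_one] at h
  have e : (1 + w) ^ r - (1 + r * w + r * (r - 1) / 2 * w ^ 2)
      = r * (((1 + w) ^ r - 1) / r - (1 * w + ((r : ℂ_[p]) - 1) / 2 * w ^ 2)) := by
    field_simp
    ring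
  rw [e, norm_mul]
  exact mul_le_mul_of_nonneg_left h (norm_nonneg _)

lemma norm_logSeries_sub_quadratic_le (hp : p ≠ 2) {x : ℂ_[p]} (hx : ‖x - 1‖ ≤ (p : ℝ)⁻¹) :
    ‖logSeries p x - ((x - 1) - 1 / 2 * (x - 1) ^ 2)‖ ≤ p * ‖x - 1‖ ^ 3 := by
  have h := norm_sub_two_terms_le hp norm_neg_one_pow_le hx (hasSum_logSeries hx)
  convert h using 2
  ring

lemma angle_neg_one (hp : p ≠ 2) : angle p (-1) = 1 := by
  have h := norm_logSeries hp (norm_angle_sub_one_le (p := p) (x := -1) isUnit_one.neg)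
  rw [logSeries_angle_neg_one, norm_zero] at h
  exact sub_eq_zero.mp (norm_eq_zero.mp h.symm)

lemma angle_reflect (hp : p ≠ 2) {q m : ℕ} (hpq : p ∣ q) (hm : ¬ p ∣ m) (hmq : m ≤ q) :
    angle p ((q - m : ℕ) : ℤ_[p]) = angle p m * (1 - (q : ℂ_[p]) / m) := by
  rw [Nat.cast_sub hmq, sub_eq_neg_add, angle_add (isUnit_natCast hm).neg (natCast_dvd hpq),
    neg_eq_neg_one_mul (m : ℤ_[p]), angle_mul, angle_neg_one hp, one_mul, map_mul, map_neg, map_one,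
    map_natCast, map_natCast, neg_one_mul, div_neg, ← sub_eq_add_neg]

lemma norm_pow_sub_one {x : ℂ_[p]} (hp : p ≠ 2) (hx : ‖x - 1‖ ≤ (p : ℝ)⁻¹) (r : ℕ) :
    ‖x ^ r - 1‖ = ‖(r : ℂ_[p])‖ * ‖x - 1‖ := by
  rw [← norm_logSeries hp (norm_pow_sub_one_le hx r), logSeries_pow hx, norm_mul,
    norm_logSeries hp hx]

/-- The third order comparison of the two expansions, term by term. -/
lemma norm_comparison_term_le (hp : p ≠ 2) {q : ℕ} (hpq : p ∣ q) (hq0 : q ≠ 0) (hq1 : q ≠ 1)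
    {z : ℂ_[p]} (hz : ‖z‖ = ‖(q : ℂ_[p])‖) :
    ‖(1 - z) ^ q - (1 - 2 * z) ^ q - q * z / 2 * (1 + (1 - z) ^ (q - 1))
      + q * (q - 1) * z ^ 2‖ ≤ p * ‖(q : ℂ_[p])‖ ^ 4 := by
  have hq := norm_natCast_le_inv hpq
  have h2 := norm_two hp
  have hz' : ‖-z‖ ≤ (p : ℝ)⁻¹ := by rwa [norm_neg, hz]
  have h2z : ‖-(2 * z)‖ ≤ (p : ℝ)⁻¹ := by rwa [norm_neg, norm_mul, h2, one_mul, hz]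
  have A := norm_pow_sub_quadratic_le hp hz' hq0
  have B := norm_pow_sub_quadratic_le hp h2z hq0
  have C := norm_pow_sub_quadratic_le hp hz' (Nat.sub_ne_zero_of_lt (by omega : 1 < q))
  have hc : ((q - 1 : ℕ) : ℂ_[p]) = q - 1 := by
    rw [Nat.cast_sub (by omega), Nat.cast_one]
  have hq1' : ‖((q - 1 : ℕ) : ℂ_[p])‖ ≤ 1 := norm_natCast_le_one _
  have hq2' : ‖(q : ℂ_[p]) - 1 - 1‖ ≤ 1 :=
    norm_sub_le_of_le (by rw [← hc]; exact hq1') norm_one.le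
  rw [norm_neg, hz, ← sub_eq_add_neg] at A C
  rw [norm_neg, norm_mul, h2, one_mul, hz, ← sub_eq_add_neg] at B
  rw [hc] at C hq1'
  have hp1 := (one_lt_prime (p := p)).le
  have e : (1 - z) ^ q - (1 - 2 * z) ^ q - q * z / 2 * (1 + (1 - z) ^ (q - 1))
      + q * (q - 1) * z ^ 2
      = ((1 - z) ^ q - (1 + q * -z + q * (q - 1) / 2 * (-z) ^ 2))
        - ((1 - 2 * z) ^ q - (1 + q * -(2 * z) + q * (q - 1) / 2 * (-(2 * z)) ^ 2))
        - (q * z / 2 * ((1 - z) ^ (q - 1)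
            - (1 + ((q : ℂ_[p]) - 1) * -z + (q - 1) * (q - 1 - 1) / 2 * (-z) ^ 2))
          + q * z / 2 * ((q - 1) * (q - 1 - 1) / 2 * z ^ 2)) := by
    field_simp
    ring
  rw [e]
  refine norm_sub_le_of_le (norm_sub_le_of_le (A.trans_eq (by ring)) (B.trans_eq (by ring)))
    (norm_add_le_of_le ?_ ?_)
  · rw [norm_mul, norm_div, norm_mul, h2, div_one, hz]
    calc _ ≤ ‖(q : ℂ_[p])‖ * ‖(q : ℂ_[p])‖ * (‖(q : ℂ_[p]) - 1‖ * (p * ‖(q : ℂ_[p])‖ ^ 3)) := by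
          gcongr
      _ ≤ ‖(q : ℂ_[p])‖ * 1 * (1 * (p * ‖(q : ℂ_[p])‖ ^ 3)) := by
          gcongr
          exact norm_natCast_le_one q
      _ = _ := by ring
  · rw [norm_mul, norm_div, norm_mul, norm_mul, norm_div, norm_mul, norm_pow, h2, div_one, div_one,
      hz]
    calc _ ≤ ‖(q : ℂ_[p])‖ * ‖(q : ℂ_[p])‖ * (1 * 1 * ‖(q : ℂ_[p])‖ ^ 2) := by gcongr
      _ = 1 * ‖(q : ℂ_[p])‖ ^ 4 := by ring
      _ ≤ _ := by gcongr

/-- The alternating sum `∑ (-1)^m / (2m) ⟨m⟩^q` over the units below `q`. -/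
def altSum (p : ℕ) [Fact p.Prime] (q : ℕ) : ℂ_[p] :=
  ∑ m ∈ Finset.range q with ¬ p ∣ m, (-1) ^ m / (2 * (m : ℂ_[p])) * angle p m ^ q

/-- The sum of `⟨m⟩^q` over the units below `q`. -/
def powSum (p : ℕ) [Fact p.Prime] (q : ℕ) : ℂ_[p] :=
  ∑ m ∈ Finset.range q with ¬ p ∣ m, angle p m ^ q

lemma angle_reflect_pow (hp : p ≠ 2) {q m : ℕ} (hpq : p ∣ q) (hm : ¬ p ∣ m) (hmq : m ≤ q)
    (r : ℕ) :
    angle p ((q - m : ℕ) : ℤ_[p]) ^ r = angle p m ^ r * (1 - (q : ℂ_[p]) / m) ^ r := by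
  rw [angle_reflect hp hpq hm hmq, mul_pow]

lemma powSum_eq (hp : p ≠ 2) {q : ℕ} (hpq : p ∣ q) (hq : Odd q) :
    powSum p q = ∑ e ∈ Finset.range q with ¬ p ∣ e ∧ Even e,
      angle p e ^ q * (1 + (1 - (q : ℂ_[p]) / e) ^ q) := by
  rw [powSum, sum_units_eq_even hpq hq]
  refine Finset.sum_congr rfl fun m hm => ?_
  rw [Finset.mem_filter, Finset.mem_range] at hm
  rw [angle_reflect_pow hp hpq hm.2.1 hm.1.le]
  ring

/-- Using `⟨2⟩⟨m⟩ = ⟨2m⟩` on the representatives with `2m < q` moves the sum to the even residues `e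
= 2m`, where `q/m = 2(q/e)`. -/
lemma angle_two_pow_mul_powSum (hp : p ≠ 2) {q : ℕ} (hpq : p ∣ q) (hq : Odd q) :
    angle p 2 ^ q * powSum p q = ∑ e ∈ Finset.range q with ¬ p ∣ e ∧ Even e,
      angle p e ^ q * (1 + (1 - 2 * ((q : ℂ_[p]) / e)) ^ q) := by
  rw [powSum, sum_units_eq_half hpq hq, ← sum_half_eq_even hp, Finset.mul_sum]
  refine Finset.sum_congr rfl fun m hm => ?_
  rw [Finset.mem_filter, Finset.mem_range] at hm
  have hm0 := natCast_ne_zero_of_not_dvd hm.2.1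
  have e : 2 * ((q : ℂ_[p]) / ((2 * m : ℕ) : ℂ_[p])) = (q : ℂ_[p]) / m := by
    push_cast
    field_simp
  rw [angle_reflect_pow hp hpq hm.2.1 hm.1.le, e, Nat.cast_mul, angle_mul, mul_pow, Nat.cast_two]
  ring

lemma altSum_eq (hp : p ≠ 2) {q : ℕ} (hpq : p ∣ q) (hq : Odd q) :
    (q : ℂ_[p]) ^ 2 * altSum p q = ∑ e ∈ Finset.range q with ¬ p ∣ e ∧ Even e,
      angle p e ^ q * (q * ((q : ℂ_[p]) / e) / 2 * (1 + (1 - (q : ℂ_[p]) / e) ^ (q - 1))) := by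
  rw [altSum, sum_units_eq_even hpq hq, Finset.mul_sum]
  refine Finset.sum_congr rfl fun m hm => ?_
  rw [Finset.mem_filter, Finset.mem_range] at hm
  obtain ⟨h1, h2, h3⟩ := hm
  have hm0 := natCast_ne_zero_of_not_dvd h2
  have hodd : Odd (q - m) := Nat.Odd.sub_even h1.le hq h3
  have hd : ¬ p ∣ q - m := fun H => h2 ((Nat.dvd_sub_iff_right h1.le hpq).mp H)
  have hqm := natCast_ne_zero_of_not_dvd hd
  have hq0 : q ≠ 0 := by omega
  rw [angle_reflect_pow hp hpq h2 h1.le, hodd.neg_one_pow, h3.neg_one_pow]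
  rw [Nat.cast_sub h1.le] at hqm ⊢
  have e : (1 - (q : ℂ_[p]) / m) ^ q
      = (1 - (q : ℂ_[p]) / m) ^ (q - 1) * (1 - (q : ℂ_[p]) / m) := by
    rw [← pow_succ, Nat.sub_add_cancel (Nat.one_le_iff_ne_zero.mpr hq0)]
  rw [e]
  generalize (1 - (q : ℂ_[p]) / m) ^ (q - 1) = X
  field_simp
  ring

lemma exists_smoothWith_inv_sq :
    ∃ F', SmoothWith (p := p) 1 (unitExt fun m => (m : ℂ_[p])⁻¹ ^ 2) F' := by
  obtain ⟨F', h⟩ := exists_smoothWith_unitExt_pow (smoothWith_inv (p := p)) 2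
  exact ⟨F', by rwa [one_pow] at h⟩

/-- Reflection preserves `e^(-2)` modulo `q`, so twice the even sum agrees modulo `q` with the sum
over all units, which is `q` times a bounded Haar sum. -/
lemma norm_sum_even_inv_sq_le (hp : p ≠ 2) (n : ℕ) :
    ‖∑ e ∈ Finset.range (p ^ (n + 1)) with ¬ p ∣ e ∧ Even e, (e : ℂ_[p])⁻¹ ^ 2‖
      ≤ p ^ 3 * ‖((p ^ (n + 1) : ℕ) : ℂ_[p])‖ := by
  set q := p ^ (n + 1) with hqdef
  have hpq : p ∣ q := dvd_pow_self p n.succ_ne_zero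
  have hq : Odd q := ((Fact.out : p.Prime).odd_of_ne_two hp).pow
  have hq0 : (q : ℂ_[p]) ≠ 0 :=
    Nat.cast_ne_zero.mpr (pow_ne_zero _ (Fact.out : p.Prime).ne_zero)
  have hp3 : (1 : ℝ) ≤ p ^ 3 := one_le_pow₀ one_lt_prime.le
  obtain ⟨F', hF⟩ := exists_smoothWith_inv_sq (p := p)
  have h1 : ‖∑ m ∈ Finset.range q with ¬ p ∣ m, (m : ℂ_[p])⁻¹ ^ 2‖ ≤ p ^ 3 * ‖(q : ℂ_[p])‖ := by
    have h := norm_haarSum_le hF (n + 1)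
    rw [haarSum, ← Nat.cast_pow, ← hqdef, norm_mul, norm_div, norm_one, one_mul, one_div,
      inv_mul_le_iff₀ (norm_pos_iff.mpr hq0)] at h
    exact h.trans_eq (mul_comm _ _)
  rw [sum_units_eq_even hpq hq] at h1
  have e : ∑ e ∈ Finset.range q with ¬ p ∣ e ∧ Even e, (e : ℂ_[p])⁻¹ ^ 2
      = 1 / 2 * (∑ e ∈ Finset.range q with ¬ p ∣ e ∧ Even e,
          ((e : ℂ_[p])⁻¹ ^ 2 + ((q - e : ℕ) : ℂ_[p])⁻¹ ^ 2)
        - ∑ e ∈ Finset.range q with ¬ p ∣ e ∧ Even e,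
          (((q - e : ℕ) : ℂ_[p])⁻¹ ^ 2 - (e : ℂ_[p])⁻¹ ^ 2)) := by
    rw [← Finset.sum_sub_distrib, Finset.mul_sum]
    exact Finset.sum_congr rfl fun m _ => by ring
  rw [e, norm_mul, norm_div, norm_one, norm_two hp, div_one, one_mul]
  refine norm_sub_le_of_le h1 (norm_sum_le_of_forall _ _ (by positivity) fun m hm => ?_)
  rw [Finset.mem_filter, Finset.mem_range] at hm
  obtain ⟨h1, h2, h3⟩ := hm
  have hd : ¬ p ∣ q - m := fun H => h2 ((Nat.dvd_sub_iff_right h1.le hpq).mp H)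
  have hm0 := natCast_ne_zero_of_not_dvd h2
  have hqm := natCast_ne_zero_of_not_dvd hd
  have e2 : ((q - m : ℕ) : ℂ_[p])⁻¹ ^ 2 - (m : ℂ_[p])⁻¹ ^ 2
      = q * (2 * m - q) / (((q - m : ℕ) : ℂ_[p]) ^ 2 * (m : ℂ_[p]) ^ 2) := by
    rw [Nat.cast_sub h1.le] at hqm ⊢
    field_simp
    ring
  rw [e2, norm_div, norm_mul, norm_mul, norm_pow, norm_pow, norm_natCast_eq_one h2,
    norm_natCast_eq_one hd]
  simp only [one_pow, mul_one, div_one]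
  have h5 : ‖2 * (m : ℂ_[p]) - q‖ ≤ 1 :=
    norm_sub_le_of_le (by exact_mod_cast norm_natCast_le_one (2 * m)) (norm_natCast_le_one q)
  calc ‖(q : ℂ_[p])‖ * ‖2 * (m : ℂ_[p]) - q‖ ≤ ‖(q : ℂ_[p])‖ :=
        mul_le_of_le_one_right (norm_nonneg _) h5
    _ ≤ _ := le_mul_of_one_le_left (norm_nonneg _) hp3

lemma norm_powSum_sub_altSum_le (hp : p ≠ 2) (n : ℕ) :
    ‖(1 - angle p 2 ^ p ^ (n + 1)) * powSum p (p ^ (n + 1))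
        - ((p ^ (n + 1) : ℕ) : ℂ_[p]) ^ 2 * altSum p (p ^ (n + 1))‖
      ≤ p ^ 3 * ‖((p ^ (n + 1) : ℕ) : ℂ_[p])‖ ^ 4 := by
  have hE := norm_sum_even_inv_sq_le hp n
  set q := p ^ (n + 1) with hqdef
  have hpq : p ∣ q := dvd_pow_self p n.succ_ne_zero
  have hq : Odd q := ((Fact.out : p.Prime).odd_of_ne_two hp).pow
  have hq0 : q ≠ 0 := pow_ne_zero _ (Fact.out : p.Prime).ne_zero
  have hq1 : q ≠ 1 := by
    intro h
    rw [h, Nat.dvd_one] at hpq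
    exact (Fact.out : p.Prime).ne_one hpq
  have hp1 := (one_lt_prime (p := p)).le
  have hqm1 : ‖(q : ℂ_[p]) - 1‖ ≤ 1 := norm_sub_le_of_le (norm_natCast_le_one q) norm_one.le
  -- Each summand is only `O(q³)`, with leading part `-q(q-1)(q/e)²`. Replacing `⟨e⟩^q` by `1` there
  -- costs `O(q^4)`, and the remaining sum of `e^(-2)` supplies another factor `q`.
  have e : (1 - angle p 2 ^ q) * powSum p q - (q : ℂ_[p]) ^ 2 * altSum p q
      = ∑ e ∈ Finset.range q with ¬ p ∣ e ∧ Even e, (angle p e ^ q *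
          ((1 - (q : ℂ_[p]) / e) ^ q - (1 - 2 * ((q : ℂ_[p]) / e)) ^ q
            - q * ((q : ℂ_[p]) / e) / 2 * (1 + (1 - (q : ℂ_[p]) / e) ^ (q - 1))
            + q * (q - 1) * ((q : ℂ_[p]) / e) ^ 2)
          - (angle p e ^ q - 1) * (q * (q - 1) * ((q : ℂ_[p]) / e) ^ 2))
        - q ^ 3 * (q - 1) *
          ∑ e ∈ Finset.range q with ¬ p ∣ e ∧ Even e, (e : ℂ_[p])⁻¹ ^ 2 := by
    rw [sub_mul, one_mul, angle_two_pow_mul_powSum hp hpq hq, powSum_eq hp hpq hq,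
      altSum_eq hp hpq hq, Finset.mul_sum, ← Finset.sum_sub_distrib, ← Finset.sum_sub_distrib,
      ← Finset.sum_sub_distrib]
    refine Finset.sum_congr rfl fun m _ => ?_
    rw [div_eq_mul_inv (q : ℂ_[p])]
    ring
  rw [e]
  refine norm_sub_le_of_le (norm_sum_le_of_forall _ _ (by positivity) fun m hm => ?_) ?_
  · rw [Finset.mem_filter, Finset.mem_range] at hm
    obtain ⟨h1, h2, h3⟩ := hm
    have hz : ‖(q : ℂ_[p]) / m‖ = ‖(q : ℂ_[p])‖ := by
      rw [norm_div, norm_natCast_eq_one h2, div_one]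
    have hm1 := norm_angle_sub_one_le (isUnit_natCast h2)
    refine norm_sub_le_of_le ?_ ?_
    · rw [norm_mul, norm_pow, norm_angle (isUnit_natCast h2), one_pow, one_mul]
      refine (norm_comparison_term_le hp hpq hq0 hq1 hz).trans ?_
      gcongr
      exact le_self_pow₀ hp1 (by norm_num)
    · rw [norm_mul, norm_mul, norm_mul, norm_pow, hz, norm_pow_sub_one hp hm1]
      calc _ ≤ ‖(q : ℂ_[p])‖ * 1 * (‖(q : ℂ_[p])‖ * 1 * ‖(q : ℂ_[p])‖ ^ 2) := by
            gcongr
            exact hm1.trans inv_prime_lt_one.le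
        _ = 1 * ‖(q : ℂ_[p])‖ ^ 4 := by ring
        _ ≤ _ := by
            gcongr
            exact one_le_pow₀ hp1
  · rw [norm_mul, norm_mul, norm_pow]
    calc _ ≤ ‖(q : ℂ_[p])‖ ^ 3 * 1 * (p ^ 3 * ‖(q : ℂ_[p])‖) := by gcongr
      _ = _ := by ring

/-! ### Division by `1 - ⟨2⟩^q` and passage to the limit -/

lemma isUnit_two (hp : p ≠ 2) : IsUnit (2 : ℤ_[p]) := by
  exact_mod_cast isUnit_natCast (not_dvd_two hp)

/-- Otherwise `2 = ω(2)` would be a root of unity, with `2^(p-1) = 1`. -/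
lemma logSeries_angle_two_ne_zero (hp : p ≠ 2) : logSeries p (angle p 2) ≠ 0 := by
  have hu := isUnit_two hp
  rw [← norm_ne_zero_iff, norm_logSeries hp (norm_angle_sub_one_le hu), norm_ne_zero_iff,
    sub_ne_zero]
  intro h
  have h1 : toCp p 2 ^ (p - 1) = 1 := by
    rw [angle, div_eq_one_iff_eq (teich_ne_zero hu)] at h
    rw [h, teich, ← map_pow (omega p), ZMod.pow_card_sub_one_eq_one (toZMod_ne_zero hu), map_one]
  have h2 : ((2 ^ (p - 1) : ℕ) : ℂ_[p]) = ((1 : ℕ) : ℂ_[p]) := by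
    push_cast
    rw [← h1, map_ofNat]
  have h3 : 2 ^ (p - 1) ≠ 1 :=
    (Nat.one_lt_two_pow (Nat.sub_ne_zero_of_lt (Fact.out : p.Prime).one_lt)).ne'
  exact h3 (Nat.cast_injective h2)

lemma norm_one_sub_angle_two_pow (hp : p ≠ 2) (q : ℕ) :
    ‖1 - angle p 2 ^ q‖ = ‖(q : ℂ_[p])‖ * ‖logSeries p (angle p 2)‖ := by
  have hu := norm_angle_sub_one_le (isUnit_two hp)
  rw [norm_sub_rev, norm_pow_sub_one hp hu, norm_logSeries hp hu]

lemma one_sub_angle_two_pow_ne_zero (hp : p ≠ 2) {q : ℕ} (hq : q ≠ 0) :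
    1 - angle p 2 ^ q ≠ 0 := by
  rw [← norm_ne_zero_iff, norm_one_sub_angle_two_pow hp]
  exact mul_ne_zero (norm_ne_zero_iff.mpr (Nat.cast_ne_zero.mpr hq))
    (norm_ne_zero_iff.mpr (logSeries_angle_two_ne_zero hp))

lemma tendsto_const_mul_norm_prime_pow (K : ℝ) :
    Tendsto (fun n : ℕ => K * ‖((p ^ n : ℕ) : ℂ_[p])‖) atTop (𝓝 0) := by
  have h := (tendsto_prime_pow (p := p)).norm.const_mul K
  rw [norm_zero, mul_zero] at h
  exact h.congr fun n => by rw [Nat.cast_pow]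

lemma tendsto_altSum (hp : p ≠ 2) :
    Tendsto (fun n : ℕ => -altSum p (p ^ n) / (1 - angle p 2 ^ p ^ n)
      + (1 - 1 / (p : ℂ_[p])) / (p : ℂ_[p]) ^ n) atTop (𝓝 (gammaConst p)) := by
  have hdiff : Tendsto (fun n : ℕ => -altSum p (p ^ n) / (1 - angle p 2 ^ p ^ n)
      + (1 - 1 / (p : ℂ_[p])) / (p : ℂ_[p]) ^ n - 1 / (-(p : ℂ_[p]) ^ n) *
      (haarSum p (fun m : ℕ => angle p m ^ p ^ n) n - (1 - 1 / (p : ℂ_[p])))) atTop (𝓝 0) := by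
    refine squeeze_zero_norm' ?_ (tendsto_const_mul_norm_prime_pow (p := p)
      (p ^ 3 / ‖logSeries p (angle p 2)‖))
    filter_upwards [eventually_ne_atTop 0] with n hn
    obtain ⟨k, rfl⟩ := Nat.exists_eq_succ_of_ne_zero hn
    have h := norm_powSum_sub_altSum_le hp k
    have hq : p ^ (k + 1) ≠ 0 := pow_ne_zero _ (Fact.out : p.Prime).ne_zero
    have hD := one_sub_angle_two_pow_ne_zero hp hq
    have hq' : ((p ^ (k + 1) : ℕ) : ℂ_[p]) ≠ 0 := Nat.cast_ne_zero.mpr hq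
    have hl := norm_pos_iff.mpr (logSeries_angle_two_ne_zero hp)
    have hDn := norm_one_sub_angle_two_pow hp (p ^ (k + 1))
    have hh : haarSum p (fun m : ℕ => angle p m ^ p ^ (k + 1)) (k + 1)
        = 1 / ((p ^ (k + 1) : ℕ) : ℂ_[p]) * powSum p (p ^ (k + 1)) := by
      rw [haarSum, powSum, Nat.cast_pow]
    rw [Nat.succ_eq_add_one, hh, ← Nat.cast_pow p (k + 1) (α := ℂ_[p])]
    generalize p ^ (k + 1) = q at *
    have e : -altSum p q / (1 - angle p 2 ^ q) + (1 - 1 / (p : ℂ_[p])) / (q : ℂ_[p])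
        - 1 / (-(q : ℂ_[p])) * (1 / (q : ℂ_[p]) * powSum p q - (1 - 1 / (p : ℂ_[p])))
        = ((1 - angle p 2 ^ q) * powSum p q - (q : ℂ_[p]) ^ 2 * altSum p q)
          / ((q : ℂ_[p]) ^ 2 * (1 - angle p 2 ^ q)) := by
      generalize (1 - 1 / (p : ℂ_[p])) = c
      generalize 1 - angle p 2 ^ q = D at *
      field_simp
      ring
    have hqn := norm_pos_iff.mpr hq'
    rw [e, norm_div, norm_mul, norm_pow, hDn, div_le_iff₀ (by positivity)]
    refine h.trans_eq ?_
    field_simp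
  have h := hdiff.add (tendsto_haarSum_angle_pow_self hp)
  rw [zero_add] at h
  exact h.congr fun n => by ring

theorem tendsto_alt_integral (hp : p ≠ 2) :
    Tendsto (fun n : ℕ => -1 / (1 - angle p 2 ^ p ^ n) *
      (∑ m ∈ Finset.range (p ^ n) with ¬ p ∣ m,
        1 / (m : ℂ_[p]) * angle p m ^ p ^ n * ((-1) ^ m / 2))
      - (1 - 1 / (p : ℂ_[p])) / (-(p : ℂ_[p]) ^ n)) atTop (𝓝 (gammaConst p)) := by
  refine (tendsto_altSum hp).congr fun n => ?_
  have e : altSum p (p ^ n) = ∑ m ∈ Finset.range (p ^ n) with ¬ p ∣ m,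
        1 / (m : ℂ_[p]) * angle p m ^ p ^ n * ((-1) ^ m / 2) := by
    refine Finset.sum_congr rfl fun m hm => ?_
    have := natCast_ne_zero_of_not_dvd (Finset.mem_filter.mp hm).2
    field_simp
  rw [← e]
  ring

lemma sum_Icc_alternating_eq {n : ℕ} (hn : n ≠ 0) :
    ∑ m ∈ Finset.Icc 1 (p ^ n) with ¬ p ∣ m, (-1) ^ (m + 1) / (2 * (m : ℂ_[p])) * angle p m ^ p ^ n
      = -altSum p (p ^ n) := by
  rw [sum_Icc_filter_eq _ hn, altSum, ← Finset.sum_neg_distrib]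
  exact Finset.sum_congr rfl fun m _ => by rw [pow_succ]; ring

theorem tendsto_sum_Icc_alternating (hp : p ≠ 2) :
    Tendsto (fun n : ℕ => 1 / (1 - angle p 2 ^ p ^ n) *
      ((∑ m ∈ Finset.Icc 1 (p ^ n) with ¬ p ∣ m,
          (-1) ^ (m + 1) / (2 * (m : ℂ_[p])) * angle p m ^ p ^ n)
        + (1 - 1 / (p : ℂ_[p])) * (1 - angle p 2 ^ p ^ n) * (1 / (p : ℂ_[p]) ^ n))) atTop
      (𝓝 (gammaConst p)) := by
  refine (tendsto_altSum hp).congr' ?_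
  filter_upwards [eventually_ne_atTop 0] with n hn
  have hD := one_sub_angle_two_pow_ne_zero hp (pow_ne_zero n (Fact.out : p.Prime).ne_zero)
  rw [sum_Icc_alternating_eq hn]
  generalize (1 - 1 / (p : ℂ_[p])) = c
  have hq := pow_ne_zero n (prime_ne_zero (p := p))
  field_simp

/-- The second order expansion of `x^q = exp(L)` with `L = q log x`, obtained from the logarithm
alone: for `u = x^q - 1`, both `L - u + u²/2` and `L² - u² = (L-u)(L+u)` are of third order. -/
lemma norm_log_pow_expansion_le (hp : p ≠ 2) {x : ℂ_[p]} (hx : ‖x - 1‖ ≤ (p : ℝ)⁻¹) (q : ℕ) :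
    ‖1 - x ^ q + q * logSeries p x * (1 + 1 / 2 * q * logSeries p x)‖
      ≤ p * ‖q * logSeries p x‖ ^ 3 := by
  have hxq := norm_pow_sub_one_le hx q
  have hp1 := (one_lt_prime (p := p)).le
  rw [← logSeries_pow hx, norm_logSeries hp hxq]
  have h1 := norm_logSeries_sub_quadratic_le hp hxq
  have h2 := norm_logSeries_sub_le hp hxq
  have h3 := norm_logSeries hp hxq
  have e : 1 - x ^ q + logSeries p (x ^ q) * (1 + 1 / 2 * q * logSeries p x)
      = (logSeries p (x ^ q) - ((x ^ q - 1) - 1 / 2 * (x ^ q - 1) ^ 2))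
        + 1 / 2 * ((logSeries p (x ^ q) - (x ^ q - 1)) * (logSeries p (x ^ q) + (x ^ q - 1))) := by
    rw [logSeries_pow hx]
    field_simp
    ring
  rw [e]
  refine norm_add_le_of_le h1 ?_
  rw [norm_mul, norm_div, norm_one, norm_two hp, div_one, one_mul, norm_mul]
  calc _ ≤ ‖x ^ q - 1‖ ^ 2 * ‖x ^ q - 1‖ := by
        gcongr
        exact norm_add_le_of_le h3.le le_rfl
    _ = 1 * ‖x ^ q - 1‖ ^ 3 := by ring
    _ ≤ _ := by gcongr

theorem tendsto_sum_Icc_alternating_log (hp : p ≠ 2) :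
    Tendsto (fun n : ℕ => 1 / (1 - angle p 2 ^ p ^ n) *
      ((∑ m ∈ Finset.Icc 1 (p ^ n) with ¬ p ∣ m,
          (-1) ^ (m + 1) / (2 * (m : ℂ_[p])) * angle p m ^ p ^ n)
        - (1 - 1 / (p : ℂ_[p])) * logSeries p (angle p 2) *
          (1 + 1 / 2 * (p : ℂ_[p]) ^ n * logSeries p (angle p 2)))) atTop
      (𝓝 (gammaConst p)) := by
  have hdiff : Tendsto (fun n : ℕ => (1 - 1 / (p : ℂ_[p])) * ((1 - angle p 2 ^ p ^ n
      + ((p ^ n : ℕ) : ℂ_[p]) * logSeries p (angle p 2)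
        * (1 + 1 / 2 * ((p ^ n : ℕ) : ℂ_[p]) * logSeries p (angle p 2)))
      / (((p ^ n : ℕ) : ℂ_[p]) * (1 - angle p 2 ^ p ^ n)))) atTop (𝓝 0) := by
    refine squeeze_zero_norm (fun n => ?_) (tendsto_const_mul_norm_prime_pow (p := p)
      (‖1 - 1 / (p : ℂ_[p])‖ * (p * ‖logSeries p (angle p 2)‖ ^ 2)))
    have hq : p ^ n ≠ 0 := pow_ne_zero _ (Fact.out : p.Prime).ne_zero
    have hq' : ((p ^ n : ℕ) : ℂ_[p]) ≠ 0 := Nat.cast_ne_zero.mpr hq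
    have hqn := norm_pos_iff.mpr hq'
    have hl := norm_pos_iff.mpr (logSeries_angle_two_ne_zero hp)
    have h := norm_log_pow_expansion_le hp (norm_angle_sub_one_le (isUnit_two hp)) (p ^ n)
    rw [norm_mul, mul_assoc ‖1 - 1 / (p : ℂ_[p])‖]
    refine mul_le_mul_of_nonneg_left ?_ (norm_nonneg _)
    rw [norm_div, norm_mul ((p ^ n : ℕ) : ℂ_[p]), norm_one_sub_angle_two_pow hp,
      div_le_iff₀ (by positivity)]
    refine h.trans_eq ?_
    rw [norm_mul]
    ring
  have h := (tendsto_sum_Icc_alternating hp).sub hdiff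
  rw [sub_zero] at h
  refine h.congr fun n => ?_
  have hD := one_sub_angle_two_pow_ne_zero hp (pow_ne_zero n (Fact.out : p.Prime).ne_zero)
  have hq := pow_ne_zero n (prime_ne_zero (p := p))
  push_cast
  generalize (∑ m ∈ Finset.Icc 1 (p ^ n) with ¬ p ∣ m,
          (-1) ^ (m + 1) / (2 * (m : ℂ_[p])) * angle p m ^ p ^ n) = S
  generalize (1 - 1 / (p : ℂ_[p])) = c
  generalize 1 - angle p 2 ^ p ^ n = D at *
  field_simp
  ring

/-! ### Standard parts of hyperfinite expressions -/

section Ultrapower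

variable {ι : Type*} {U : Ultrafilter ι}

lemma hasStandardPart_coe {K : Type*} [PseudoMetricSpace K] {F : ι → K} {a : K}
    (h : Tendsto F U (𝓝 a)) : HasStandardPart (F : Germ (U : Filter ι) K) a :=
  fun _ hε => Metric.tendsto_nhds.mp h _ hε

lemma IsInfinite.tendsto {f : ι → ℕ} (h : IsInfinite (f : Germ (U : Filter ι) ℕ)) :
    Tendsto f U atTop :=
  tendsto_atTop.mpr fun b => Germ.coe_le.mp (h b).le

end Ultrapower

end PadicEM

end

/-! ### Assembly, with standard parts read as limits along the ultrafilter -/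

open PadicEM
theorem mainTheorem9 (p : ℕ) [Fact p.Prime] (hp : p ≠ 2) {ι : Type*} (U : Ultrafilter ι) :
    -- the zeta function is well defined near `1` and has the Laurent expansion
    -- `(1 - 1/p)/(s-1) + γ_p + ...`
    (∀ᶠ s in 𝓝 (1 : ℂ_[p]), VolkenbornIntegrable p (fun x => anglePow p x (1 - s))) ∧
    (∃ g : ℂ_[p] → ℂ_[p], AnalyticAt ℂ_[p] g 1 ∧ g 1 = gammaConst p ∧
      ∀ᶠ s in 𝓝[≠] (1 : ℂ_[p]), zeta p 1 s = (1 - 1 / (p : ℂ_[p])) / (s - 1) + g s) ∧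
    -- standard formula with generalized Bernoulli numbers
    Tendsto (fun n : ℕ => 1 / (p : ℂ_[p]) ^ n *
        (1 - 1 / (p : ℂ_[p]) - genBernoulli (omega p)⁻¹ (p ^ n)))
      atTop (𝓝 (gammaConst p)) ∧
    -- standard version of the series
    Tendsto (fun m : ℕ => -∑ n ∈ Finset.Icc 1 m, 1 / (n : ℂ_[p]) *
        ∑ j ∈ Finset.range (n + 1), (n.choose j : ℂ_[p]) * (-1) ^ (j + 1) *
          genBernoulli ((omega p)⁻¹ ^ j) j)
      atTop (𝓝 (gammaConst p)) ∧
    -- the `p`-adic Gamma function and its derivative at `1`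
    (Continuous (Gamma p) ∧ ∀ n : ℕ, Gamma p n = gammaNat p n) ∧
    Tendsto (fun h : ℤ_[p] => (toCp p (Gamma p (1 + h)) - toCp p (Gamma p 1)) / toCp p h)
      (𝓝[≠] 0) (𝓝 (gammaConst p)) ∧
    -- series for the linear term of `(s-1) ζ_{p,1}(s)` at `s = 1`
    HasSum (fun j : ℕ => 1 / (p : ℂ_[p]) * ∑ a ∈ Finset.Icc 1 (p - 1),
        (-1) ^ (j + 1) / ((j : ℂ_[p]) + 1) * (bernoulli (j + 1) : ℂ_[p]) *
          ((p : ℂ_[p]) ^ (j + 1) / (a : ℂ_[p]) ^ (j + 1)))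
      (gammaConst p - 1 / (p : ℂ_[p]) * ∑ a ∈ Finset.Icc 1 (p - 1),
        -logSeries p (angle p (a : ℤ_[p]))) ∧
    -- nonstandard formulas, for every infinite `N`
    (∀ N : Germ (U : Filter ι) ℕ, IsInfinite N →
      -- powers `⟨y⟩^(p^N)`
      HasStandardPart
        (1 / (-hyperPow p N) *
          (haarIntegral p (Germ.map (fun n m : ℕ => angle p m ^ (p ^ n)) N) N -
            ((1 - 1 / (p : ℂ_[p]) : ℂ_[p]) : Germ (U : Filter ι) ℂ_[p])))
        (gammaConst p) ∧
      HasStandardPart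
        (-1 / hyperPow p N *
          (1 / hyperPow p N *
              Germ.map (fun n : ℕ => ∑ m ∈ Finset.Icc 1 (p ^ n) with ¬ p ∣ m,
                angle p m ^ (p ^ n)) N -
            ((1 - 1 / (p : ℂ_[p]) : ℂ_[p]) : Germ (U : Filter ι) ℂ_[p])))
        (gammaConst p) ∧
      -- Bernoulli numbers
      HasStandardPart
        (-1 / hyperPow p N *
          (Germ.map (fun n : ℕ => genBernoulli (omega p)⁻¹ (p ^ n)) N -
            ((1 - 1 / (p : ℂ_[p]) : ℂ_[p]) : Germ (U : Filter ι) ℂ_[p])))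
        (gammaConst p) ∧
      -- logarithms
      HasStandardPart
        (-haarIntegral p
          ((fun m : ℕ => logSeries p (angle p m) : ℕ → ℂ_[p]) :
            Germ (U : Filter ι) (ℕ → ℂ_[p])) N)
        (gammaConst p) ∧
      HasStandardPart
        (-(1 / hyperPow p N *
          Germ.map (fun n : ℕ => ∑ m ∈ Finset.Icc 1 (p ^ n) with ¬ p ∣ m, padicLog p m) N))
        (gammaConst p) ∧
      -- Gamma function
      HasStandardPart
        (-(1 / hyperPow p N *
          Germ.map (fun n : ℕ => padicLog p (Gamma p ((p : ℤ_[p]) ^ n))) N))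
        (gammaConst p) ∧
      HasStandardPart
        (1 / hyperPow p N *
          (Germ.map (fun n : ℕ => toCp p (Gamma p ((p : ℤ_[p]) ^ n + 1))) N - (-1)))
        (gammaConst p) ∧
      HasStandardPart
        (1 / hyperPow p N *
          (Germ.map (fun n : ℕ => ((p ^ n).factorial : ℂ_[p]) /
            (((p ^ (n - 1)).factorial : ℂ_[p]) * (p : ℂ_[p]) ^ (p ^ (n - 1)))) N + 1))
        (gammaConst p) ∧
      -- binomial expansions up to any sufficiently large `M`
      (∃ M₀ : Germ (U : Filter ι) ℕ, ∀ M : Germ (U : Filter ι) ℕ, M₀ ≤ M →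
        HasStandardPart
          (-(1 / hyperPow p N *
            haarIntegral p (Germ.map₂ (fun n M m : ℕ => ∑ k ∈ Finset.Icc 1 M,
              ((p ^ n).choose k : ℂ_[p]) * (angle p m - 1) ^ k) N M) N))
          (gammaConst p) ∧
        HasStandardPart
          (-haarIntegral p (Germ.map (fun M m : ℕ => ∑ n ∈ Finset.Icc 1 M,
            (-1) ^ (n + 1) / (n : ℂ_[p]) * ∑ j ∈ Finset.range (n + 1), (n.choose j : ℂ_[p]) *
              ((m : ℂ_[p]) / teich p m) ^ j * (-1) ^ (n - j)) M) N)
          (gammaConst p) ∧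
        HasStandardPart
          (-Germ.map₂ (fun N M : ℕ => ∑ n ∈ Finset.Icc 1 M,
            (-1) ^ (n + 1) / (n : ℂ_[p]) * ∑ j ∈ Finset.range (n + 1), (n.choose j : ℂ_[p]) *
              (-1) ^ (n - j) *
                haarSum p (fun m => (teich p m)⁻¹ ^ j * (m : ℂ_[p]) ^ j) N) N M)
          (gammaConst p)) ∧
      HasStandardPart
        (-Germ.map (fun M : ℕ => ∑ n ∈ Finset.Icc 1 M, 1 / (n : ℂ_[p]) *
          ∑ j ∈ Finset.range (n + 1), (n.choose j : ℂ_[p]) * (-1) ^ (j + 1) *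
            genBernoulli ((omega p)⁻¹ ^ j) j) N)
        (gammaConst p) ∧
      -- regularized Bernoulli measure
      HasStandardPart
        (-1 / (1 - Germ.map (fun n : ℕ => angle p 2 ^ (p ^ n)) N) *
            altIntegral p (Germ.map (fun n m : ℕ => 1 / (m : ℂ_[p]) * angle p m ^ (p ^ n)) N) N -
          ((1 - 1 / (p : ℂ_[p]) : ℂ_[p]) : Germ (U : Filter ι) ℂ_[p]) / (-hyperPow p N))
        (gammaConst p) ∧
      HasStandardPart
        (1 / (1 - Germ.map (fun n : ℕ => angle p 2 ^ (p ^ n)) N) *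
          (Germ.map (fun n : ℕ => ∑ m ∈ Finset.Icc 1 (p ^ n) with ¬ p ∣ m,
              (-1) ^ (m + 1) / (2 * (m : ℂ_[p])) * angle p m ^ (p ^ n)) N +
            ((1 - 1 / (p : ℂ_[p]) : ℂ_[p]) : Germ (U : Filter ι) ℂ_[p]) *
              (1 - Germ.map (fun n : ℕ => angle p 2 ^ (p ^ n)) N) * (1 / hyperPow p N)))
        (gammaConst p) ∧
      HasStandardPart
        (1 / (1 - Germ.map (fun n : ℕ => angle p 2 ^ (p ^ n)) N) *
          Germ.map (fun n : ℕ => (∑ m ∈ Finset.Icc 1 (p ^ n) with ¬ p ∣ m,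
              (-1) ^ (m + 1) / (2 * (m : ℂ_[p])) * angle p m ^ (p ^ n)) -
            (1 - 1 / (p : ℂ_[p])) * logSeries p (angle p 2) *
              (1 + 1 / 2 * (p : ℂ_[p]) ^ n * logSeries p (angle p 2))) N)
        (gammaConst p)) := by
  refine ⟨volkenbornIntegrable_anglePow hp, exists_analyticAt_zeta_eq hp,
    tendsto_genBernoulli_prime_pow hp, tendsto_sum_genBernoulli hp,
    ⟨continuous_Gamma hp, Gamma_natCast hp⟩, tendsto_Gamma_slope hp, hasSum_bernoulli hp, ?_⟩
  intro N
  induction N using Germ.inductionOn with | _ f => ?_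
  intro hN
  have hf := hN.tendsto
  -- The threshold `M₀ = p^N` makes the binomial expansion of `⟨y⟩^(p^N)` complete; the two
  -- logarithmic formulas only use that such an `M` is infinite.
  refine ⟨?_, ?_, ?_, ?_, ?_, ?_, ?_, ?_, ⟨Germ.map (fun n : ℕ => p ^ n) f, ?_⟩, ?_, ?_, ?_, ?_⟩
  · exact hasStandardPart_coe ((tendsto_haarSum_angle_pow_self hp).comp hf)
  · exact hasStandardPart_coe ((tendsto_sum_Icc_angle_pow_self hp).comp hf)
  · exact hasStandardPart_coe ((tendsto_neg_genBernoulli_prime_pow hp).comp hf)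
  · exact hasStandardPart_coe ((tendsto_neg_haarSum_log hp).comp hf)
  · exact hasStandardPart_coe ((tendsto_sum_Icc_padicLog hp).comp hf)
  · exact hasStandardPart_coe ((tendsto_padicLog_Gamma hp).comp hf)
  · exact hasStandardPart_coe ((tendsto_Gamma_prime_pow_add_one hp).comp hf)
  · exact hasStandardPart_coe ((tendsto_factorial_div hp).comp hf)
  · intro M
    induction M using Germ.inductionOn with | _ g => ?_
    intro hM
    have hle : ∀ᶠ i in (U : Filter ι), p ^ f i ≤ g i := Germ.coe_le.mp hM
    have hg : Tendsto g U atTop :=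
      tendsto_atTop_mono' _ (hle.mono fun i hi =>
        (Nat.lt_pow_self (Fact.out : p.Prime).one_lt).le.trans hi) hf
    exact ⟨hasStandardPart_coe (tendsto_haarSum_sum_choose hp hf hle),
      hasStandardPart_coe (tendsto_haarSum_sum_log hp hf hg),
      hasStandardPart_coe (tendsto_sum_log_haarSum hp hf hg)⟩
  -- Here `N` itself is the truncation index; as it is an arbitrary infinite element, every infinite
  -- index is covered.
  · exact hasStandardPart_coe ((tendsto_sum_genBernoulli hp).comp hf)
  · exact hasStandardPart_coe ((tendsto_alt_integral hp).comp hf)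
  · exact hasStandardPart_coe ((tendsto_sum_Icc_alternating hp).comp hf)
  · exact hasStandardPart_coe ((tendsto_sum_Icc_alternating_log hp).comp hf)
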